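/- Let $d\ge 1$, let $\Omega\subset\mathbb R^d$ be a bounded open set with Lipschitz boundary (connectedness is not needed), and let $T>0$. Write $(\cdot,\cdot)$ and $(\cdot,\cdot)_{\partial\Omega}$ for the inner products of $L^2(\Omega)$ and $L^2(\partial\Omega)$; functions in $H^1(\Omega)$ are evaluated on $\partial\Omega$ through their trace. Assume: 1. $\eta:[0,T]\times\overline\Omega\to\mathbb R$ is measurable and $0<\eta_0\le\eta\le\eta_1<\infty$ a.e. for some constants $\eta_0,\eta_1$; 2. $\kappa:[0,T]\times\overline\Omega\to\mathbb R$ is measurable, $0<\kappa_0\le\kappa\le\kappa_1<\infty$ a.e., and its (weak) time derivative satisfies $|\partial_t\kappa|\le\kappa_1'<\infty$ a.e., for some constants $\kappa_0,\kappa_1,\kappa_1'$; 3. $F:\mathbb R\to\mathbb R$ is Lipschitz continuous; 4. $\tilde u_0\in H^1(\Omega)$; 5. $g\in H^1((0,T);L^2(\partial\Omega))$ and $G:=g/\kappa\in H^1((0,T);L^2(\partial\Omega))$; 6. $p\in C([0,T];L^2(\Omega))$ and $\omega(t):=\int_\Omega p(t,x)\,dx\neq0$ for all $t\in[0,T]$;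 7. $m\in H^1(0,T)$. ("A.e." on $\overline\Omega$ refers to Lebesgue measure in $\Omega$ and to surface measure on $\partial\Omega$.) **Existence and uniqueness.** There is exactly one couple $\{u,h\}$ with $$u\in C([0,T];H^1(\Omega)),\qquad \partial_t u\in L^2((0,T);H^1(\Omega)),\qquad h\in L^2(0,T),$$ such that $u(0)=\tilde u_0$ and, for a.a. $t\in(0,T)$, $$h(t)=\frac1{\omega(t)}\Big[m'(t)-\int_{\partial\Omega}\eta(t)\,\partial_tG(t)\,d\Gamma-\int_{\partial\Omega}g(t)\,d\Gamma-\int_\Omega F(u(t))\,dx\Big]$$ and, for every $\varphi\in H^1(\Omega)$, $$(\partial_tu(t),\varphi)+(\eta(t)\nabla\partial_tu(t),\nabla\varphi)+(\kappa(t)\nabla u(t),\nabla\varphi)=h(t)(p(t),\varphi)+(F(u(t)),\varphi)+(\eta(t)\partial_tG(t),\varphi)_{\partial\Omega}+(g(t),\varphi)_{\partial\Omega}.$$ (Here $h$ is unique up to equality a.e. in $(0,T)$.) **Convergence of the Rothe approximations.** For $n\ge1$ put $\tau=T/n$ and $t_i=i\tau$. Let $p_i=p(t_i)$, $\omega_i=\omega(t_i)$,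 and for $z\in\{\eta,\kappa,g,\partial_tG,m'\}$ let $z_i=\frac1\tau\int_{t_{i-1}}^{t_i}z(s)\,ds$. Write $\delta u_i=(u_i-u_{i-1})/\tau$. Then for every $n\ge 1$ there are unique $u_0,\dots,u_n\in H^1(\Omega)$ and $h_1,\dots,h_n\in\mathbb R$ with $u_0=\tilde u_0$ and, for $1\le i\le n$, $$h_i=\frac1{\omega_i}\Big[(m')_i-\int_{\partial\Omega}\eta_i(\partial_tG)_i\,d\Gamma-\int_{\partial\Omega}g_i\,d\Gamma-\int_\Omega F(u_{i-1})\,dx\Big],$$ $$(\delta u_i,\varphi)+(\eta_i\nabla\delta u_i,\nabla\varphi)+(\kappa_i\nabla u_i,\nabla\varphi)=h_i(p_i,\varphi)+(F(u_{i-1}),\varphi)+(\eta_i(\partial_tG)_i,\varphi)_{\partial\Omega}+(g_i,\varphi)_{\partial\Omega}\quad\forall\varphi\in H^1(\Omega).$$ Let $U_n(0)=\overline U_n(0)=\tilde u_0$ and, for $t\in(t_{i-1},t_i]$, let $U_n(t)=u_{i-1}+(t-t_{i-1})\delta u_i$, $\overline U_n(t)=u_i$, $\overline h_n(t)=h_i$.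 Then, as $n\to\infty$ and for the whole sequence: $U_n\to u$ in $C([0,T];L^2(\Omega))$; $U_n(t)\rightharpoonup u(t)$ and $\overline U_n(t)\rightharpoonup u(t)$ weakly in $H^1(\Omega)$ for every $t\in[0,T]$; $\partial_tU_n\rightharpoonup\partial_tu$ weakly in $L^2((0,T);H^1(\Omega))$; and $\overline h_n\rightharpoonup h$ weakly in $L^2(0,T)$. -/

import Mathlib

open MeasureTheory Set Filter Topology
open scoped ContDiff InnerProductSpace

noncomputable section

namespace PseudoParabolic

/-- The space `ℝ^d` with its Euclidean norm. -/
abbrev Space (d : ℕ) := EuclideanSpace ℝ (Fin d)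

/-! ### Lipschitz domains and the surface measure -/

/-- A bounded open set `Ω ⊆ ℝ^d` with Lipschitz boundary: near every boundary point, for a suitable
unit vector `e`, the set `Ω` is the part lying below the graph (in direction `e`) of a Lipschitz
function on the hyperplane orthogonal to `e`. Connectedness is not required. -/
structure IsBoundedLipschitz {d : ℕ} (Ω : Set (Space d)) : Prop where
  isOpen : IsOpen Ω
  isBounded : Bornology.IsBounded Ω
  lipschitz_graph : ∀ x ∈ frontier Ω, ∃ (e : Space d) (K : NNReal) (γ : ↥(ℝ ∙ e)ᗮ → ℝ) (r : ℝ),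
    ‖e‖ = 1 ∧ LipschitzWith K γ ∧ 0 < r ∧
      ∀ y ∈ Metric.ball x r, (y ∈ Ω ↔ ⟪e, y⟫_ℝ < γ ((ℝ ∙ e)ᗮ.orthogonalProjectionOnto y))

/-- The surface measure of `∂Ω`: the `(d-1)`-dimensional Hausdorff measure (normalised so as to
agree with Lebesgue measure on hyperplanes), restricted to `∂Ω`. -/
def surface {d : ℕ} (Ω : Set (Space d)) : Measure (Space d) :=
  (Measure.euclideanHausdorffMeasure (d - 1)).restrict (frontier Ω)

/-- The measure that gives "almost every point of `closure Ω`" its meaning: Lebesgue measure inside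
`Ω`, surface measure on `∂Ω`. -/
def closureMeasure {d : ℕ} (Ω : Set (Space d)) : Measure (Space d) :=
  volume.restrict Ω + surface Ω

/-- `L²(Ω)`. -/
abbrev L2 {d : ℕ} (Ω : Set (Space d)) := Lp ℝ 2 (volume.restrict Ω)

/-- `L²(Ω; ℝ^d)`. -/
abbrev L2Vec {d : ℕ} (Ω : Set (Space d)) := Lp (Space d) 2 (volume.restrict Ω)

/-- `L²(∂Ω)`. -/
abbrev L2Bdry {d : ℕ} (Ω : Set (Space d)) := Lp ℝ 2 (surface Ω)

/-! ### The Sobolev space `H¹(Ω)` and its trace -/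

/-- `w` is the weak gradient of `v` in `Ω`. -/
def IsWeakGradient {d : ℕ} {Ω : Set (Space d)} (v : L2 Ω) (w : L2Vec Ω) : Prop :=
  ∀ φ : Space d → ℝ, ContDiff ℝ ∞ φ → HasCompactSupport φ → tsupport φ ⊆ Ω →
    ∀ y : Space d, ∫ x in Ω, v x * fderiv ℝ φ x y = -∫ x in Ω, ⟪w x, y⟫_ℝ * φ x

theorem integrable_mul_test {d : ℕ} {Ω : Set (Space d)} (v : L2 Ω) {ψ : Space d → ℝ}
    (hψ : Continuous ψ) (hc : HasCompactSupport ψ) :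
    Integrable (fun x => v x * ψ x) (volume.restrict Ω) :=
  (Lp.memLp v).integrable_mul
    ((hψ.memLp_of_hasCompactSupport (μ := volume) (p := 2) hc).restrict Ω)

theorem integrable_inner_mul_test {d : ℕ} {Ω : Set (Space d)} (w : L2Vec Ω) (y : Space d)
    {ψ : Space d → ℝ} (hψ : Continuous ψ) (hc : HasCompactSupport ψ) :
    Integrable (fun x => ⟪w x, y⟫_ℝ * ψ x) (volume.restrict Ω) :=
  ((Lp.memLp w).inner_const y).integrable_mul
    ((hψ.memLp_of_hasCompactSupport (μ := volume) (p := 2) hc).restrict Ω)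

theorem continuous_fderiv_apply_const {d : ℕ} {φ : Space d → ℝ} (hφ : ContDiff ℝ ∞ φ)
    (y : Space d) : Continuous fun x => fderiv ℝ φ x y :=
  (hφ.continuous_fderiv (by simp)).clm_apply continuous_const

/-- `H¹(Ω)`, realised as the space of pairs `(v, ∇v)` in `L²(Ω) × L²(Ω; ℝ^d)`. It carries the norm
`(‖v‖² + ‖∇v‖²)^(1/2)` and the corresponding inner product. -/
def H1 {d : ℕ} (Ω : Set (Space d)) : Submodule ℝ (WithLp 2 (L2 Ω × L2Vec Ω)) where
  carrier := {q | IsWeakGradient q.fst q.snd}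
  zero_mem' := by
    intro φ hφ hc hs y
    have h1 : ∫ x in Ω, ((0 : L2 Ω) x) * fderiv ℝ φ x y = 0 := by
      rw [← integral_zero (Space d) ℝ (μ := volume.restrict Ω)]
      apply integral_congr_ae
      filter_upwards [Lp.coeFn_zero ℝ 2 (volume.restrict Ω)] with x hx
      rw [hx]; simp
    have h2 : ∫ x in Ω, ⟪(0 : L2Vec Ω) x, y⟫_ℝ * φ x = 0 := by
      rw [← integral_zero (Space d) ℝ (μ := volume.restrict Ω)]
      apply integral_congr_ae
      filter_upwards [Lp.coeFn_zero (Space d) 2 (volume.restrict Ω)] with x hx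
      rw [hx]; simp
    change ∫ x in Ω, ((0 : L2 Ω) x) * fderiv ℝ φ x y = -∫ x in Ω, ⟪(0 : L2Vec Ω) x, y⟫_ℝ * φ x
    rw [h1, h2, neg_zero]
  add_mem' := by
    intro a b ha hb φ hφ hc hs y
    have hφ' := continuous_fderiv_apply_const hφ y
    have hc' : HasCompactSupport fun x => fderiv ℝ φ x y :=
      (hc.fderiv ℝ).comp_left (g := fun L : Space d →L[ℝ] ℝ => L y) (by simp)
    have h1 : ∫ x in Ω, (a.fst + b.fst : L2 Ω) x * fderiv ℝ φ x y =
        (∫ x in Ω, a.fst x * fderiv ℝ φ x y) + ∫ x in Ω, b.fst x * fderiv ℝ φ x y := by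
      rw [← integral_add (integrable_mul_test _ hφ' hc') (integrable_mul_test _ hφ' hc')]
      apply integral_congr_ae
      filter_upwards [Lp.coeFn_add a.fst b.fst] with x hx
      rw [hx]; simp [add_mul]
    have h2 : ∫ x in Ω, ⟪(a.snd + b.snd : L2Vec Ω) x, y⟫_ℝ * φ x =
        (∫ x in Ω, ⟪a.snd x, y⟫_ℝ * φ x) + ∫ x in Ω, ⟪b.snd x, y⟫_ℝ * φ x := by
      rw [← integral_add (integrable_inner_mul_test _ y hφ.continuous hc)
        (integrable_inner_mul_test _ y hφ.continuous hc)]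
      apply integral_congr_ae
      filter_upwards [Lp.coeFn_add a.snd b.snd] with x hx
      rw [hx]; simp [inner_add_left, add_mul]
    change ∫ x in Ω, (a.fst + b.fst : L2 Ω) x * fderiv ℝ φ x y =
      -∫ x in Ω, ⟪(a.snd + b.snd : L2Vec Ω) x, y⟫_ℝ * φ x
    rw [h1, h2, ha φ hφ hc hs y, hb φ hφ hc hs y]
    ring
  smul_mem' := by
    intro c a ha φ hφ hc hs y
    have h1 : ∫ x in Ω, (c • a.fst : L2 Ω) x * fderiv ℝ φ x y =
        c * ∫ x in Ω, a.fst x * fderiv ℝ φ x y := by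
      rw [← integral_const_mul]
      apply integral_congr_ae
      filter_upwards [Lp.coeFn_smul c a.fst] with x hx
      rw [hx]; simp [mul_assoc]
    have h2 : ∫ x in Ω, ⟪(c • a.snd : L2Vec Ω) x, y⟫_ℝ * φ x =
        c * ∫ x in Ω, ⟪a.snd x, y⟫_ℝ * φ x := by
      rw [← integral_const_mul]
      apply integral_congr_ae
      filter_upwards [Lp.coeFn_smul c a.snd] with x hx
      rw [hx]; simp [real_inner_smul_left, mul_assoc]
    change ∫ x in Ω, (c • a.fst : L2 Ω) x * fderiv ℝ φ x y =
      -∫ x in Ω, ⟪(c • a.snd : L2Vec Ω) x, y⟫_ℝ * φ x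
    rw [h1, h2, ha φ hφ hc hs y]
    ring

theorem isClosed_H1 {d : ℕ} (Ω : Set (Space d)) :
    IsClosed (H1 Ω : Set (WithLp 2 (L2 Ω × L2Vec Ω))) := by
  rw [← isSeqClosed_iff_isClosed]
  intro a b ha hab φ hφ hc hs y
  have hψ := continuous_fderiv_apply_const hφ y
  have hcψ : HasCompactSupport fun x => fderiv ℝ φ x y :=
    (hc.fderiv ℝ).comp_left (g := fun L : Space d →L[ℝ] ℝ => L y) (by simp)
  have m1 : MemLp (fun x => fderiv ℝ φ x y) 2 (volume.restrict Ω) :=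
    (hψ.memLp_of_hasCompactSupport (μ := volume) (p := 2) hcψ).restrict Ω
  have m2 : MemLp (fun x => φ x • y) 2 (volume.restrict Ω) :=
    ((hφ.continuous.smul continuous_const).memLp_of_hasCompactSupport (μ := volume) (p := 2)
      (hc.smul_right (f' := fun _ => y))).restrict Ω
  have e1 : ∀ v : L2 Ω, ∫ x in Ω, v x * fderiv ℝ φ x y = ⟪v, m1.toLp _⟫_ℝ := by
    intro v
    rw [L2.inner_def]
    apply integral_congr_ae
    filter_upwards [m1.coeFn_toLp] with x hx
    rw [hx]; simp [mul_comm]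
  have e2 : ∀ w : L2Vec Ω, ∫ x in Ω, ⟪w x, y⟫_ℝ * φ x = ⟪w, m2.toLp _⟫_ℝ := by
    intro w
    rw [L2.inner_def]
    apply integral_congr_ae
    filter_upwards [m2.coeFn_toLp] with x hx
    rw [hx, real_inner_smul_right, mul_comm]
  have key : ∀ n, ⟪(a n).fst, m1.toLp _⟫_ℝ = -⟪(a n).snd, m2.toLp _⟫_ℝ := by
    intro n
    rw [← e1, ← e2]
    exact ha n φ hφ hc hs y
  rw [e1, e2]
  have c1 : Tendsto (fun n => (a n).fst) atTop (𝓝 b.fst) :=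
    ((WithLp.prod_continuous_ofLp 2 _ _).fst.tendsto b).comp hab
  have c2 : Tendsto (fun n => (a n).snd) atTop (𝓝 b.snd) :=
    ((WithLp.prod_continuous_ofLp 2 _ _).snd.tendsto b).comp hab
  refine tendsto_nhds_unique (c1.inner tendsto_const_nhds) ?_
  simp only [key]
  exact (c2.inner tendsto_const_nhds).neg

instance instCompleteSpaceH1 {d : ℕ} (Ω : Set (Space d)) : CompleteSpace (H1 Ω) :=
  (isClosed_H1 Ω).completeSpace_coe

/-- The underlying `L²(Ω)` function of an element of `H¹(Ω)`. -/
def toL2 {d : ℕ} {Ω : Set (Space d)} (v : H1 Ω) : L2 Ω := v.1.fst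

/-- The weak gradient of an element of `H¹(Ω)`. -/
def wgrad {d : ℕ} {Ω : Set (Space d)} (v : H1 Ω) : L2Vec Ω := v.1.snd

/-- `w ∈ L²(∂Ω)` is the trace of `v ∈ H¹(Ω)`: some sequence of functions that are smooth up to the
boundary converges to `v` in `H¹(Ω)` while its boundary values converge to `w` in `L²(∂Ω)`. -/
def IsTrace {d : ℕ} {Ω : Set (Space d)} (v : H1 Ω) (w : L2Bdry Ω) : Prop :=
  ∃ ψ : ℕ → Space d → ℝ, (∀ n, ContDiff ℝ ∞ (ψ n)) ∧
    Tendsto (fun n => eLpNorm (fun x => ψ n x - toL2 v x) 2 (volume.restrict Ω)) atTop (𝓝 0) ∧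
    Tendsto (fun n => eLpNorm (fun x => gradient (ψ n) x - wgrad v x) 2 (volume.restrict Ω))
      atTop (𝓝 0) ∧
    Tendsto (fun n => eLpNorm (fun x => ψ n x - w x) 2 (surface Ω)) atTop (𝓝 0)

open Classical in
/-- The trace `H¹(Ω) → L²(∂Ω)`. On a bounded Lipschitz domain every `v ∈ H¹(Ω)` has exactly one
trace (the trace theorem); the value `0` is only a default for irregular sets. -/
def trace {d : ℕ} {Ω : Set (Space d)} (v : H1 Ω) : L2Bdry Ω :=
  if h : ∃ w, IsTrace v w then h.choose else 0

/-! ### Time-dependent functions -/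

/-- `z'` is the weak derivative of `z : (0,T) → X`. -/
def HasWeakTimeDeriv {X : Type*} [NormedAddCommGroup X] [NormedSpace ℝ X] (T : ℝ)
    (z z' : ℝ → X) : Prop :=
  ∀ φ : ℝ → ℝ, ContDiff ℝ ∞ φ → HasCompactSupport φ → tsupport φ ⊆ Ioo 0 T →
    ∫ t in Ioo 0 T, deriv φ t • z t = -∫ t in Ioo 0 T, φ t • z' t

/-- `z ∈ L²((0,T); X)`. -/
def MemL2Time {X : Type*} [NormedAddCommGroup X] (T : ℝ) (z : ℝ → X) : Prop :=
  MemLp z 2 (volume.restrict (Ioo 0 T))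

/-- `z ∈ H¹((0,T); X)`, with weak derivative `z'`. -/
structure MemH1Time {X : Type*} [NormedAddCommGroup X] [NormedSpace ℝ X] (T : ℝ)
    (z z' : ℝ → X) : Prop where
  mem : MemL2Time T z
  mem_deriv : MemL2Time T z'
  hasWeakDeriv : HasWeakTimeDeriv T z z'

/-! ### The inverse problem -/

/-- The given functions: coefficients `η`, `κ`, nonlinearity `F`, initial value `u₀`, boundary flux
`g`, the quotient `G = g/κ` and its time derivative `dG`, the spatial source profile `p`, the
measurement `m` and its derivative `dm`. How they are related is part of `Admissible`. -/
structure Data {d : ℕ} (Ω : Set (Space d)) where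
  η : ℝ → Space d → ℝ
  κ : ℝ → Space d → ℝ
  F : ℝ → ℝ
  u₀ : H1 Ω
  g : ℝ → L2Bdry Ω
  G : ℝ → L2Bdry Ω
  dG : ℝ → L2Bdry Ω
  p : ℝ → L2 Ω
  m : ℝ → ℝ
  dm : ℝ → ℝ

/-- `ω(t) = ∫_Ω p(t,x) dx`. -/
def Data.omega {d : ℕ} {Ω : Set (Space d)} (D : Data Ω) (t : ℝ) : ℝ := ∫ x in Ω, D.p t x

/-- The assumptions on the data on the time interval `[0,T]`. -/
structure Data.Admissible {d : ℕ} {Ω : Set (Space d)} (D : Data Ω) (T : ℝ) : Prop where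
  η_meas : AEMeasurable (fun z : ℝ × Space d => D.η z.1 z.2)
    ((volume.restrict (Ioo 0 T)).prod (closureMeasure Ω))
  η_bound : ∃ η₀ η₁ : ℝ, 0 < η₀ ∧
    ∀ᵐ z ∂((volume.restrict (Ioo 0 T)).prod (closureMeasure Ω)),
      η₀ ≤ D.η z.1 z.2 ∧ D.η z.1 z.2 ≤ η₁
  κ_meas : AEMeasurable (fun z : ℝ × Space d => D.κ z.1 z.2)
    ((volume.restrict (Ioo 0 T)).prod (closureMeasure Ω))
  κ_bound : ∃ κ₀ κ₁ : ℝ, 0 < κ₀ ∧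
    ∀ᵐ z ∂((volume.restrict (Ioo 0 T)).prod (closureMeasure Ω)),
      κ₀ ≤ D.κ z.1 z.2 ∧ D.κ z.1 z.2 ≤ κ₁
  κ_deriv : ∃ (dκ : ℝ → Space d → ℝ) (κ₁' : ℝ),
    AEMeasurable (fun z : ℝ × Space d => dκ z.1 z.2)
      ((volume.restrict (Ioo 0 T)).prod (closureMeasure Ω)) ∧
    (∀ᵐ z ∂((volume.restrict (Ioo 0 T)).prod (closureMeasure Ω)), |dκ z.1 z.2| ≤ κ₁') ∧
    ∀ᵐ x ∂(closureMeasure Ω), HasWeakTimeDeriv T (fun t => D.κ t x) (fun t => dκ t x)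
  F_lipschitz : ∃ L : NNReal, LipschitzWith L D.F
  g_mem : ∃ dg : ℝ → L2Bdry Ω, MemH1Time T D.g dg
  G_eq : ∀ᵐ t ∂(volume.restrict (Ioo 0 T)),
    ∀ᵐ x ∂(surface Ω), D.G t x = D.g t x / D.κ t x
  G_mem : MemH1Time T D.G D.dG
  p_cont : ContinuousOn D.p (Icc 0 T)
  omega_ne : ∀ t ∈ Icc 0 T, D.omega t ≠ 0
  m_mem : MemH1Time T D.m D.dm

/-- The formula
`(1/ω) [ m' - ∫_{∂Ω} η ∂ₜG - ∫_{∂Ω} g - ∫_Ω F(v) ]`. -/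
def sourceValue {d : ℕ} {Ω : Set (Space d)} (F : ℝ → ℝ) (om dm : ℝ) (η : Space d → ℝ)
    (dG g : L2Bdry Ω) (v : H1 Ω) : ℝ :=
  (1 / om) * (dm - (∫ x, η x * dG x ∂(surface Ω)) - (∫ x, g x ∂(surface Ω))
    - ∫ x in Ω, F (toL2 v x))

/-- The variational equation at one instant, with velocity `w`, state `v`, reaction term evaluated
at `z`, and source value `h`, for every test function `φ ∈ H¹(Ω)`:
`(w,φ) + (η∇w,∇φ) + (κ∇v,∇φ) = h (p,φ) + (F(z),φ) + (η ∂ₜG,φ)_{∂Ω} + (g,φ)_{∂Ω}`. -/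
def VariationalEq {d : ℕ} {Ω : Set (Space d)} (F : ℝ → ℝ) (η κ : Space d → ℝ)
    (dG g : L2Bdry Ω) (p : L2 Ω) (h : ℝ) (w v z : H1 Ω) : Prop :=
  ∀ φ : H1 Ω,
    (∫ x in Ω, toL2 w x * toL2 φ x)
      + (∫ x in Ω, η x * ⟪wgrad w x, wgrad φ x⟫_ℝ)
      + (∫ x in Ω, κ x * ⟪wgrad v x, wgrad φ x⟫_ℝ)
    = h * (∫ x in Ω, p x * toL2 φ x)
      + (∫ x in Ω, F (toL2 z x) * toL2 φ x)
      + (∫ x, η x * dG x * trace φ x ∂(surface Ω))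
      + ∫ x, g x * trace φ x ∂(surface Ω)

/-- `{u, h}`, with `∂ₜu = du`, is a weak solution on `[0,T]` of the reformulated inverse problem, in
the class `u ∈ C([0,T]; H¹(Ω))`, `∂ₜu ∈ L²((0,T); H¹(Ω))`, `h ∈ L²(0,T)`. -/
structure Data.IsWeakSolution {d : ℕ} {Ω : Set (Space d)} (D : Data Ω) (T : ℝ)
    (u du : ℝ → H1 Ω) (h : ℝ → ℝ) : Prop where
  u_cont : ContinuousOn u (Icc 0 T)
  du_mem : MemL2Time T du
  du_deriv : HasWeakTimeDeriv T u du
  h_mem : MemL2Time T h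
  initial : u 0 = D.u₀
  h_eq : ∀ᵐ t ∂(volume.restrict (Ioo 0 T)),
    h t = sourceValue D.F (D.omega t) (D.dm t) (D.η t) (D.dG t) (D.g t) (u t)
  u_eq : ∀ᵐ t ∂(volume.restrict (Ioo 0 T)),
    VariationalEq D.F (D.η t) (D.κ t) (D.dG t) (D.g t) (D.p t) (h t) (du t) (u t) (u t)

/-! ### Rothe's method -/

/-- The mean of `z` over the `i`-th of the `n` subintervals `[(i-1)τ, iτ]`, `τ = T/n`, `i ≥ 1`. -/
def stepMean {X : Type*} [NormedAddCommGroup X] [NormedSpace ℝ X] (T : ℝ) (n : ℕ) (z : ℝ → X)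
    (i : ℕ) : X :=
  (T / n)⁻¹ • ∫ s in (((i : ℝ) - 1) * (T / n))..((i : ℝ) * (T / n)), z s

/-- The backward difference quotient `δUᵢ = (Uᵢ - Uᵢ₋₁)/τ`, `τ = T/n`, `i ≥ 1`. -/
def backwardDiff {X : Type*} [AddCommGroup X] [Module ℝ X] (T : ℝ) (n : ℕ) (U : ℕ → X)
    (i : ℕ) : X :=
  (T / n)⁻¹ • (U i - U (i - 1))

/-- `U 0, …, U n` and `H 1, …, H n` solve the semi-implicit time-discrete problem with `n` steps of
length `τ = T/n`. The data at step `i` are the values at `iτ` of `p` and `ω`, which are continuous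
in time, and the means over `[(i-1)τ, iτ]` of the other data, which are only given for a.e. time. -/
structure Data.IsRotheScheme {d : ℕ} {Ω : Set (Space d)} (D : Data Ω) (T : ℝ) (n : ℕ)
    (U : ℕ → H1 Ω) (H : ℕ → ℝ) : Prop where
  initial : U 0 = D.u₀
  source : ∀ i, 1 ≤ i → i ≤ n →
    H i = sourceValue D.F (D.omega (i * (T / n))) (stepMean T n D.dm i)
      (fun x => stepMean T n (fun s => D.η s x) i) (stepMean T n D.dG i) (stepMean T n D.g i)
      (U (i - 1))
  step : ∀ i, 1 ≤ i → i ≤ n →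
    VariationalEq D.F (fun x => stepMean T n (fun s => D.η s x) i)
      (fun x => stepMean T n (fun s => D.κ s x) i) (stepMean T n D.dG i) (stepMean T n D.g i)
      (D.p (i * (T / n))) (H i) (backwardDiff T n U i) (U i) (U (i - 1))

/-- The index `i` with `t ∈ ((i-1)τ, iτ]`, `τ = T/n` (and `0` for `t ≤ 0`). -/
def stepIndex (T : ℝ) (n : ℕ) (t : ℝ) : ℕ := ⌈t / (T / n)⌉₊

/-- The piecewise constant function with value `V i` on `((i-1)τ, iτ]`, and `V 0` for `t ≤ 0`. -/
def rotheStep {X : Type*} (T : ℝ) (n : ℕ) (V : ℕ → X) (t : ℝ) : X := V (stepIndex T n t)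

/-- The piecewise linear function with value `Uᵢ₋₁ + (t - (i-1)τ) δUᵢ` on `((i-1)τ, iτ]`, and
`U₀` for `t ≤ 0`. -/
def rotheLinear {X : Type*} [AddCommGroup X] [Module ℝ X] (T : ℝ) (n : ℕ) (U : ℕ → X)
    (t : ℝ) : X :=
  if t ≤ 0 then U 0
  else U (stepIndex T n t - 1) +
    (t - ((stepIndex T n t : ℝ) - 1) * (T / n)) • backwardDiff T n U (stepIndex T n t)

/-- The Rothe functions built from the discrete solutions `U n`, `H n` converge to `{u, h}`:
the piecewise linear interpolants converge in `C([0,T]; L²(Ω))`; these and the piecewise constant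
ones converge weakly in `H¹(Ω)` at every time; the time derivatives of the piecewise linear ones
(that is, the piecewise constant functions with values `δUᵢ`) converge weakly in
`L²((0,T); H¹(Ω))`; the discrete sources converge weakly in `L²(0,T)`. -/
structure RotheConverges {d : ℕ} {Ω : Set (Space d)} (T : ℝ) (U : ℕ → ℕ → H1 Ω) (H : ℕ → ℕ → ℝ)
    (u du : ℝ → H1 Ω) (h : ℝ → ℝ) : Prop where
  uniform_L2 : TendstoUniformlyOn (fun n t => toL2 (rotheLinear T n (U n) t))
    (fun t => toL2 (u t)) atTop (Icc 0 T)
  linear_weak : ∀ t ∈ Icc 0 T, ∀ φ : H1 Ω,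
    Tendsto (fun n => ⟪rotheLinear T n (U n) t, φ⟫_ℝ) atTop (𝓝 ⟪u t, φ⟫_ℝ)
  step_weak : ∀ t ∈ Icc 0 T, ∀ φ : H1 Ω,
    Tendsto (fun n => ⟪rotheStep T n (U n) t, φ⟫_ℝ) atTop (𝓝 ⟪u t, φ⟫_ℝ)
  deriv_weak : ∀ φ : ℝ → H1 Ω, MemL2Time T φ →
    Tendsto (fun n => ∫ t in Ioo 0 T, ⟪rotheStep T n (backwardDiff T n (U n)) t, φ t⟫_ℝ) atTop
      (𝓝 (∫ t in Ioo 0 T, ⟪du t, φ t⟫_ℝ))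
  source_weak : ∀ φ : ℝ → ℝ, MemL2Time T φ →
    Tendsto (fun n => ∫ t in Ioo 0 T, rotheStep T n (H n) t * φ t) atTop
      (𝓝 (∫ t in Ioo 0 T, h t * φ t))

end PseudoParabolic

end

open PseudoParabolic

/-!
The formula for `h` makes `h(t)` an affine expression in `∫ F(u(t))`, so it can be inserted into the
variational equation. With `V = H¹(Ω)` and the Riesz isomorphism the problem becomes

  `A(t) u' + K(t) u = f(u) + b(t) + (ν(t) - j(u)) q(t)`, `u(0) = u₀`,

where `A(t)` represents `(w, φ) + (η(t)∇w, ∇φ)`, `K(t)` represents `(κ(t)∇u, ∇φ)`, the nonlinearities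
`f` and `j` are globally Lipschitz, `q = p/ω` is continuous, and `b`, `ν` are square integrable.

*Well-posedness.* The derivative `u'` is acted upon by `A(t)`, which is coercive on all of `V`, hence
invertible with a uniformly bounded inverse. The problem is therefore an ordinary differential
equation in `V` with a right-hand side that is Lipschitz in `u` and square integrable in `t`, and a
contraction argument in a weighted supremum norm gives existence and uniqueness on `[0,T]`
(`IsCaratheodory.exists_unique`, `EvolutionProblem.Regular.exists_unique_solution`). The coefficients
are merely measurable in time; that `A(t)⁻¹` is again measurable is seen by writing it as a limit of
Richardson iterates (`stronglyMeasurable_inverse`). The weak time derivative is related to the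
integrated equation by the lemma of du Bois-Reymond (`HasWeakTimeDeriv.eq_integral`).

*Convergence.* Compactness is not needed, because the Rothe functions converge strongly. The scheme
uses exact averages of the coefficients, so the average of the differential equation over a time cell
shows that the exact solution satisfies the scheme up to a residual controlled by the oscillation of
`u`, `u'`, `q` over the cell and by the error of `η_i (∂ₜG)_i` as an average of `η ∂ₜG`
(`EvolutionProblem.Regular.norm_residual_le`); this tends to zero in `L²(0,T)`
(`EvolutionProblem.Regular.l2Null_consistency`). Coercivity of the averaged `A` and a discrete
Gronwall argument bound the error by it (`EvolutionProblem.Regular.norm_backwardDiff_sub_le`,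
`EvolutionProblem.Regular.norm_scheme_sub_le`). Hence the nodal values converge uniformly in `H¹(Ω)`,
and the difference quotients and the `h_i` converge in `L²`
(`EvolutionProblem.Regular.scheme_convergence`), which is more than the convergences asserted
(`rotheConverges_of_strong`).

*Traces.* The boundary terms are bounded functionals on `H¹(Ω)` because the trace is a bounded
operator (`exists_traceL`). This rests on the trace inequality for smooth functions, proved in graph
charts by integrating along the direction of the chart (`exists_lintegral_surface_sq_le`), and on the
density of functions smooth up to the boundary (`exists_smooth_approx`): a localised function is
mollified with a kernel whose mass is shifted in the direction of the chart, so that only values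
inside `Ω` enter.
-/


/-! ### The trace inequality -/

namespace PseudoParabolic

open scoped ENNReal NNReal

section Graph

variable {d : ℕ} {e : Space d}

theorem finrank_orthogonal_unit (he : ‖e‖ = 1) : Module.finrank ℝ (ℝ ∙ e)ᗮ = d - 1 := by
  have h := Submodule.finrank_add_finrank_orthogonal (ℝ ∙ e)
  rw [finrank_span_singleton (by rintro rfl; simp at he), finrank_euclideanSpace_fin] at h
  omega

theorem coe_proj_add_inner_smul (he : ‖e‖ = 1) (x : Space d) :
    ((ℝ ∙ e)ᗮ.orthogonalProjectionOnto x : Space d) + ⟪e, x⟫_ℝ • e = x := by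
  have h := Submodule.starProjection_add_starProjection_orthogonal (K := ℝ ∙ e) x
  rw [Submodule.starProjection_unit_singleton ℝ he] at h
  rw [add_comm]
  exact h

theorem inner_unit_orthogonal (y : (ℝ ∙ e)ᗮ) : ⟪e, (y : Space d)⟫_ℝ = 0 :=
  Submodule.mem_orthogonal_singleton_iff_inner_right.1 y.2

theorem proj_coe_add_smul (y : (ℝ ∙ e)ᗮ) (t : ℝ) :
    (ℝ ∙ e)ᗮ.orthogonalProjectionOnto ((y : Space d) + t • e) = y := by
  rw [map_add, map_smul, Submodule.orthogonalProjectionOnto_mem_subspace_eq_self,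
    Submodule.orthogonalProjectionOnto_orthogonalComplement_singleton_eq_zero]
  simp

theorem inner_coe_add_smul (he : ‖e‖ = 1) (y : (ℝ ∙ e)ᗮ) (t : ℝ) :
    ⟪e, (y : Space d) + t • e⟫_ℝ = t := by
  rw [inner_add_right, inner_unit_orthogonal, real_inner_smul_right, real_inner_self_eq_norm_sq, he]
  simp

/-- The splitting `e^⊥ × ℝ ≃ ℝ^d`, `(y, t) ↦ y + t e`. -/
noncomputable def splitEquiv (he : ‖e‖ = 1) : ((ℝ ∙ e)ᗮ × ℝ) ≃L[ℝ] Space d :=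
  LinearEquiv.toContinuousLinearEquiv
    { toFun := fun z => (z.1 : Space d) + z.2 • e
      map_add' := fun z w => by simp only [Prod.fst_add, Prod.snd_add, Submodule.coe_add]; module
      map_smul' := fun c z => by
        simp only [Prod.smul_fst, Prod.smul_snd, Submodule.coe_smul, RingHom.id_apply, smul_eq_mul]
        module
      invFun := fun x => ((ℝ ∙ e)ᗮ.orthogonalProjectionOnto x, ⟪e, x⟫_ℝ)
      left_inv := fun z => by
        ext1
        · exact proj_coe_add_smul _ _
        · exact inner_coe_add_smul he _ _
      right_inv := fun x => coe_proj_add_inner_smul he x }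

/-- Fubini along a direction; the constant comes from the uniqueness of Haar measure, and its value
is irrelevant. -/
theorem exists_lintegral_lines_le (he : ‖e‖ = 1) : ∃ c : ℝ≥0, ∀ g : Space d → ℝ≥0∞, Measurable g →
    ∫⁻ y : (ℝ ∙ e)ᗮ, (∫⁻ t : ℝ, g (y + t • e)) ∂(Measure.euclideanHausdorffMeasure (d - 1)) =
      c * ∫⁻ x, g x := by
  have hH : (Measure.euclideanHausdorffMeasure (d - 1) : Measure (ℝ ∙ e)ᗮ).IsAddHaarMeasure := by
    rw [← finrank_orthogonal_unit he]; infer_instance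
  let ν : Measure (Space d) := Measure.map (splitEquiv he)
    ((Measure.euclideanHausdorffMeasure (d - 1) : Measure (ℝ ∙ e)ᗮ).prod volume)
  have hν : ν.IsAddHaarMeasure := ContinuousLinearEquiv.isAddHaarMeasure_map _ _
  refine ⟨Measure.addHaarScalarFactor ν volume, fun g hg => ?_⟩
  have h1 : ∫⁻ x, g x ∂ν = Measure.addHaarScalarFactor ν volume * ∫⁻ x, g x := by
    conv_lhs => rw [Measure.isAddLeftInvariant_eq_smul ν volume]
    rw [lintegral_smul_measure]; rfl
  rw [← h1, lintegral_map hg (splitEquiv he).continuous.measurable,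
    lintegral_prod (fun z => g (splitEquiv he z))
      (hg.comp (splitEquiv he).continuous.measurable).aemeasurable]
  rfl

/-- The parametrisation `y ↦ y + γ(y) e` of the graph of `γ`. -/
noncomputable def graphMap (e : Space d) (γ : (ℝ ∙ e)ᗮ → ℝ) (y : (ℝ ∙ e)ᗮ) : Space d :=
  (y : Space d) + γ y • e

theorem lipschitzWith_graphMap (he : ‖e‖ = 1) {γ : (ℝ ∙ e)ᗮ → ℝ} {K : ℝ≥0}
    (hγ : LipschitzWith K γ) : LipschitzWith (1 + K) (graphMap e γ) := by
  refine (LipschitzWith.subtype_val _).add (LipschitzWith.of_dist_le_mul fun x y => ?_)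
  rw [dist_eq_norm, ← sub_smul, norm_smul, he, mul_one, ← dist_eq_norm]
  exact hγ.dist_le_mul x y

theorem euclideanHausdorffMeasure_image_le {X Y : Type*} [MetricSpace X] [MeasurableSpace X]
    [BorelSpace X] [MetricSpace Y] [MeasurableSpace Y] [BorelSpace Y] {f : X → Y} {K : ℝ≥0}
    (h : LipschitzWith K f) (k : ℕ) (s : Set X) :
    Measure.euclideanHausdorffMeasure k (f '' s) ≤
      ((K ^ (k : ℝ) : ℝ≥0) : ℝ≥0∞) * Measure.euclideanHausdorffMeasure k s := by
  have := h.hausdorffMeasure_image_le (d := k) (by positivity) s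
  rw [Measure.euclideanHausdorffMeasure_def, Measure.euclideanHausdorffMeasure_def,
    Measure.smul_apply, Measure.smul_apply, ENNReal.smul_def, ENNReal.smul_def, smul_eq_mul,
    smul_eq_mul, ENNReal.coe_rpow_of_nonneg _ (by positivity)]
  calc _ ≤ _ := mul_le_mul_right this _
    _ = _ := by ring

/-- The area bound for Lipschitz graphs. -/
theorem lintegral_graph_le (he : ‖e‖ = 1) {γ : (ℝ ∙ e)ᗮ → ℝ} {K : ℝ≥0}
    (hγ : LipschitzWith K γ) {B : Set (Space d)}
    (hBγ : ∀ x ∈ B, ⟪e, x⟫_ℝ = γ ((ℝ ∙ e)ᗮ.orthogonalProjectionOnto x)) {g : Space d → ℝ≥0∞}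
    (hg : Measurable g) :
    ∫⁻ x in B, g x ∂(Measure.euclideanHausdorffMeasure (d - 1)) ≤
      (((1 + K) ^ ((d - 1 : ℕ) : ℝ) : ℝ≥0) : ℝ≥0∞) *
        ∫⁻ y in graphMap e γ ⁻¹' B, g (graphMap e γ y)
          ∂(Measure.euclideanHausdorffMeasure (d - 1)) := by
  have hL := lipschitzWith_graphMap he hγ
  set H : Measure (ℝ ∙ e)ᗮ := Measure.euclideanHausdorffMeasure (d - 1)
  set c : ℝ≥0∞ := (((1 + K) ^ ((d - 1 : ℕ) : ℝ) : ℝ≥0) : ℝ≥0∞)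
  have hm : Measurable (graphMap e γ) := hL.continuous.measurable
  have hle : (Measure.euclideanHausdorffMeasure (d - 1) : Measure (Space d)).restrict B ≤
      c • Measure.map (graphMap e γ) (H.restrict (graphMap e γ ⁻¹' B)) := by
    refine Measure.le_intro fun s hs _ => ?_
    rw [Measure.restrict_apply hs, Measure.smul_apply, Measure.map_apply hm hs,
      Measure.restrict_apply (hm hs), smul_eq_mul]
    have himg : s ∩ B ⊆ graphMap e γ '' (graphMap e γ ⁻¹' s ∩ graphMap e γ ⁻¹' B) := by
      intro x hx
      have hx' : graphMap e γ ((ℝ ∙ e)ᗮ.orthogonalProjectionOnto x) = x := by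
        rw [graphMap, ← hBγ x hx.2, coe_proj_add_inner_smul he]
      exact ⟨_, by simpa [hx'] using hx, hx'⟩
    exact (measure_mono himg).trans (euclideanHausdorffMeasure_image_le hL _ _)
  calc _ ≤ ∫⁻ x, g x ∂(c • Measure.map (graphMap e γ) (H.restrict (graphMap e γ ⁻¹' B))) :=
        lintegral_mono' hle le_rfl
    _ = _ := by rw [lintegral_smul_measure, lintegral_map hg hm, smul_eq_mul]

end Graph

section TraceInequality

variable {d : ℕ} {Ω : Set (Space d)}

/-- Inside a chart the boundary is the graph. -/
theorem frontier_eq_graph {e x : Space d} {γ : (ℝ ∙ e)ᗮ → ℝ} (hγ : Continuous γ) {r : ℝ}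
    (hΩ : IsOpen Ω)
    (h : ∀ y ∈ Metric.ball x r, (y ∈ Ω ↔ ⟪e, y⟫_ℝ < γ ((ℝ ∙ e)ᗮ.orthogonalProjectionOnto y)))
    {z : Space d} (hz : z ∈ frontier Ω) (hzr : z ∈ Metric.ball x r) :
    ⟪e, z⟫_ℝ = γ ((ℝ ∙ e)ᗮ.orthogonalProjectionOnto z) := by
  rw [hΩ.frontier_eq] at hz
  refine le_antisymm ?_ (not_lt.1 fun hlt => hz.2 ((h z hzr).2 hlt))
  by_contra! hlt
  have hc : Continuous fun y : Space d => γ ((ℝ ∙ e)ᗮ.orthogonalProjectionOnto y) :=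
    hγ.comp (ContinuousLinearMap.continuous _)
  have ho : IsOpen {y : Space d | γ ((ℝ ∙ e)ᗮ.orthogonalProjectionOnto y) < ⟪e, y⟫_ℝ} :=
    isOpen_lt hc (continuous_const.inner continuous_id)
  obtain ⟨y, ⟨hy1, hy2⟩, hy3⟩ := mem_closure_iff.1 hz.1 _ (ho.inter Metric.isOpen_ball) ⟨hlt, hzr⟩
  exact lt_asymm hy1 ((h y hy2).1 hy3)

/-- The trace estimate for a function supported in a single graph chart: the boundary value is the
integral of the derivative along the inward ray, which stays in `Ω` as long as it stays in the
chart. -/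
theorem exists_lintegral_frontier_le_of_support {e x : Space d} (he : ‖e‖ = 1)
    {γ : (ℝ ∙ e)ᗮ → ℝ} {K : ℝ≥0} (hγ : LipschitzWith K γ) {r : ℝ} (hΩ : IsOpen Ω)
    (h : ∀ y ∈ Metric.ball x r, (y ∈ Ω ↔ ⟪e, y⟫_ℝ < γ ((ℝ ∙ e)ᗮ.orthogonalProjectionOnto y))) :
    ∃ C : ℝ≥0, ∀ f : Space d → ℝ, ContDiff ℝ 1 f → HasCompactSupport f →
      tsupport f ⊆ Metric.ball x r →
      ∫⁻ z in frontier Ω ∩ Metric.ball x r, ‖f z‖ₑ ∂(Measure.euclideanHausdorffMeasure (d - 1)) ≤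
        C * ∫⁻ z in Ω, ‖fderiv ℝ f z‖ₑ := by
  obtain ⟨c, hc⟩ := exists_lintegral_lines_le he
  refine ⟨(1 + K) ^ ((d - 1 : ℕ) : ℝ) * c, fun f hf hfc hfs => ?_⟩
  have hcf : Continuous fun z => ‖fderiv ℝ f z‖ₑ := (hf.continuous_fderiv one_ne_zero).enorm
  have hB : MeasurableSet (frontier Ω ∩ Metric.ball x r) :=
    isClosed_frontier.measurableSet.inter Metric.isOpen_ball.measurableSet
  set H : Measure (ℝ ∙ e)ᗮ := Measure.euclideanHausdorffMeasure (d - 1)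
  have hgm : Measurable (Ω.indicator fun z => ‖fderiv ℝ f z‖ₑ) :=
    hcf.measurable.indicator hΩ.measurableSet
  have key : ∀ y ∈ graphMap e γ ⁻¹' (frontier Ω ∩ Metric.ball x r),
      ‖f (graphMap e γ y)‖ₑ ≤ ∫⁻ t : ℝ, (Ω.indicator fun z => ‖fderiv ℝ f z‖ₑ) (y + t • e) := by
    intro y hy
    have hline : ContDiff ℝ 1 fun t : ℝ => f (y + t • e) :=
      hf.comp (contDiff_const.add (contDiff_id.smul contDiff_const))
    have hemb : IsClosedEmbedding fun t : ℝ => (y : Space d) + t • e := by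
      refine Isometry.isClosedEmbedding (Isometry.of_dist_eq fun s t => ?_)
      rw [dist_add_left, dist_eq_norm, ← sub_smul, norm_smul, he, mul_one, dist_eq_norm]
    have hsupp : HasCompactSupport fun t : ℝ => f (y + t • e) := hfc.comp_isClosedEmbedding hemb
    refine (hsupp.enorm_le_lintegral_Ici_deriv hline (γ y)).trans ?_
    rw [Measure.restrict_congr_set Iio_ae_eq_Iic.symm, ← lintegral_indicator measurableSet_Iio]
    refine lintegral_mono fun t => ?_
    by_cases ht : t < γ y
    swap
    · simp [indicator, ht]
    rw [indicator_of_mem (show t ∈ Iio (γ y) from ht)]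
    have hd : deriv (fun t : ℝ => f (y + t • e)) t = fderiv ℝ f (y + t • e) e := by
      have h1 : HasDerivAt (fun t : ℝ => (y : Space d) + t • e) e t := by
        simpa using ((hasDerivAt_id t).smul_const e).const_add (y : Space d)
      exact ((hf.differentiable one_ne_zero _).hasFDerivAt.comp_hasDerivAt t h1).deriv
    rw [hd]
    have hb : ‖fderiv ℝ f (y + t • e) e‖ₑ ≤ ‖fderiv ℝ f (y + t • e)‖ₑ := by
      rw [← ofReal_norm, ← ofReal_norm]
      refine ENNReal.ofReal_le_ofReal ?_
      simpa [he] using (fderiv ℝ f (y + t • e)).le_opNorm e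
    by_cases hm : (y : Space d) + t • e ∈ Metric.ball x r
    · have : (y : Space d) + t • e ∈ Ω := by
        rw [h _ hm, inner_coe_add_smul he, proj_coe_add_smul]; exact ht
      rwa [indicator_of_mem this]
    · have : fderiv ℝ f (y + t • e) = 0 := by
        by_contra h0
        exact hm (hfs (support_fderiv_subset ℝ h0))
      simp [this]
  calc _ ≤ _ := lintegral_graph_le he hγ (fun z hz => frontier_eq_graph hγ.continuous hΩ h hz.1 hz.2)
          hf.continuous.enorm.measurable
    _ ≤ (((1 + K) ^ ((d - 1 : ℕ) : ℝ) : ℝ≥0) : ℝ≥0∞) *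
          ∫⁻ y, (∫⁻ t : ℝ, (Ω.indicator fun z => ‖fderiv ℝ f z‖ₑ) (y + t • e)) ∂H := by
        refine mul_le_mul_right ?_ _
        refine (setLIntegral_mono' ((lipschitzWith_graphMap he hγ).continuous.measurable hB)
          key).trans (setLIntegral_le_lintegral _ _)
    _ = _ := by
        rw [hc _ hgm, lintegral_indicator hΩ.measurableSet, ENNReal.coe_mul, mul_assoc]

/-- The trace inequality near a boundary point, from the estimate in `L¹` for the square. -/
theorem exists_lintegral_sq_frontier_le_near {x : Space d} (hΩ : IsBoundedLipschitz Ω)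
    (hx : x ∈ frontier Ω) :
    ∃ r : ℝ, 0 < r ∧ ∃ C : ℝ≥0, ∀ ψ : Space d → ℝ, ContDiff ℝ 1 ψ →
      ∫⁻ z in frontier Ω ∩ Metric.ball x r, ‖ψ z‖ₑ ^ 2
          ∂(Measure.euclideanHausdorffMeasure (d - 1)) ≤
        C * ((∫⁻ z in Ω, ‖ψ z‖ₑ ^ 2) + ∫⁻ z in Ω, ‖fderiv ℝ ψ z‖ₑ ^ 2) := by
  obtain ⟨e, K, γ, r, he, hγ, hr, hgr⟩ := hΩ.lipschitz_graph x hx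
  obtain ⟨C, hC⟩ := exists_lintegral_frontier_le_of_support he hγ hΩ.isOpen hgr
  let ζ : ContDiffBump x := ⟨r / 4, r / 2, by positivity, by linarith⟩
  have hζ : ContDiff ℝ 1 ζ := ζ.contDiff
  obtain ⟨N, hN⟩ : ∃ N, ∀ z, ‖fderiv ℝ ζ z‖ ≤ N :=
    (hζ.continuous_fderiv one_ne_zero).bounded_above_of_compact_support
      (ζ.hasCompactSupport.fderiv ℝ)
  have hN0 : 0 ≤ N := (norm_nonneg _).trans (hN x)
  refine ⟨r / 4, by positivity, C * (1 + 2 * N).toNNReal, fun ψ hψ => ?_⟩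
  -- the chart estimate is applied to the square of the localised function
  let f : Space d → ℝ := fun z => (ζ z * ψ z) ^ 2
  have hf : ContDiff ℝ 1 f := (hζ.mul hψ).pow 2
  have hts : tsupport f ⊆ Metric.closedBall x (r / 2) := by
    refine (closure_mono fun z hz => ?_).trans ζ.tsupport_eq.le
    contrapose! hz
    simp [f, Function.notMem_support.1 hz]
  have hfc : HasCompactSupport f :=
    HasCompactSupport.of_support_subset_isCompact (isCompact_closedBall x (r / 2))
      ((subset_tsupport f).trans hts)
  have hder : ∀ z, ‖fderiv ℝ f z‖ₑ ≤
      ((1 + 2 * N).toNNReal : ℝ≥0∞) * (‖ψ z‖ₑ ^ 2 + ‖fderiv ℝ ψ z‖ₑ ^ 2) := by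
    intro z
    have h1 : HasFDerivAt (fun z => ζ z * ψ z) (ζ z • fderiv ℝ ψ z + ψ z • fderiv ℝ ζ z) z :=
      ((hζ.differentiable one_ne_zero z).hasFDerivAt).mul
        ((hψ.differentiable one_ne_zero z).hasFDerivAt)
    have h2 : fderiv ℝ f z = (2 * (ζ z * ψ z)) • (ζ z • fderiv ℝ ψ z + ψ z • fderiv ℝ ζ z) := by
      simpa [f] using (h1.pow 2).fderiv
    have h3 : ‖fderiv ℝ f z‖ ≤ (1 + 2 * N) * (‖ψ z‖ ^ 2 + ‖fderiv ℝ ψ z‖ ^ 2) := by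
      rw [h2, norm_smul]
      have hz0 : 0 ≤ ζ z := ζ.nonneg
      have hz1 : ζ z ≤ 1 := ζ.le_one
      have a1 : ‖2 * (ζ z * ψ z)‖ ≤ 2 * ‖ψ z‖ := by
        rw [norm_mul, norm_mul, Real.norm_of_nonneg hz0]
        simp only [Real.norm_ofNat]
        nlinarith [norm_nonneg (ψ z)]
      have a2 : ‖ζ z • fderiv ℝ ψ z + ψ z • fderiv ℝ ζ z‖ ≤ ‖fderiv ℝ ψ z‖ + ‖ψ z‖ * N := by
        refine (norm_add_le _ _).trans ?_
        rw [norm_smul, norm_smul, Real.norm_of_nonneg hz0]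
        gcongr
        · nlinarith [norm_nonneg (fderiv ℝ ψ z)]
        · exact hN z
      calc _ ≤ 2 * ‖ψ z‖ * (‖fderiv ℝ ψ z‖ + ‖ψ z‖ * N) := by gcongr
        _ ≤ _ := by nlinarith [sq_nonneg (‖ψ z‖ - ‖fderiv ℝ ψ z‖), sq_nonneg ‖ψ z‖,
                      mul_nonneg hN0 (sq_nonneg ‖fderiv ℝ ψ z‖)]
    rw [← ofReal_norm, ← ofReal_norm, ← ofReal_norm, ← ENNReal.ofReal_pow (norm_nonneg _),
      ← ENNReal.ofReal_pow (norm_nonneg _), ← ENNReal.ofReal_add (by positivity) (by positivity)]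
    change _ ≤ ENNReal.ofReal _ * _
    rw [← ENNReal.ofReal_mul (by positivity)]
    exact ENNReal.ofReal_le_ofReal h3
  calc _ ≤ ∫⁻ z in frontier Ω ∩ Metric.ball x (r / 4), ‖f z‖ₑ
          ∂(Measure.euclideanHausdorffMeasure (d - 1)) := by
        refine setLIntegral_mono hf.continuous.enorm.measurable fun z hz => ?_
        have : ζ z = 1 := ζ.one_of_mem_closedBall (Metric.ball_subset_closedBall hz.2)
        simp [f, this]
    _ ≤ ∫⁻ z in frontier Ω ∩ Metric.ball x r, ‖f z‖ₑ
          ∂(Measure.euclideanHausdorffMeasure (d - 1)) :=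
        lintegral_mono_set (inter_subset_inter_right _ (Metric.ball_subset_ball (by linarith)))
    _ ≤ C * ∫⁻ z in Ω, ‖fderiv ℝ f z‖ₑ := hC f hf hfc
        (hts.trans (Metric.closedBall_subset_ball (by linarith)))
    _ ≤ C * ∫⁻ z in Ω, ((1 + 2 * N).toNNReal : ℝ≥0∞) * (‖ψ z‖ₑ ^ 2 + ‖fderiv ℝ ψ z‖ₑ ^ 2) := by
        gcongr with z; exact hder z
    _ = _ := by
        rw [lintegral_const_mul' _ _ ENNReal.coe_ne_top,
          lintegral_add_left (hψ.continuous.enorm.measurable.pow_const 2), ENNReal.coe_mul, mul_assoc]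

/-- The trace inequality for functions that are smooth up to the boundary. -/
theorem exists_lintegral_surface_sq_le (hΩ : IsBoundedLipschitz Ω) :
    ∃ C : ℝ≥0, ∀ ψ : Space d → ℝ, ContDiff ℝ 1 ψ →
      ∫⁻ z, ‖ψ z‖ₑ ^ 2 ∂(surface Ω) ≤
        C * ((∫⁻ z in Ω, ‖ψ z‖ₑ ^ 2) + ∫⁻ z in Ω, ‖fderiv ℝ ψ z‖ₑ ^ 2) := by
  have hcomp : IsCompact (frontier Ω) :=
    (hΩ.isBounded.isCompact_closure).of_isClosed_subset isClosed_frontier frontier_subset_closure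
  refine hcomp.induction_on (p := fun s => ∃ C : ℝ≥0, ∀ ψ : Space d → ℝ, ContDiff ℝ 1 ψ →
      ∫⁻ z in s, ‖ψ z‖ₑ ^ 2 ∂(Measure.euclideanHausdorffMeasure (d - 1)) ≤
        C * ((∫⁻ z in Ω, ‖ψ z‖ₑ ^ 2) + ∫⁻ z in Ω, ‖fderiv ℝ ψ z‖ₑ ^ 2)) ?_ ?_ ?_ ?_
  · exact ⟨0, by simp⟩
  · rintro s t hst ⟨C, hC⟩
    exact ⟨C, fun ψ hψ => (lintegral_mono_set hst).trans (hC ψ hψ)⟩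
  · rintro s t ⟨C, hC⟩ ⟨C', hC'⟩
    refine ⟨C + C', fun ψ hψ => (lintegral_union_le _ _ _).trans ?_⟩
    rw [ENNReal.coe_add, add_mul]
    exact add_le_add (hC ψ hψ) (hC' ψ hψ)
  · intro x hx
    obtain ⟨r, hr, h⟩ := exists_lintegral_sq_frontier_le_near hΩ hx
    exact ⟨_, inter_mem_nhdsWithin _ (Metric.ball_mem_nhds x hr), h⟩

theorem surface_univ_lt_top (hΩ : IsBoundedLipschitz Ω) : surface Ω univ < ⊤ := by
  obtain ⟨C, hC⟩ := exists_lintegral_surface_sq_le hΩ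
  have h := hC (fun _ => 1) contDiff_const
  simp only [enorm_one, one_pow, lintegral_const, one_mul, fderiv_fun_const, Pi.zero_apply] at h
  refine h.trans_lt (ENNReal.mul_lt_top ENNReal.coe_lt_top ?_)
  have hv : volume Ω < ⊤ := hΩ.isBounded.measure_lt_top
  simpa using ⟨hv, ENNReal.mul_lt_top (ENNReal.pow_lt_top enorm_lt_top) hv⟩

end TraceInequality

end PseudoParabolic

/-! ### Mollification and local approximation -/

namespace PseudoParabolic

open scoped ENNReal NNReal

section Mollification

variable {d : ℕ} {F : Type*} [NormedAddCommGroup F]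

/-- Translations are continuous in `L²`. -/
theorem tendsto_eLpNorm_translate_sub {f : Space d → F} (hf : MemLp f 2 volume) :
    Tendsto (fun t : Space d => eLpNorm (fun y => f (y - t) - f y) 2 volume) (𝓝 0) (𝓝 0) := by
  let g : Space d → C(Space d, Space d) := fun t => ⟨fun y => y - t, by fun_prop⟩
  have hg : Continuous g :=
    (ContinuousMap.curry ⟨fun z : Space d × Space d => z.2 - z.1, by fun_prop⟩).continuous
  have hgm : ∀ t, MeasurePreserving (g t) (volume : Measure (Space d)) volume :=
    fun t => measurePreserving_sub_right volume t
  have hc := (continuousAt_const (y := hf.toLp f)).compMeasurePreservingLp (hg.continuousAt (x := 0))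
    hgm (by norm_num : (2 : ℝ≥0∞) ≠ ⊤)
  have h0 : Tendsto (fun t => Lp.compMeasurePreserving (g t) (hgm t) (hf.toLp f)) (𝓝 0)
      (𝓝 (hf.toLp f)) := by
    convert hc.tendsto using 2
    refine Lp.ext ?_
    filter_upwards [Lp.coeFn_compMeasurePreserving (hf.toLp f) (hgm 0)] with y hy
    rw [hy]; simp [g]
  rw [Lp.tendsto_Lp_iff_tendsto_eLpNorm'] at h0
  refine h0.congr fun t => eLpNorm_congr_ae ?_
  filter_upwards [Lp.coeFn_compMeasurePreserving (hf.toLp f) (hgm t), hf.coeFn_toLp,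
    (hgm t).quasiMeasurePreserving.ae_eq_comp hf.coeFn_toLp] with y h1 h2 h3
  simp only [Pi.sub_apply, h1, h2]
  exact congrArg (· - f y) h3

variable [NormedSpace ℝ F]

/-- Convolution of `f` with the kernel `ρ`. -/
noncomputable def mollify (ρ : Space d → ℝ) (f : Space d → F) (y : Space d) : F :=
  ∫ t, ρ t • f (y - t)

/-- A smooth probability density supported in the ball of radius `δ` about the origin. It is not
required to be symmetric, so that it may shift the mass in a prescribed direction. -/
structure IsMollifier (ρ : Space d → ℝ) (δ : ℝ) : Prop where
  contDiff : ContDiff ℝ ∞ ρ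
  hasCompactSupport : HasCompactSupport ρ
  nonneg : ∀ t, 0 ≤ ρ t
  integral_eq_one : ∫ t, ρ t = 1
  support_subset : Function.support ρ ⊆ Metric.ball 0 δ

theorem integrable_mollify {ρ : Space d → ℝ} {δ : ℝ} (hρ : IsMollifier ρ δ) {f : Space d → F}
    (hf : LocallyIntegrable f volume) (y : Space d) : Integrable fun t => ρ t • f (y - t) :=
  hρ.hasCompactSupport.convolutionExists_left (ContinuousLinearMap.lsmul ℝ ℝ)
    hρ.contDiff.continuous hf y

/-- Jensen's inequality for the square and the probability density `w`. -/
theorem lintegral_mul_sq_le {α : Type*} [MeasurableSpace α] {μ : Measure α} {w g : α → ℝ≥0∞}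
    (hw : Measurable w) (hg : AEMeasurable g μ) (h1 : ∫⁻ a, w a ∂μ = 1) :
    (∫⁻ a, w a * g a ∂μ) ^ 2 ≤ ∫⁻ a, w a * g a ^ 2 ∂μ := by
  have : IsProbabilityMeasure (μ.withDensity w) := ⟨by
    rw [withDensity_apply _ MeasurableSet.univ, setLIntegral_univ, h1]⟩
  have e1 : ∫⁻ a, w a * g a ∂μ = ∫⁻ a, g a ∂(μ.withDensity w) :=
    (lintegral_withDensity_eq_lintegral_mul₀ hw.aemeasurable hg).symm
  have e2 : ∫⁻ a, w a * g a ^ 2 ∂μ = ∫⁻ a, g a ^ 2 ∂(μ.withDensity w) :=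
    (lintegral_withDensity_eq_lintegral_mul₀ hw.aemeasurable (hg.pow_const 2)).symm
  rw [e1, e2]
  have h := eLpNorm_le_eLpNorm_of_exponent_le (μ := μ.withDensity w) (p := 1) (q := 2) (f := g)
    (by norm_num) (hg.mono_ac (withDensity_absolutelyContinuous _ _)).aestronglyMeasurable
  rw [eLpNorm_one_eq_lintegral_enorm,
    eLpNorm_eq_lintegral_rpow_enorm_toReal (by norm_num) (by norm_num)] at h
  simp only [enorm_eq_self, ENNReal.toReal_ofNat, ENNReal.rpow_ofNat] at h
  calc _ ≤ ((∫⁻ a, g a ^ 2 ∂(μ.withDensity w)) ^ (1 / 2 : ℝ)) ^ 2 := by gcongr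
    _ = _ := by rw [← ENNReal.rpow_natCast, ← ENNReal.rpow_mul]; norm_num

theorem eLpNorm_two_sq {α G : Type*} [MeasurableSpace α] [NormedAddCommGroup G] (μ : Measure α)
    (f : α → G) : eLpNorm f 2 μ ^ 2 = ∫⁻ a, ‖f a‖ₑ ^ 2 ∂μ := by
  rw [eLpNorm_eq_lintegral_rpow_enorm_toReal (by norm_num) (by norm_num)]
  rw [← ENNReal.rpow_natCast, ← ENNReal.rpow_mul]
  norm_num

/-- Mollifiers are an approximate identity in `L²`. -/
theorem exists_mollify_close [CompleteSpace F] {f : Space d → F} (hf : MemLp f 2 volume)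
    {ε : ℝ≥0∞} (hε : 0 < ε) :
    ∃ δ : ℝ, 0 < δ ∧ ∀ ρ : Space d → ℝ, IsMollifier ρ δ →
      eLpNorm (fun y => mollify ρ f y - f y) 2 volume ≤ ε := by
  wlog hfm : StronglyMeasurable f generalizing f
  · obtain ⟨δ, hδ, h⟩ := this (hf.ae_eq hf.1.ae_eq_mk) hf.1.stronglyMeasurable_mk
    refine ⟨δ, hδ, fun ρ hρ => le_trans (le_of_eq (eLpNorm_congr_ae ?_)) (h ρ hρ)⟩
    filter_upwards [hf.1.ae_eq_mk] with y hy
    rw [hy]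
    congr 1
    refine integral_congr_ae ?_
    filter_upwards [(Measure.measurePreserving_sub_left volume y).quasiMeasurePreserving.ae_eq_comp
      hf.1.ae_eq_mk] with t ht
    exact congrArg (ρ t • ·) ht
  have hnh := (tendsto_eLpNorm_translate_sub hf).eventually (Iic_mem_nhds hε)
  obtain ⟨δ, hδ, h⟩ := Metric.eventually_nhds_iff_ball.1 hnh
  refine ⟨δ, hδ, fun ρ hρ => ?_⟩
  have hloc : LocallyIntegrable f volume := hf.locallyIntegrable (by norm_num)
  have hρi : Integrable ρ := hρ.contDiff.continuous.integrable_of_hasCompactSupport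
    hρ.hasCompactSupport
  have hw : ∫⁻ t, ‖ρ t‖ₑ = 1 := by
    have := ofReal_integral_eq_lintegral_ofReal hρi (.of_forall hρ.nonneg)
    rw [hρ.integral_eq_one, ENNReal.ofReal_one] at this
    rw [this]
    refine lintegral_congr fun t => ?_
    rw [Real.enorm_eq_ofReal (hρ.nonneg t)]
  have hwm : Measurable fun t => ‖ρ t‖ₑ := hρ.contDiff.continuous.enorm.measurable
  have hjm : Measurable fun z : Space d × Space d => ‖f (z.1 - z.2) - f z.1‖ₑ :=
    ((hfm.comp_measurable (measurable_fst.sub measurable_snd)).sub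
      (hfm.comp_measurable measurable_fst)).enorm
  have hpt : ∀ y, ‖mollify ρ f y - f y‖ₑ ^ 2 ≤ ∫⁻ t, ‖ρ t‖ₑ * ‖f (y - t) - f y‖ₑ ^ 2 := by
    intro y
    have e : mollify ρ f y - f y = ∫ t, ρ t • (f (y - t) - f y) := by
      simp_rw [smul_sub]
      rw [integral_sub (integrable_mollify hρ hloc y) (hρi.smul_const _), integral_smul_const,
        hρ.integral_eq_one, one_smul]
      rfl
    have h1 : ‖mollify ρ f y - f y‖ₑ ≤ ∫⁻ t, ‖ρ t‖ₑ * ‖f (y - t) - f y‖ₑ := by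
      rw [e]
      refine (enorm_integral_le_lintegral_enorm _).trans (le_of_eq ?_)
      simp_rw [enorm_smul]
    exact (pow_le_pow_left' h1 2).trans
      (lintegral_mul_sq_le hwm (hjm.comp (measurable_const.prodMk measurable_id)).aemeasurable hw)
  have hsq : eLpNorm (fun y => mollify ρ f y - f y) 2 volume ^ 2 ≤ ε ^ 2 := by
    rw [eLpNorm_two_sq]
    calc _ ≤ ∫⁻ y, ∫⁻ t, ‖ρ t‖ₑ * ‖f (y - t) - f y‖ₑ ^ 2 := lintegral_mono hpt
      _ = ∫⁻ t, ∫⁻ y, ‖ρ t‖ₑ * ‖f (y - t) - f y‖ₑ ^ 2 :=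
          lintegral_lintegral_swap
            ((hwm.comp measurable_snd).mul (hjm.pow_const 2)).aemeasurable
      _ ≤ ∫⁻ t, ‖ρ t‖ₑ * ε ^ 2 := by
          refine lintegral_mono fun t => ?_
          rw [lintegral_const_mul' _ _ enorm_ne_top]
          by_cases ht : ρ t = 0
          · simp [ht]
          gcongr
          rw [← eLpNorm_two_sq volume (fun y => f (y - t) - f y)]
          exact pow_le_pow_left' (h t (hρ.support_subset ht)) 2
      _ = ε ^ 2 := by rw [lintegral_mul_const _ hwm, hw, one_mul]
  exact (ENNReal.pow_le_pow_left_iff two_ne_zero).1 hsq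

end Mollification

section LocalApproximation

variable {d : ℕ} {Ω : Set (Space d)}

theorem fderiv_mollify_apply {ρ : Space d → ℝ} {δ : ℝ} (hρ : IsMollifier ρ δ) {f : Space d → ℝ}
    (hf : LocallyIntegrable f volume) (y b : Space d) :
    fderiv ℝ (mollify ρ f) y b = ∫ z, fderiv ℝ ρ (y - z) b * f z := by
  have hρ1 : ContDiff ℝ 1 ρ := hρ.contDiff.of_le (by simp)
  have h := hρ.hasCompactSupport.hasFDerivAt_convolution_left (ContinuousLinearMap.lsmul ℝ ℝ)
    hρ1 hf y
  have hint := (hρ.hasCompactSupport.fderiv ℝ).convolutionExists_left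
    ((ContinuousLinearMap.lsmul ℝ ℝ).precompL (Space d)) (hρ1.continuous_fderiv one_ne_zero) hf y
  have e := h.fderiv
  change fderiv ℝ (mollify ρ f) y = _ at e
  rw [e, convolution_def, ContinuousLinearMap.integral_apply hint,
    ← integral_sub_left_eq_self _ volume y]
  simp only [sub_sub_cancel]
  rfl

theorem contDiff_mollify {ρ : Space d → ℝ} {δ : ℝ} (hρ : IsMollifier ρ δ) {f : Space d → ℝ}
    (hf : LocallyIntegrable f volume) : ContDiff ℝ ∞ (mollify ρ f) :=
  hρ.hasCompactSupport.contDiff_convolution_left (n := (⊤ : ℕ∞)) (ContinuousLinearMap.lsmul ℝ ℝ)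
    hρ.contDiff hf

theorem inner_gradient_left {f : Space d → ℝ} (y b : Space d) :
    ⟪gradient f y, b⟫_ℝ = fderiv ℝ f y b := by
  rw [gradient, InnerProductSpace.toDual_symm_apply]

/-- `ζ v`, extended by zero outside `Ω`. -/
noncomputable def cutoffFun (ζ : Space d → ℝ) (v : H1 Ω) : Space d → ℝ :=
  Ω.indicator fun z => ζ z * toL2 v z

/-- The weak gradient `ζ ∇v + v ∇ζ` of `ζ v`, extended by zero outside `Ω`. -/
noncomputable def cutoffGrad (ζ : Space d → ℝ) (v : H1 Ω) : Space d → Space d :=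
  Ω.indicator fun z => ζ z • wgrad v z + toL2 v z • gradient ζ z

theorem memLp_smul_of_continuous {α G : Type*} [TopologicalSpace α] [MeasurableSpace α]
    [OpensMeasurableSpace α]
    [NormedAddCommGroup G] [NormedSpace ℝ G] {μ : Measure α} {ζ : α → ℝ} (hζ : Continuous ζ)
    (hc : HasCompactSupport ζ) {f : α → G} (hf : MemLp f 2 μ) :
    MemLp (fun z => ζ z • f z) 2 μ := by
  obtain ⟨C, hC⟩ := hζ.bounded_above_of_compact_support hc
  refine hf.of_le_mul (c := C) (hζ.aestronglyMeasurable.smul hf.1) (.of_forall fun z => ?_)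
  rw [norm_smul]
  exact mul_le_mul_of_nonneg_right (hC z) (norm_nonneg _)

theorem continuous_gradient {ζ : Space d → ℝ} (hζ : ContDiff ℝ ∞ ζ) : Continuous (gradient ζ) :=
  (InnerProductSpace.toDual ℝ (Space d)).symm.continuous.comp
    ((hζ.continuous_fderiv (by simp)))

theorem memLp_cutoffFun (hΩ : MeasurableSet Ω) {ζ : Space d → ℝ} (hζ : ContDiff ℝ ∞ ζ)
    (hc : HasCompactSupport ζ) (v : H1 Ω) : MemLp (cutoffFun ζ v) 2 volume :=
  (memLp_indicator_iff_restrict hΩ).2 (memLp_smul_of_continuous hζ.continuous hc (Lp.memLp _))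

theorem memLp_cutoffGrad (hΩ : MeasurableSet Ω) {ζ : Space d → ℝ} (hζ : ContDiff ℝ ∞ ζ)
    (hc : HasCompactSupport ζ) (v : H1 Ω) : MemLp (cutoffGrad ζ v) 2 volume := by
  have h1 : MemLp (fun z => ζ z • wgrad v z) 2 (volume.restrict Ω) :=
    memLp_smul_of_continuous hζ.continuous hc (Lp.memLp (wgrad v))
  suffices h2 : MemLp (fun z => toL2 v z • gradient ζ z) 2 (volume.restrict Ω) from
    (memLp_indicator_iff_restrict hΩ).2 (h1.add h2)
  obtain ⟨C, hC⟩ := (hζ.continuous_fderiv (by simp)).bounded_above_of_compact_support (hc.fderiv ℝ)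
  have hv := Lp.memLp (toL2 v)
  refine hv.of_le_mul (c := C) (hv.1.smul (continuous_gradient hζ).aestronglyMeasurable)
    (.of_forall fun z => ?_)
  rw [norm_smul, mul_comm]
  refine mul_le_mul_of_nonneg_right ?_ (norm_nonneg _)
  rw [gradient, LinearIsometryEquiv.norm_map]
  exact hC z

/-- The shift condition: points of `supp ζ` reached from `Ω` by subtracting a point of `supp ρ`
are again in `Ω`. It makes the mollification of `ζ v` commute with the weak gradient on `Ω`. -/
def ShiftsInto (Ω : Set (Space d)) (ζ ρ : Space d → ℝ) : Prop :=
  ∀ y ∈ Ω, ∀ s ∈ tsupport ρ, y - s ∈ tsupport ζ → y - s ∈ Ω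

/-- Under the shift condition the mollification of `ζ v` is differentiated on `Ω` as if `ζ v` were
weakly differentiable on the whole space: `z ↦ ρ(y - z) ζ(z)` is an admissible test function in `Ω`,
although `ζ` itself need not vanish on `∂Ω`. -/
theorem gradient_mollify_cutoff (hΩ : MeasurableSet Ω) {ζ : Space d → ℝ} (hζ : ContDiff ℝ ∞ ζ)
    (hc : HasCompactSupport ζ) (v : H1 Ω) {ρ : Space d → ℝ} {δ : ℝ} (hρ : IsMollifier ρ δ)
    (hs : ShiftsInto Ω ζ ρ) {y : Space d} (hy : y ∈ Ω) :
    gradient (mollify ρ (cutoffFun ζ v)) y = mollify ρ (cutoffGrad ζ v) y := by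
  have hl1 := (memLp_cutoffFun hΩ hζ hc v).locallyIntegrable (by norm_num)
  have hl2 := (memLp_cutoffGrad hΩ hζ hc v).locallyIntegrable (by norm_num)
  refine ext_inner_right ℝ fun b => ?_
  rw [inner_gradient_left, fderiv_mollify_apply hρ hl1, mollify, real_inner_comm,
    ← integral_inner (integrable_mollify hρ hl2 y),
    ← integral_sub_left_eq_self (fun t => ⟪b, ρ t • cutoffGrad ζ v (y - t)⟫_ℝ) volume y]
  simp only [sub_sub_cancel]
  -- the test function of the weak gradient identity
  let φ : Space d → ℝ := fun z => ρ (y - z) * ζ z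
  have hρs : ContDiff ℝ ∞ fun z => ρ (y - z) := hρ.contDiff.comp (contDiff_const.sub contDiff_id)
  have hφ : ContDiff ℝ ∞ φ := hρs.mul hζ
  have hφc : HasCompactSupport φ := hc.mul_left
  have hφs : tsupport φ ⊆ Ω := by
    intro z hz
    have h1 : z ∈ tsupport ζ := tsupport_mul_subset_right hz
    have h2 : y - z ∈ tsupport ρ :=
      tsupport_comp_subset_preimage ρ (f := fun z => y - z) (by fun_prop)
        (tsupport_mul_subset_left hz)
    simpa using hs y hy (y - z) h2 (by simpa using h1)
  have hdφ : ∀ z, fderiv ℝ φ z b = ρ (y - z) * fderiv ℝ ζ z b - ζ z * fderiv ℝ ρ (y - z) b := by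
    intro z
    have h1 : HasFDerivAt (fun z => ρ (y - z)) (-fderiv ℝ ρ (y - z)) z := by
      have := (hρ.contDiff.differentiable (by simp) (y - z)).hasFDerivAt.comp z
        ((hasFDerivAt_id z).const_sub y)
      simpa [Function.comp_def] using this
    have h2 := (h1.mul (hζ.differentiable (by simp) z).hasFDerivAt).fderiv
    change fderiv ℝ φ z = _ at h2
    rw [h2]
    simp only [_root_.add_apply, _root_.smul_apply,
      _root_.neg_apply, smul_eq_mul]
    ring
  have hw := v.2 φ hφ hφc hφs b
  change ∫ x in Ω, toL2 v x * fderiv ℝ φ x b = -∫ x in Ω, ⟪wgrad v x, b⟫_ℝ * φ x at hw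
  have hi1 : Integrable (fun z => fderiv ℝ ρ (y - z) b * cutoffFun ζ v z) volume := by
    have := ((hρ.hasCompactSupport.fderiv ℝ).comp_left (g := fun L : Space d →L[ℝ] ℝ => L b)
      (by simp)).convolutionExists_left (ContinuousLinearMap.lsmul ℝ ℝ)
      (continuous_fderiv_apply_const hρ.contDiff b) hl1 y
    have h2 := (integrable_comp_sub_left _ y).2 this
    simpa [Function.comp_def] using h2
  have hi2 := integrable_inner_mul_test (wgrad v) b hφ.continuous hφc
  rw [eq_neg_iff_add_eq_zero, ← integral_add (integrable_mul_test _
    (continuous_fderiv_apply_const hφ b) ((hφc.fderiv ℝ).comp_left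
      (g := fun L : Space d →L[ℝ] ℝ => L b) (by simp))) hi2] at hw
  rw [← sub_eq_zero, ← integral_sub hi1 (by
    have h3 : Integrable (fun t => ⟪b, ρ t • cutoffGrad ζ v (y - t)⟫_ℝ) volume :=
      (integrable_mollify hρ hl2 y).const_inner b
    have := (integrable_comp_sub_left _ y).2 h3
    simpa [Function.comp_def] using this), ← neg_eq_zero, ← integral_neg, ← hw,
    ← integral_indicator hΩ]
  refine integral_congr_ae (.of_forall fun z => ?_)
  by_cases hz : z ∈ Ω
  · simp only [cutoffFun, cutoffGrad, indicator_of_mem hz, hdφ, φ]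
    rw [real_inner_smul_right, inner_add_right, real_inner_smul_right, real_inner_smul_right,
      real_inner_comm _ b, real_inner_comm _ b, inner_gradient_left]
    ring
  · simp [cutoffFun, cutoffGrad, hz]

/-- Approximation of the localised function `ζ v` in `H¹(Ω)` by functions smooth on all of `ℝ^d`. -/
theorem exists_smooth_approx_cutoff (hΩ : MeasurableSet Ω) {ζ : Space d → ℝ}
    (hζ : ContDiff ℝ ∞ ζ) (hc : HasCompactSupport ζ)
    (hs : ∀ δ : ℝ, 0 < δ → ∃ ρ, IsMollifier ρ δ ∧ ShiftsInto Ω ζ ρ) (v : H1 Ω) {ε : ℝ≥0∞}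
    (hε : 0 < ε) :
    ∃ ψ : Space d → ℝ, ContDiff ℝ ∞ ψ ∧
      eLpNorm (fun x => ψ x - ζ x * toL2 v x) 2 (volume.restrict Ω) ≤ ε ∧
      eLpNorm (fun x => gradient ψ x - (ζ x • wgrad v x + toL2 v x • gradient ζ x)) 2
        (volume.restrict Ω) ≤ ε := by
  obtain ⟨δ₁, hδ₁, h₁⟩ := exists_mollify_close (memLp_cutoffFun hΩ hζ hc v) hε
  obtain ⟨δ₂, hδ₂, h₂⟩ := exists_mollify_close (memLp_cutoffGrad hΩ hζ hc v) hε
  obtain ⟨ρ, hρ, hsh⟩ := hs (min δ₁ δ₂) (lt_min hδ₁ hδ₂)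
  have hmono : ∀ δ, min δ₁ δ₂ ≤ δ → IsMollifier ρ δ := fun δ hle =>
    ⟨hρ.contDiff, hρ.hasCompactSupport, hρ.nonneg, hρ.integral_eq_one,
      hρ.support_subset.trans (Metric.ball_subset_ball hle)⟩
  refine ⟨mollify ρ (cutoffFun ζ v),
    contDiff_mollify hρ ((memLp_cutoffFun hΩ hζ hc v).locallyIntegrable (by norm_num)), ?_, ?_⟩
  · refine le_trans (le_of_eq (eLpNorm_congr_ae ?_)) ((eLpNorm_mono_measure _
      Measure.restrict_le_self).trans (h₁ ρ (hmono _ (min_le_left _ _))))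
    filter_upwards [ae_restrict_mem hΩ] with x hx
    simp [cutoffFun, hx]
  · refine le_trans (le_of_eq (eLpNorm_congr_ae ?_)) ((eLpNorm_mono_measure _
      Measure.restrict_le_self).trans (h₂ ρ (hmono _ (min_le_right _ _))))
    filter_upwards [ae_restrict_mem hΩ] with x hx
    rw [gradient_mollify_cutoff hΩ hζ hc v hρ hsh hx]
    simp [cutoffGrad, hx]

end LocalApproximation

end PseudoParabolic

/-! ### Density of smooth functions in `H¹(Ω)` -/

namespace PseudoParabolic

open scoped ENNReal NNReal Manifold

section Density

variable {d : ℕ} {Ω : Set (Space d)}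

/-- A bump of radius `a` about the point `c`, as a mollifier. -/
theorem isMollifier_bump (c : Space d) {a δ : ℝ} (ha : 0 < a) (hδ : ‖c‖ + a ≤ δ) :
    ∃ ρ : Space d → ℝ, IsMollifier ρ δ ∧ tsupport ρ = Metric.closedBall c a := by
  let φ : ContDiffBump c := ⟨a / 2, a, by positivity, by linarith⟩
  refine ⟨φ.normed volume, ⟨φ.contDiff_normed, φ.hasCompactSupport_normed, φ.nonneg_normed,
    φ.integral_normed, ?_⟩, φ.tsupport_normed_eq⟩
  rw [φ.support_normed_eq]
  refine Metric.ball_subset_ball' ?_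
  rw [dist_zero_right]
  change a + ‖c‖ ≤ δ
  linarith

/-- Near every point of the closure, cut-off functions admit mollifiers that shift into `Ω`. At a
boundary point these are bumps about a small multiple of the chart direction `e`, so narrow that
they sit inside a cone which the Lipschitz graph cannot enter. -/
theorem exists_ball_shiftsInto (hΩ : IsBoundedLipschitz Ω) {x : Space d} (hx : x ∈ closure Ω) :
    ∃ r : ℝ, 0 < r ∧ ∀ ζ : Space d → ℝ, tsupport ζ ⊆ Metric.ball x r →
      ∀ δ : ℝ, 0 < δ → ∃ ρ, IsMollifier ρ δ ∧ ShiftsInto Ω ζ ρ := by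
  by_cases hxΩ : x ∈ Ω
  · obtain ⟨r, hr, hrΩ⟩ := Metric.isOpen_iff.1 hΩ.isOpen x hxΩ
    refine ⟨r, hr, fun ζ hζ δ hδ => ?_⟩
    obtain ⟨ρ, hρ, -⟩ := isMollifier_bump (0 : Space d) (δ := δ) hδ (by simp)
    exact ⟨ρ, hρ, fun y _ s _ hs => hrΩ (hζ hs)⟩
  have hxf : x ∈ frontier Ω := by rw [hΩ.isOpen.frontier_eq]; exact ⟨hx, hxΩ⟩
  obtain ⟨e, K, γ, r, he, hγ, hr, h⟩ := hΩ.lipschitz_graph x hxf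
  refine ⟨r, hr, fun ζ hζ δ hδ => ?_⟩
  obtain ⟨r', hr', hζ'⟩ := exists_pos_lt_subset_ball hr (isClosed_tsupport ζ) hζ
  set ε : ℝ := min δ (r - r') / 2 with hε
  have hε0 : 0 < ε := by have := hr'.2; have := lt_min hδ (sub_pos.2 this); positivity
  have hεδ : 2 * ε ≤ δ := by rw [hε]; linarith [min_le_left δ (r - r')]
  have hεr : 2 * ε ≤ r - r' := by rw [hε]; linarith [min_le_right δ (r - r')]
  -- with opening `a`, a vector `s` of the cone satisfies `K |P s| ≤ K a ε < (1 - a) ε ≤ ⟨e, s⟩`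
  set a : ℝ := 1 / (K + 2) with ha
  have hK : (0 : ℝ) ≤ K := K.2
  have ha0 : 0 < a := by positivity
  have ha1 : a ≤ 1 := by rw [ha, div_le_one (by positivity)]; linarith
  have haK : K * a < 1 - a := by
    have : a * (K + 2) = 1 := by rw [ha]; field_simp
    nlinarith
  obtain ⟨ρ, hρ, hρs⟩ := isMollifier_bump (ε • e) (a := a * ε) (δ := δ) (by positivity) (by
    rw [norm_smul, he, Real.norm_of_nonneg hε0.le]; nlinarith)
  refine ⟨ρ, hρ, fun y hy s hs hys => ?_⟩
  rw [hρs, Metric.mem_closedBall, dist_eq_norm] at hs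
  set w := s - ε • e with hw
  have hsw : s = ε • e + w := by rw [hw]; abel
  have hPs : (ℝ ∙ e)ᗮ.orthogonalProjectionOnto s = (ℝ ∙ e)ᗮ.orthogonalProjectionOnto w := by
    rw [hsw, map_add, map_smul,
      Submodule.orthogonalProjectionOnto_orthogonalComplement_singleton_eq_zero]
    simp
  have hPn : ‖(ℝ ∙ e)ᗮ.orthogonalProjectionOnto s‖ ≤ a * ε := by
    rw [hPs]
    exact ((ℝ ∙ e)ᗮ.norm_orthogonalProjectionOnto_apply_le w).trans hs
  have hes : ε - a * ε ≤ ⟪e, s⟫_ℝ := by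
    rw [hsw, inner_add_right, real_inner_smul_right, real_inner_self_eq_norm_sq, he]
    have := (abs_le.1 ((abs_real_inner_le_norm e w).trans
      (by rw [he, one_mul]; exact hs : ‖e‖ * ‖w‖ ≤ a * ε))).1
    linarith
  have hsn : ‖s‖ ≤ 2 * ε := by
    rw [hsw]
    refine (norm_add_le _ _).trans ?_
    rw [norm_smul, he, Real.norm_of_nonneg hε0.le]
    nlinarith
  have hzr : y - s ∈ Metric.ball x r' := hζ' hys
  have hyr : y ∈ Metric.ball x r := by
    rw [Metric.mem_ball, dist_eq_norm] at hzr ⊢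
    calc ‖y - x‖ = ‖(y - s - x) + s‖ := by congr 1; abel
      _ ≤ ‖y - s - x‖ + ‖s‖ := norm_add_le _ _
      _ < r := by linarith
  have hyγ := (h y hyr).1 hy
  rw [h _ (Metric.ball_subset_ball hr'.2.le hzr), inner_sub_right]
  have hlip := hγ.dist_le_mul ((ℝ ∙ e)ᗮ.orthogonalProjectionOnto y)
    ((ℝ ∙ e)ᗮ.orthogonalProjectionOnto (y - s))
  rw [map_sub, dist_eq_norm, dist_eq_norm, sub_sub_cancel, Real.norm_eq_abs] at hlip
  have h1 := (abs_le.1 hlip).2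
  have h2 : (K : ℝ) * ‖(ℝ ∙ e)ᗮ.orthogonalProjectionOnto s‖ ≤ K * a * ε := by
    rw [mul_assoc]; gcongr
  rw [map_sub]
  nlinarith

/-- Functions that are smooth up to the boundary are dense in `H¹(Ω)`. -/
theorem exists_smooth_approx (hΩ : IsBoundedLipschitz Ω) (v : H1 Ω) {ε : ℝ≥0∞} (hε : 0 < ε) :
    ∃ ψ : Space d → ℝ, ContDiff ℝ ∞ ψ ∧
      eLpNorm (fun x => ψ x - toL2 v x) 2 (volume.restrict Ω) ≤ ε ∧
      eLpNorm (fun x => gradient ψ x - wgrad v x) 2 (volume.restrict Ω) ≤ ε := by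
  have hm := hΩ.isOpen.measurableSet
  choose! r hr hrs using fun x (hx : x ∈ closure Ω) => exists_ball_shiftsInto hΩ hx
  obtain ⟨t, htc, hcov⟩ := hΩ.isBounded.isCompact_closure.elim_nhds_subcover
    (fun x => Metric.ball x (r x)) fun x hx => Metric.ball_mem_nhds x (hr x hx)
  obtain ⟨f, hf⟩ := SmoothPartitionOfUnity.exists_isSubordinate 𝓘(ℝ, Space d)
    (isClosed_closure (s := Ω)) (fun x : t => Metric.ball (x : Space d) (r x))
    (fun _ => Metric.isOpen_ball) (by simpa [iUnion_subtype] using hcov)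
  have hζ : ∀ i, ContDiff ℝ ∞ (f i) := fun i => (f i).contMDiff.contDiff
  have hc : ∀ i, HasCompactSupport (f i) := fun i =>
    (isCompact_closedBall (i : Space d) (r i)).of_isClosed_subset (isClosed_tsupport _)
      ((hf i).trans Metric.ball_subset_closedBall)
  have hsum : ∀ x ∈ closure Ω, ∑ i, f i x = 1 := fun x hx => by
    rw [← finsum_eq_sum_of_fintype]; exact f.sum_eq_one hx
  have hgrad : ∀ x ∈ Ω, ∑ i, gradient (f i) x = 0 := by
    intro x hx
    refine ext_inner_right ℝ fun b => ?_
    rw [sum_inner, inner_zero_left]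
    simp_rw [inner_gradient_left]
    rw [← _root_.sum_apply, ← fderiv_fun_sum fun i _ => (hζ i).differentiable (by simp) x]
    have : (fun y => ∑ i, f i y) =ᶠ[𝓝 x] fun _ => 1 := by
      filter_upwards [hΩ.isOpen.mem_nhds hx] with y hy using hsum y (subset_closure hy)
    rw [this.fderiv_eq]
    simp
  -- the summand `1` keeps the denominator away from zero when the cover is empty
  have hε' : 0 < ε / (t.card + 1) := ENNReal.div_pos hε.ne' (by finiteness)
  choose ψ hψ h1 h2 using fun i : t => exists_smooth_approx_cutoff hm (hζ i) (hc i)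
    (hrs i (htc i i.2) _ (hf i)) v hε'
  have hcard : ∑ _i : t, ε / (t.card + 1) ≤ ε := by
    rw [Finset.sum_const, Finset.card_univ, Fintype.card_coe, nsmul_eq_mul, ← mul_div_assoc]
    refine ENNReal.div_le_of_le_mul ?_
    rw [mul_comm]
    gcongr
    exact le_self_add
  refine ⟨fun x => ∑ i, ψ i x, ContDiff.sum fun i _ => hψ i, ?_, ?_⟩
  · calc _ = eLpNorm (∑ i, fun x => ψ i x - f i x * toL2 v x) 2 (volume.restrict Ω) := by
          refine eLpNorm_congr_ae ?_
          filter_upwards [ae_restrict_mem hm] with x hx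
          rw [Finset.sum_apply, Finset.sum_sub_distrib, ← Finset.sum_mul,
            hsum x (subset_closure hx), one_mul]
      _ ≤ ∑ i, eLpNorm (fun x => ψ i x - f i x * toL2 v x) 2 (volume.restrict Ω) :=
          eLpNorm_sum_le (fun i _ => ((hψ i).continuous.aestronglyMeasurable.sub
            ((hζ i).continuous.aestronglyMeasurable.mul (Lp.aestronglyMeasurable (toL2 v)))))
            (by norm_num)
      _ ≤ ε := (Finset.sum_le_sum fun i _ => h1 i).trans hcard
  · calc _ = eLpNorm (∑ i, fun x => gradient (ψ i) x -
            (f i x • wgrad v x + toL2 v x • gradient (f i) x)) 2 (volume.restrict Ω) := by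
          refine eLpNorm_congr_ae ?_
          filter_upwards [ae_restrict_mem hm] with x hx
          have hg : gradient (fun x => ∑ i, ψ i x) x = ∑ i, gradient (ψ i) x := by
            refine ext_inner_right ℝ fun b => ?_
            rw [sum_inner, inner_gradient_left,
              fderiv_fun_sum fun i _ => (hψ i).differentiable (by simp) x, _root_.sum_apply]
            simp_rw [inner_gradient_left]
          rw [hg, Finset.sum_apply, Finset.sum_sub_distrib, Finset.sum_add_distrib,
            ← Finset.sum_smul, ← Finset.smul_sum, hsum x (subset_closure hx), hgrad x hx]
          simp
      _ ≤ ∑ i, eLpNorm (fun x => gradient (ψ i) x -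
            (f i x • wgrad v x + toL2 v x • gradient (f i) x)) 2 (volume.restrict Ω) :=
          eLpNorm_sum_le (fun i _ => ((continuous_gradient (hψ i)).aestronglyMeasurable.sub
            (((hζ i).continuous.aestronglyMeasurable.smul (Lp.aestronglyMeasurable (wgrad v))).add
              ((Lp.aestronglyMeasurable (toL2 v)).smul
                (continuous_gradient (hζ i)).aestronglyMeasurable))))
            (by norm_num)
      _ ≤ ε := (Finset.sum_le_sum fun i _ => h2 i).trans hcard

end Density

end PseudoParabolic

/-! ### The trace operator -/

namespace PseudoParabolic

open scoped ENNReal NNReal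

section TraceOperator

variable {d : ℕ} {Ω : Set (Space d)}

theorem eLpNorm_gradient {μ : Measure (Space d)} (ψ : Space d → ℝ) :
    eLpNorm (gradient ψ) 2 μ = eLpNorm (fderiv ℝ ψ) 2 μ :=
  eLpNorm_congr_norm_ae (.of_forall fun x => by rw [gradient, LinearIsometryEquiv.norm_map])

/-- The trace inequality in terms of `L²` norms. -/
theorem exists_eLpNorm_surface_le (hΩ : IsBoundedLipschitz Ω) :
    ∃ C : ℝ≥0, ∀ ψ : Space d → ℝ, ContDiff ℝ 1 ψ →
      eLpNorm ψ 2 (surface Ω) ≤ C * (eLpNorm ψ 2 (volume.restrict Ω) +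
        eLpNorm (gradient ψ) 2 (volume.restrict Ω)) := by
  obtain ⟨C, hC⟩ := exists_lintegral_surface_sq_le hΩ
  refine ⟨C + 1, fun ψ hψ => (ENNReal.pow_le_pow_left_iff two_ne_zero).1 ?_⟩
  have h := hC ψ hψ
  rw [← eLpNorm_two_sq, ← eLpNorm_two_sq, ← eLpNorm_two_sq, ← eLpNorm_gradient] at h
  refine h.trans ?_
  rw [mul_pow]
  gcongr
  · calc (C : ℝ≥0∞) ≤ (C + 1) * 1 := by rw [mul_one]; exact le_self_add
      _ ≤ ((C + 1 : ℝ≥0) : ℝ≥0∞) ^ 2 := by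
        rw [sq]; push_cast; gcongr; exact le_add_self
  · rw [add_sq]
    gcongr
    exact le_self_add

theorem IsTrace.add_smul {v v' : H1 Ω} {w w' : L2Bdry Ω} (h : IsTrace v w) (h' : IsTrace v' w')
    (c : ℝ) : IsTrace (v + c • v') (w + c • w') := by
  obtain ⟨ψ, hψ, h1, h2, h3⟩ := h
  obtain ⟨ψ', hψ', h1', h2', h3'⟩ := h'
  have key : ∀ {G : Type} [NormedAddCommGroup G] [NormedSpace ℝ G] {μ : Measure (Space d)}
      {f f' : ℕ → Space d → G} {g g' : Lp G 2 μ},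
      (∀ n, Continuous (f n)) → (∀ n, Continuous (f' n)) →
      Tendsto (fun n => eLpNorm (fun x => f n x - g x) 2 μ) atTop (𝓝 0) →
      Tendsto (fun n => eLpNorm (fun x => f' n x - g' x) 2 μ) atTop (𝓝 0) →
      SecondCountableTopology G →
      Tendsto (fun n => eLpNorm (fun x => (f n x + c • f' n x) - (g + c • g') x) 2 μ)
        atTop (𝓝 0) := by
    intro G _ _ μ f f' g g' hf hf' hg hg' _
    have hlim : Tendsto (fun n => eLpNorm (fun x => f n x - g x) 2 μ +
        ‖c‖ₑ * eLpNorm (fun x => f' n x - g' x) 2 μ) atTop (𝓝 0) := by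
      simpa using hg.add (ENNReal.Tendsto.const_mul hg' (Or.inr enorm_ne_top))
    refine tendsto_of_tendsto_of_tendsto_of_le_of_le tendsto_const_nhds hlim
      (fun _ => zero_le) fun n => ?_
    have e : (fun x => (f n x + c • f' n x) - (g + c • g') x) =ᵐ[μ]
        (fun x => f n x - g x) + c • fun x => f' n x - g' x := by
      filter_upwards [Lp.coeFn_add g (c • g'), Lp.coeFn_smul c g'] with x h1 h2
      simp only [h1, h2, Pi.add_apply, Pi.smul_apply, smul_sub]
      abel
    rw [eLpNorm_congr_ae e]
    refine (eLpNorm_add_le ((hf n).aestronglyMeasurable.sub (Lp.aestronglyMeasurable g))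
      (((hf' n).aestronglyMeasurable.sub (Lp.aestronglyMeasurable g')).const_smul c)
      (by norm_num)).trans ?_
    rw [eLpNorm_const_smul]
    exact le_rfl
  refine ⟨fun n x => ψ n x + c • ψ' n x, fun n => (hψ n).add ((hψ' n).const_smul c),
    key (fun n => (hψ n).continuous) (fun n => (hψ' n).continuous) h1 h1' inferInstance, ?_,
    key (fun n => (hψ n).continuous) (fun n => (hψ' n).continuous) h3 h3' inferInstance⟩
  have := key (fun n => continuous_gradient (hψ n)) (fun n => continuous_gradient (hψ' n))
    h2 h2' inferInstance
  refine this.congr fun n => ?_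
  congr 1
  funext x
  have hg : gradient (fun x => ψ n x + c • ψ' n x) x = gradient (ψ n) x + c • gradient (ψ' n) x := by
    refine ext_inner_right ℝ fun b => ?_
    have hd : HasFDerivAt (fun x => ψ n x + c • ψ' n x)
        (fderiv ℝ (ψ n) x + c • fderiv ℝ (ψ' n) x) x :=
      ((hψ n).differentiable (by simp) x).hasFDerivAt.add
        (((hψ' n).differentiable (by simp) x).hasFDerivAt.const_smul c)
    rw [inner_add_left, real_inner_smul_left, inner_gradient_left, inner_gradient_left,
      inner_gradient_left, hd.fderiv]
    rfl
  rw [hg]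
  rfl

theorem norm_toL2_le (v : H1 Ω) : ‖toL2 v‖ ≤ ‖v‖ := by
  have h := WithLp.prod_norm_sq_eq_of_L2 v.1
  refine abs_le_of_sq_le_sq' ?_ (norm_nonneg _) |>.2
  change ‖v.1.fst‖ ^ 2 ≤ ‖v.1‖ ^ 2
  nlinarith [sq_nonneg ‖v.1.snd‖]

theorem norm_wgrad_le (v : H1 Ω) : ‖wgrad v‖ ≤ ‖v‖ := by
  have h := WithLp.prod_norm_sq_eq_of_L2 v.1
  refine abs_le_of_sq_le_sq' ?_ (norm_nonneg _) |>.2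
  change ‖v.1.snd‖ ^ 2 ≤ ‖v.1‖ ^ 2
  nlinarith [sq_nonneg ‖v.1.fst‖]

/-- The trace inequality passes to the limit, so the trace is bounded, and unique. -/
theorem exists_isTrace_norm_le (hΩ : IsBoundedLipschitz Ω) :
    ∃ C : ℝ, ∀ (v : H1 Ω) (w : L2Bdry Ω), IsTrace v w → ‖w‖ ≤ C * ‖v‖ := by
  obtain ⟨C, hC⟩ := exists_eLpNorm_surface_le hΩ
  refine ⟨2 * C, fun v w ⟨ψ, hψ, h1, h2, h3⟩ => ?_⟩
  have hle : eLpNorm w 2 (surface Ω) ≤ C * (eLpNorm (toL2 v) 2 (volume.restrict Ω) +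
      eLpNorm (wgrad v) 2 (volume.restrict Ω)) := by
    have hlim : Tendsto (fun n => eLpNorm (fun x => ψ n x - w x) 2 (surface Ω) +
        C * ((eLpNorm (fun x => ψ n x - toL2 v x) 2 (volume.restrict Ω)
            + eLpNorm (toL2 v) 2 (volume.restrict Ω)) +
          (eLpNorm (fun x => gradient (ψ n) x - wgrad v x) 2 (volume.restrict Ω)
            + eLpNorm (wgrad v) 2 (volume.restrict Ω)))) atTop
        (𝓝 (0 + C * ((0 + eLpNorm (toL2 v) 2 (volume.restrict Ω)) +
          (0 + eLpNorm (wgrad v) 2 (volume.restrict Ω))))) :=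
      h3.add (ENNReal.Tendsto.const_mul ((h1.add tendsto_const_nhds).add
        (h2.add tendsto_const_nhds)) (Or.inr ENNReal.coe_ne_top))
    simp only [zero_add] at hlim
    refine ge_of_tendsto' hlim fun n => ?_
    have m1 := (hψ n).continuous.aestronglyMeasurable (μ := surface Ω)
    have m2 := (hψ n).continuous.aestronglyMeasurable (μ := volume.restrict Ω)
    have m3 := (continuous_gradient (hψ n)).aestronglyMeasurable (μ := volume.restrict Ω)
    have b1 : eLpNorm w 2 (surface Ω) ≤ eLpNorm (fun x => ψ n x - w x) 2 (surface Ω) +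
        eLpNorm (ψ n) 2 (surface Ω) := by
      have := eLpNorm_sub_le (p := 2) m1 (m1.sub (Lp.aestronglyMeasurable w)) (by norm_num)
      rw [sub_sub_cancel, add_comm] at this
      exact this
    have b2 : eLpNorm (ψ n) 2 (volume.restrict Ω) ≤
        eLpNorm (fun x => ψ n x - toL2 v x) 2 (volume.restrict Ω) +
          eLpNorm (toL2 v) 2 (volume.restrict Ω) := by
      have := eLpNorm_add_le (p := 2) (m2.sub (Lp.aestronglyMeasurable (toL2 v)))
        (Lp.aestronglyMeasurable (toL2 v)) (by norm_num)
      rw [sub_add_cancel] at this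
      exact this
    have b3 : eLpNorm (gradient (ψ n)) 2 (volume.restrict Ω) ≤
        eLpNorm (fun x => gradient (ψ n) x - wgrad v x) 2 (volume.restrict Ω) +
          eLpNorm (wgrad v) 2 (volume.restrict Ω) := by
      have := eLpNorm_add_le (p := 2) (m3.sub (Lp.aestronglyMeasurable (wgrad v)))
        (Lp.aestronglyMeasurable (wgrad v)) (by norm_num)
      rw [sub_add_cancel] at this
      exact this
    refine b1.trans (add_le_add le_rfl ((hC _ ((hψ n).of_le (by simp))).trans ?_))
    gcongr
  rw [← Lp.enorm_def, ← Lp.enorm_def, ← Lp.enorm_def, ← ofReal_norm, ← ofReal_norm, ← ofReal_norm,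
    ← ENNReal.ofReal_add (norm_nonneg _) (norm_nonneg _), ← ENNReal.ofReal_coe_nnreal,
    ← ENNReal.ofReal_mul C.coe_nonneg, ENNReal.ofReal_le_ofReal_iff (by positivity)] at hle
  refine hle.trans ?_
  rw [mul_comm 2, mul_assoc]
  gcongr
  linarith [norm_toL2_le v, norm_wgrad_le v]

theorem isFiniteMeasure_surface (hΩ : IsBoundedLipschitz Ω) : IsFiniteMeasure (surface Ω) :=
  ⟨surface_univ_lt_top hΩ⟩

theorem memLp_surface_of_continuous (hΩ : IsBoundedLipschitz Ω) {ψ : Space d → ℝ}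
    (hψ : Continuous ψ) : MemLp ψ 2 (surface Ω) := by
  have := isFiniteMeasure_surface hΩ
  have hcomp : IsCompact (frontier Ω) :=
    (hΩ.isBounded.isCompact_closure).of_isClosed_subset isClosed_frontier frontier_subset_closure
  obtain ⟨M, hM⟩ := hcomp.exists_bound_of_continuousOn hψ.continuousOn
  refine MemLp.of_bound hψ.aestronglyMeasurable M ?_
  filter_upwards [ae_restrict_mem isClosed_frontier.measurableSet] with x hx using hM x hx

/-- Existence of the trace: the boundary values of a smooth approximating sequence are Cauchy. -/
theorem exists_isTrace (hΩ : IsBoundedLipschitz Ω) (v : H1 Ω) : ∃ w, IsTrace v w := by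
  obtain ⟨C, hC⟩ := exists_eLpNorm_surface_le hΩ
  have hpos : ∀ n : ℕ, (0 : ℝ≥0∞) < (n + 1 : ℝ≥0∞)⁻¹ := fun n => by simp
  choose ψ hψ h1 h2 using fun n : ℕ => exists_smooth_approx hΩ v (hpos n)
  have hlim : Tendsto (fun n : ℕ => (n + 1 : ℝ≥0∞)⁻¹) atTop (𝓝 0) := by
    have := ENNReal.tendsto_inv_nat_nhds_zero.comp (tendsto_add_atTop_nat 1)
    simpa [Function.comp_def] using this
  have hm : ∀ n, MemLp (ψ n) 2 (surface Ω) := fun n =>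
    memLp_surface_of_continuous hΩ (hψ n).continuous
  have hd : ∀ n m, eLpNorm (ψ n - ψ m) 2 (surface Ω) ≤
      C * (2 * ((n + 1 : ℝ≥0∞)⁻¹ + (m + 1 : ℝ≥0∞)⁻¹)) := by
    intro n m
    refine (hC (ψ n - ψ m) (((hψ n).sub (hψ m)).of_le (by simp))).trans ?_
    gcongr
    have e1 : eLpNorm (ψ n - ψ m) 2 (volume.restrict Ω) ≤
        (n + 1 : ℝ≥0∞)⁻¹ + (m + 1 : ℝ≥0∞)⁻¹ := by
      have := eLpNorm_sub_le (p := 2)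
        ((hψ n).continuous.aestronglyMeasurable.sub (Lp.aestronglyMeasurable (toL2 v)))
        ((hψ m).continuous.aestronglyMeasurable.sub (Lp.aestronglyMeasurable (toL2 v)))
        (by norm_num)
      rw [sub_sub_sub_cancel_right] at this
      exact this.trans (add_le_add (h1 n) (h1 m))
    have e2 : eLpNorm (gradient (ψ n - ψ m)) 2 (volume.restrict Ω) ≤
        (n + 1 : ℝ≥0∞)⁻¹ + (m + 1 : ℝ≥0∞)⁻¹ := by
      have := eLpNorm_sub_le (p := 2)
        ((continuous_gradient (hψ n)).aestronglyMeasurable.sub (Lp.aestronglyMeasurable (wgrad v)))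
        ((continuous_gradient (hψ m)).aestronglyMeasurable.sub (Lp.aestronglyMeasurable (wgrad v)))
        (by norm_num)
      rw [sub_sub_sub_cancel_right] at this
      have hg : gradient (ψ n - ψ m) = gradient (ψ n) - gradient (ψ m) := by
        funext x
        refine ext_inner_right ℝ fun b => ?_
        rw [Pi.sub_apply, inner_sub_left, inner_gradient_left, inner_gradient_left,
          inner_gradient_left, fderiv_sub ((hψ n).differentiable (by simp) x)
            ((hψ m).differentiable (by simp) x)]
        rfl
      rw [hg]
      exact this.trans (add_le_add (h2 n) (h2 m))
    rw [two_mul]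
    exact add_le_add e1 e2
  have hcau : CauchySeq fun n => (hm n).toLp := by
    rw [EMetric.cauchySeq_iff]
    intro ε hε
    have hl : Tendsto (fun n : ℕ => C * (2 * ((n + 1 : ℝ≥0∞)⁻¹ + (n + 1 : ℝ≥0∞)⁻¹))) atTop
        (𝓝 (C * (2 * (0 + 0)))) :=
      ENNReal.Tendsto.const_mul (ENNReal.Tendsto.const_mul (hlim.add hlim)
        (Or.inr (by norm_num))) (Or.inr ENNReal.coe_ne_top)
    simp only [add_zero, mul_zero] at hl
    obtain ⟨N, hN⟩ := (hl.eventually (gt_mem_nhds hε)).exists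
    refine ⟨N, fun n hn m hm' => ?_⟩
    rw [Lp.edist_toLp_toLp]
    refine ((hd n m).trans ?_).trans_lt hN
    gcongr
  obtain ⟨w, hw⟩ := cauchySeq_tendsto_of_complete hcau
  refine ⟨w, ψ, hψ, ?_, ?_, ?_⟩
  · exact tendsto_of_tendsto_of_tendsto_of_le_of_le tendsto_const_nhds hlim (fun _ => zero_le) h1
  · exact tendsto_of_tendsto_of_tendsto_of_le_of_le tendsto_const_nhds hlim (fun _ => zero_le) h2
  · rw [Lp.tendsto_Lp_iff_tendsto_eLpNorm'] at hw
    refine hw.congr fun n => eLpNorm_congr_ae ?_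
    filter_upwards [(hm n).coeFn_toLp] with x hx
    simp [hx]

theorem isTrace_trace (hΩ : IsBoundedLipschitz Ω) (v : H1 Ω) : IsTrace v (trace v) := by
  have h := exists_isTrace hΩ v
  rw [trace, dif_pos h]
  exact h.choose_spec

theorem isTrace_unique (hΩ : IsBoundedLipschitz Ω) {v : H1 Ω} {w w' : L2Bdry Ω}
    (h : IsTrace v w) (h' : IsTrace v w') : w = w' := by
  obtain ⟨C, hC⟩ := exists_isTrace_norm_le hΩ
  have := hC _ _ (h.add_smul h' (-1))
  simpa [← sub_eq_add_neg, sub_eq_zero] using this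

/-- **The trace theorem**: on a bounded Lipschitz set the trace is a bounded linear operator. -/
theorem exists_traceL (hΩ : IsBoundedLipschitz Ω) :
    ∃ L : H1 Ω →L[ℝ] L2Bdry Ω, ∀ v, L v = trace v := by
  obtain ⟨C, hC⟩ := exists_isTrace_norm_le hΩ
  have hz : trace (0 : H1 Ω) = 0 := by
    have := hC _ _ (isTrace_trace hΩ 0)
    simpa using this
  have hlin : ∀ (v v' : H1 Ω) (c : ℝ), trace (v + c • v') = trace v + c • trace v' :=
    fun v v' c => isTrace_unique hΩ (isTrace_trace hΩ _)
      ((isTrace_trace hΩ v).add_smul (isTrace_trace hΩ v') c)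
  exact ⟨LinearMap.mkContinuous
    { toFun := trace
      map_add' := fun v v' => by simpa using hlin v v' 1
      map_smul' := fun c v => by simpa [hz] using hlin 0 v c } C
    fun v => hC v _ (isTrace_trace hΩ v), fun v => rfl⟩

end TraceOperator

end PseudoParabolic

/-! ### Measurable families of operators and Carathéodory equations -/

namespace PseudoParabolic

open scoped ENNReal NNReal

section WeakMeasurability

variable {V : Type*} [NormedAddCommGroup V] [InnerProductSpace ℝ V]

theorem countable_of_orthonormal [SecondCountableTopology V] {w : Set V}
    (hw : Orthonormal ℝ ((↑) : w → V)) : w.Countable := by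
  have hdist : ∀ x ∈ w, ∀ y ∈ w, x ≠ y → 1 < dist x y := by
    intro x hx y hy hxy
    have hx1 : ‖x‖ = 1 := hw.1 ⟨x, hx⟩
    have hy1 : ‖y‖ = 1 := hw.1 ⟨y, hy⟩
    have h0 : ⟪x, y⟫_ℝ = 0 := hw.2 (i := ⟨x, hx⟩) (j := ⟨y, hy⟩) (by simpa using hxy)
    have := norm_sub_sq_real x y
    rw [h0, hx1, hy1] at this
    rw [dist_eq_norm]
    nlinarith [norm_nonneg (x - y)]
  refine Set.PairwiseDisjoint.countable_of_isOpen (s := fun x => Metric.ball x (1 / 2)) ?_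
    (fun _ _ => Metric.isOpen_ball) fun x _ => ⟨x, Metric.mem_ball_self (by norm_num)⟩
  intro x hx y hy hxy
  exact Metric.ball_disjoint_ball (by linarith [hdist x hx y hy hxy])

/-- Pettis' theorem for separable Hilbert spaces. -/
theorem stronglyMeasurable_of_inner [CompleteSpace V] [SecondCountableTopology V]
    {α : Type*} [MeasurableSpace α] {f : α → V}
    (hf : ∀ φ : V, Measurable fun a => ⟪φ, f a⟫_ℝ) : StronglyMeasurable f := by
  obtain ⟨w, b, hb⟩ := exists_hilbertBasis ℝ V
  have hw : w.Countable := countable_of_orthonormal (by rw [← hb]; exact b.orthonormal)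
  have : Countable w := hw.to_subtype
  refine stronglyMeasurable_of_tendsto (u := (atTop : Filter (Finset w)))
    (f := fun s a => ∑ i ∈ s, ⟪b i, f a⟫_ℝ • b i) (fun s => ?_) ?_
  · exact Finset.stronglyMeasurable_fun_sum s fun i _ => (hf (b i)).stronglyMeasurable.smul_const _
  · rw [tendsto_pi_nhds]
    intro a
    simpa [HasSum, b.repr_apply_apply] using b.hasSum_repr (f a)

end WeakMeasurability

section OperatorFamilies

variable {V : Type*} [NormedAddCommGroup V] [InnerProductSpace ℝ V]

/-- For a strongly measurable family of operators, `t ↦ A(t) x(t)` is measurable when `x` is. -/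
theorem stronglyMeasurable_apply {W : Type*} [NormedAddCommGroup W] [NormedSpace ℝ W] {α : Type*}
    [MeasurableSpace α] {A : α → W →L[ℝ] V} (hA : ∀ w, StronglyMeasurable fun t => A t w)
    {x : α → W} (hx : StronglyMeasurable x) : StronglyMeasurable fun t => A t (x t) := by
  refine stronglyMeasurable_of_tendsto atTop (f := fun n t => A t (hx.approx n t)) (fun n => ?_)
    (tendsto_pi_nhds.2 fun t => ((A t).continuous.tendsto _).comp (hx.tendsto_approx t))
  -- on the level sets of a simple function the family is applied to a fixed vector
  have e : (fun t => A t (hx.approx n t)) = fun t => ∑ y ∈ (hx.approx n).range,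
      ((hx.approx n) ⁻¹' {y}).indicator (fun t => A t y) t := by
    funext t
    rw [Finset.sum_eq_single (hx.approx n t)]
    · simp
    · intro y _ hy
      rw [indicator_of_notMem]
      simpa using hy.symm
    · intro h
      exact absurd (SimpleFunc.mem_range_self _ t) h
  rw [e]
  exact Finset.stronglyMeasurable_fun_sum _ fun y _ =>
    (hA y).indicator ((hx.approx n).measurableSet_fiber y)

theorem aestronglyMeasurable_apply {W : Type*} [NormedAddCommGroup W] [NormedSpace ℝ W]
    {α : Type*} [MeasurableSpace α] {μ : Measure α} {A : α → W →L[ℝ] V}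
    (hA : ∀ w, StronglyMeasurable fun t => A t w)
    {x : α → W} (hx : AEStronglyMeasurable x μ) : AEStronglyMeasurable (fun t => A t (x t)) μ :=
  ⟨_, stronglyMeasurable_apply hA hx.stronglyMeasurable_mk, by
    filter_upwards [hx.ae_eq_mk] with t ht
    rw [← ht]⟩

theorem isUnit_of_coercive [CompleteSpace V] {A : V →L[ℝ] V} {c : ℝ} (hc : 0 < c)
    (h : ∀ v, c * ‖v‖ ^ 2 ≤ ⟪A v, v⟫_ℝ) : IsUnit A :=
  A.isUnit_of_forall_le_norm_inner_map (c := ⟨c, hc.le⟩) hc fun x => by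
    refine le_trans ?_ ((h x).trans (le_abs_self _))
    rw [mul_comm]
    exact le_rfl

theorem norm_le_of_coercive {A : V →L[ℝ] V} {c : ℝ}
    (h : ∀ v, c * ‖v‖ ^ 2 ≤ ⟪A v, v⟫_ℝ) (v : V) : c * ‖v‖ ≤ ‖A v‖ := by
  rcases eq_or_ne v 0 with rfl | hv
  · simp
  have hv' : 0 < ‖v‖ := norm_pos_iff.2 hv
  have := (h v).trans (real_inner_le_norm _ _)
  nlinarith

theorem apply_inverse_of_coercive [CompleteSpace V] {A : V →L[ℝ] V} {c : ℝ} (hc : 0 < c)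
    (h : ∀ v, c * ‖v‖ ^ 2 ≤ ⟪A v, v⟫_ℝ) (v : V) : A (Ring.inverse A v) = v :=
  congrArg (fun L : V →L[ℝ] V => L v) (Ring.mul_inverse_cancel A (isUnit_of_coercive hc h))

theorem inverse_apply_of_coercive [CompleteSpace V] {A : V →L[ℝ] V} {c : ℝ} (hc : 0 < c)
    (h : ∀ v, c * ‖v‖ ^ 2 ≤ ⟪A v, v⟫_ℝ) (v : V) : Ring.inverse A (A v) = v :=
  congrArg (fun L : V →L[ℝ] V => L v) (Ring.inverse_mul_cancel A (isUnit_of_coercive hc h))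

theorem norm_inverse_le_of_coercive [CompleteSpace V] {A : V →L[ℝ] V} {c : ℝ} (hc : 0 < c)
    (h : ∀ v, c * ‖v‖ ^ 2 ≤ ⟪A v, v⟫_ℝ) (v : V) : ‖Ring.inverse A v‖ ≤ c⁻¹ * ‖v‖ := by
  have := norm_le_of_coercive h (Ring.inverse A v)
  rw [apply_inverse_of_coercive hc h] at this
  rwa [inv_mul_eq_div, le_div_iff₀' hc]

/-- One step of the damped Richardson iteration contracts. -/
theorem norm_sub_smul_apply_le {A : V →L[ℝ] V} {c M : ℝ} (hc : 0 < c) (hM : c < M)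
    (hA : ‖A‖ ≤ M) (h : ∀ v, c * ‖v‖ ^ 2 ≤ ⟪A v, v⟫_ℝ) (v : V) :
    ‖v - (c / M ^ 2) • A v‖ ≤ Real.sqrt (1 - c ^ 2 / M ^ 2) * ‖v‖ := by
  have hM0 : 0 < M := hc.trans hM
  have hq : 0 ≤ 1 - c ^ 2 / M ^ 2 := by
    rw [sub_nonneg, div_le_one (by positivity)]; gcongr
  refine abs_le_of_sq_le_sq' ?_ (by positivity) |>.2
  rw [mul_pow, Real.sq_sqrt hq, norm_sub_sq_real, real_inner_smul_right, norm_smul,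
    Real.norm_of_nonneg (by positivity), real_inner_comm]
  have h1 : ‖A v‖ ≤ M * ‖v‖ := (A.le_opNorm v).trans (by gcongr)
  have h2 : (c / M ^ 2 * ‖A v‖) ^ 2 ≤ (c / M ^ 2 * (M * ‖v‖)) ^ 2 := by gcongr
  have h3 : c / M ^ 2 * (c * ‖v‖ ^ 2) ≤ c / M ^ 2 * ⟪A v, v⟫_ℝ := by
    gcongr; exact h v
  have e1 : (c / M ^ 2 * (M * ‖v‖)) ^ 2 = c ^ 2 / M ^ 2 * ‖v‖ ^ 2 := by field_simp
  have e2 : c / M ^ 2 * (c * ‖v‖ ^ 2) = c ^ 2 / M ^ 2 * ‖v‖ ^ 2 := by field_simp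
  linarith

/-- The inverses of a measurable, uniformly bounded and coercive family form a measurable family:
they are limits of Richardson iterates. -/
theorem stronglyMeasurable_inverse [CompleteSpace V] {α : Type*} [MeasurableSpace α]
    {A : α → V →L[ℝ] V} (hA : ∀ w, StronglyMeasurable fun t => A t w) {c M : ℝ} (hc : 0 < c)
    (hM : ∀ t, ‖A t‖ ≤ M) (h : ∀ t v, c * ‖v‖ ^ 2 ≤ ⟪A t v, v⟫_ℝ) (w : V) :
    StronglyMeasurable fun t => Ring.inverse (A t) w := by
  -- a bound strictly above `c` makes the contraction rate `√(1 - c²/N²)` well defined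
  set N : ℝ := max M c + 1 with hN
  have hcN : c < N := by rw [hN]; linarith [le_max_right M c]
  have hAN : ∀ t, ‖A t‖ ≤ N := fun t => (hM t).trans (by rw [hN]; linarith [le_max_left M c])
  let θ := c / N ^ 2
  let y : ℕ → α → V := fun n => n.rec (fun _ => 0) fun _ z t => z t - θ • (A t (z t) - w)
  have hsucc : ∀ n t, y (n + 1) t = y n t - θ • (A t (y n t) - w) := fun _ _ => rfl
  have hy : ∀ n, StronglyMeasurable (y n) := by
    intro n
    induction n with
    | zero => exact stronglyMeasurable_const
    | succ n ih =>
      exact ih.sub (((stronglyMeasurable_apply hA ih).sub stronglyMeasurable_const).const_smul θ)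
  set r : ℝ := Real.sqrt (1 - c ^ 2 / N ^ 2) with hr
  have hN0 : 0 < N := hc.trans hcN
  have hr1 : r < 1 := by
    rw [hr, Real.sqrt_lt' one_pos, one_pow, sub_lt_self_iff]; positivity
  have hr0 : 0 ≤ r := Real.sqrt_nonneg _
  have herr : ∀ n t, ‖y n t - Ring.inverse (A t) w‖ ≤ r ^ n * ‖Ring.inverse (A t) w‖ := by
    intro n t
    induction n with
    | zero => simp [y]
    | succ n ih =>
      have e : y (n + 1) t - Ring.inverse (A t) w = (y n t - Ring.inverse (A t) w) -
          θ • A t (y n t - Ring.inverse (A t) w) := by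
        rw [hsucc, map_sub, apply_inverse_of_coercive hc (h t)]
        abel
      rw [e, pow_succ', mul_assoc]
      exact (norm_sub_smul_apply_le hc hcN (hAN t) (h t) _).trans
        (mul_le_mul_of_nonneg_left ih hr0)
  refine stronglyMeasurable_of_tendsto atTop hy (tendsto_pi_nhds.2 fun t => ?_)
  rw [tendsto_iff_norm_sub_tendsto_zero]
  refine squeeze_zero (fun _ => norm_nonneg _) (fun n => herr n t) ?_
  simpa using (tendsto_pow_atTop_nhds_zero_of_lt_one hr0 hr1).mul_const ‖Ring.inverse (A t) w‖

end OperatorFamilies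

section Caratheodory

variable {V : Type*} [NormedAddCommGroup V]

/-- Hypotheses of the Carathéodory existence theorem with a global Lipschitz constant. -/
structure IsCaratheodory (T L : ℝ) (Φ : ℝ → V → V) : Prop where
  meas : ∀ x : ℝ → V, Continuous x → AEStronglyMeasurable (fun s => Φ s (x s))
    (volume.restrict (Ioc 0 T))
  lip : ∀ s ∈ Ioc 0 T, ∀ v w, ‖Φ s v - Φ s w‖ ≤ L * ‖v - w‖
  int : IntegrableOn (fun s => Φ s 0) (Ioc 0 T)

theorem IsCaratheodory.integrableOn {T L : ℝ} {Φ : ℝ → V → V} (h : IsCaratheodory T L Φ)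
    {x : ℝ → V} (hx : Continuous x) : IntegrableOn (fun s => Φ s (x s)) (Ioc 0 T) := by
  have hg : IntegrableOn (fun s => ‖Φ s 0‖ + L * ‖x s‖) (Ioc 0 T) :=
    h.int.norm.add ((continuous_const.mul hx.norm).integrableOn_Ioc)
  refine hg.mono' (h.meas x hx) ?_
  filter_upwards [ae_restrict_mem measurableSet_Ioc] with s hs
  have := h.lip s hs (x s) 0
  rw [sub_zero] at this
  calc ‖Φ s (x s)‖ = ‖Φ s 0 + (Φ s (x s) - Φ s 0)‖ := by congr 1; abel
    _ ≤ _ := (norm_add_le _ _).trans (by gcongr)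

theorem IsCaratheodory.intervalIntegrable {T L : ℝ} {Φ : ℝ → V → V} (h : IsCaratheodory T L Φ)
    {x : ℝ → V} (hx : Continuous x) {a b : ℝ} (ha : a ∈ Icc 0 T) (hb : b ∈ Icc 0 T) :
    IntervalIntegrable (fun s => Φ s (x s)) volume a b := by
  rw [intervalIntegrable_iff]
  refine (h.integrableOn hx).mono_set fun s hs => ?_
  rw [uIoc, mem_Ioc] at hs
  exact ⟨(le_min ha.1 hb.1).trans_lt hs.1, hs.2.trans (max_le ha.2 hb.2)⟩

/-- Global existence and uniqueness for `u' = Φ(t, u)` with `Φ` Lipschitz in `u` and only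
integrable in `t`, in integrated form. -/
theorem IsCaratheodory.exists_unique [NormedSpace ℝ V] [CompleteSpace V] {T L : ℝ} (hT : 0 ≤ T)
    (hL : 0 ≤ L) {Φ : ℝ → V → V} (h : IsCaratheodory T L Φ) (u₀ : V) :
    ∃ u : ℝ → V, Continuous u ∧ (∀ t ∈ Icc 0 T, u t = u₀ + ∫ s in 0..t, Φ s (u s)) ∧
      ∀ u₂ : ℝ → V, ContinuousOn u₂ (Icc 0 T) →
        (∀ t ∈ Icc 0 T, u₂ t = u₀ + ∫ s in 0..t, Φ s (u₂ s)) → ∀ t ∈ Icc 0 T, u₂ t = u t := by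
  -- the substitution `v = e^{-lt} u` makes the integral operator a contraction for `l > L`
  set l : ℝ := 2 * L + 1 with hl
  have hl0 : 0 < l := by positivity
  -- `c` clamps the time to `[0,T]`, so that bounded continuous functions on `ℝ` can be used
  let c : ℝ → ℝ := fun t => max 0 (min t T)
  have hc : Continuous c := by fun_prop
  have hcm : ∀ t, c t ∈ Icc 0 T := fun t => ⟨le_max_left _ _, max_le hT (min_le_right _ _)⟩
  have hcid : ∀ t ∈ Icc 0 T, c t = t := fun t ht => by
    simp only [c, min_eq_left ht.2, max_eq_right ht.1]
  have h0 : (0 : ℝ) ∈ Icc 0 T := ⟨le_rfl, hT⟩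
  have hexp : ∀ v : BoundedContinuousFunction ℝ V, Continuous fun s => Real.exp (l * s) • v s :=
    fun v => (by fun_prop : Continuous fun s => Real.exp (l * s)).smul v.continuous
  let ψ : BoundedContinuousFunction ℝ V → ℝ → V := fun v t =>
    Real.exp (-(l * c t)) • (u₀ + ∫ s in 0..c t, Φ s (Real.exp (l * s) • v s))
  have hbdd : ∀ g : ℝ → V, ContinuousOn g (Icc 0 T) → ∃ C, ∀ t, ‖g (c t)‖ ≤ C := fun g hg =>
    (isCompact_Icc.exists_bound_of_continuousOn hg).imp fun C hC t => hC _ (hcm t)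
  have hprim : ∀ x : ℝ → V, Continuous x →
      ContinuousOn (fun t => u₀ + ∫ s in 0..t, Φ s (x s)) (Icc 0 T) := fun x hx =>
    continuousOn_const.add (intervalIntegral.continuousOn_primitive_interval
      (by rw [uIcc_of_le hT, integrableOn_Icc_iff_integrableOn_Ioc]; exact h.integrableOn hx) |>.mono
        (by rw [uIcc_of_le hT]))
  have hψc : ∀ v, Continuous (ψ v) := fun v =>
    (by fun_prop : Continuous fun t => Real.exp (-(l * c t))).smul
      ((hprim _ (hexp v)).comp_continuous hc hcm)
  have hψb : ∀ v, ∃ C, ∀ t, ‖ψ v t‖ ≤ C := fun v =>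
    hbdd (fun t => Real.exp (-(l * t)) • (u₀ + ∫ s in 0..t, Φ s (Real.exp (l * s) • v s)))
      ((by fun_prop : Continuous fun t => Real.exp (-(l * t))).continuousOn.smul
        (hprim _ (hexp v)))
  let Ψ : BoundedContinuousFunction ℝ V → BoundedContinuousFunction ℝ V := fun v =>
    BoundedContinuousFunction.ofNormedAddCommGroup (ψ v) (hψc v) _ (hψb v).choose_spec
  have hcontr : ContractingWith (1 / 2 : ℝ≥0) Ψ := by
    refine ⟨by rw [← NNReal.coe_lt_coe]; norm_num, LipschitzWith.of_dist_le_mul fun v w => ?_⟩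
    rw [BoundedContinuousFunction.dist_le (by positivity)]
    intro t
    change dist (ψ v t) (ψ w t) ≤ _
    have hI : ‖(∫ s in 0..c t, Φ s (Real.exp (l * s) • v s)) -
        ∫ s in 0..c t, Φ s (Real.exp (l * s) • w s)‖ ≤ L * dist v w * (Real.exp (l * c t) / l) := by
      rw [← intervalIntegral.integral_sub (h.intervalIntegrable (hexp v) h0 (hcm t))
        (h.intervalIntegrable (hexp w) h0 (hcm t))]
      calc _ ≤ ∫ s in 0..c t, L * dist v w * Real.exp (l * s) := by
            refine intervalIntegral.norm_integral_le_of_norm_le (hcm t).1 ?_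
              ((by fun_prop : Continuous fun s =>
                L * dist v w * Real.exp (l * s)).intervalIntegrable _ _)
            refine .of_forall fun s hs => ?_
            refine (h.lip s ⟨hs.1, hs.2.trans (hcm t).2⟩ _ _).trans ?_
            rw [← smul_sub, norm_smul, Real.norm_of_nonneg (Real.exp_pos _).le, mul_assoc,
              mul_comm (dist v w)]
            gcongr
            rw [← dist_eq_norm]
            exact BoundedContinuousFunction.dist_coe_le_dist s
        _ ≤ _ := by
            rw [intervalIntegral.integral_const_mul]
            gcongr
            rw [intervalIntegral.integral_comp_mul_left _ hl0.ne', integral_exp, smul_eq_mul,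
              inv_mul_eq_div]
            gcongr
            linarith [Real.exp_pos (l * 0)]
    rw [dist_eq_norm, ← smul_sub, add_sub_add_left_eq_sub, norm_smul,
      Real.norm_of_nonneg (Real.exp_pos _).le]
    calc _ ≤ Real.exp (-(l * c t)) * (L * dist v w * (Real.exp (l * c t) / l)) := by gcongr
      _ = L / l * dist v w := by
          rw [Real.exp_neg]; field_simp
      _ ≤ _ := by
          gcongr
          rw [div_le_iff₀ hl0]
          push_cast
          linarith
  have hfix : ∀ u : ℝ → V, Continuous u → (∀ t ∈ Icc 0 T, u t = u₀ + ∫ s in 0..t, Φ s (u s)) →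
      ∀ v : BoundedContinuousFunction ℝ V, (∀ t, v t = Real.exp (-(l * c t)) • u (c t)) →
        Function.IsFixedPt Ψ v := by
    intro u hu hueq v hv
    refine BoundedContinuousFunction.ext fun t => ?_
    change ψ v t = v t
    rw [hv t, hueq _ (hcm t)]
    simp only [ψ]
    congr 2
    refine intervalIntegral.integral_congr_ae (.of_forall fun s hs => ?_)
    rw [uIoc_of_le (hcm t).1] at hs
    have hs' : s ∈ Icc 0 T := ⟨hs.1.le, hs.2.trans (hcm t).2⟩
    rw [hv s, hcid s hs', smul_smul, ← Real.exp_add]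
    simp
  obtain ⟨v, hv⟩ : ∃ v, Function.IsFixedPt Ψ v := ⟨_, hcontr.fixedPoint_isFixedPt⟩
  refine ⟨fun s => Real.exp (l * s) • v s, hexp v, fun t ht => ?_, fun u₂ hu₂ hu₂eq t ht => ?_⟩
  · have e : v t = ψ v t := congrArg (fun z : BoundedContinuousFunction ℝ V => z t) hv.symm
    simp only [ψ, hcid t ht] at e
    change Real.exp (l * t) • v t = _
    rw [e, smul_smul, ← Real.exp_add]
    simp
  · have hu₂c : Continuous fun t => u₂ (c t) := hu₂.comp_continuous hc hcm
    obtain ⟨C, hC⟩ := hbdd (fun t => Real.exp (-(l * t)) • u₂ t)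
      ((by fun_prop : Continuous fun t => Real.exp (-(l * t))).continuousOn.smul hu₂)
    let v₂ : BoundedContinuousFunction ℝ V := BoundedContinuousFunction.ofNormedAddCommGroup
      (fun t => Real.exp (-(l * c t)) • u₂ (c t))
      ((by fun_prop : Continuous fun t => Real.exp (-(l * c t))).smul hu₂c) C hC
    have hv₂ : Function.IsFixedPt Ψ v₂ := by
      refine hfix (fun t => u₂ (c t)) hu₂c (fun t ht => ?_) v₂ fun t => ?_
      · rw [hcid t ht, hu₂eq t ht]
        congr 1
        refine intervalIntegral.integral_congr_ae (.of_forall fun s hs => ?_)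
        rw [uIoc_of_le ht.1] at hs
        rw [hcid s ⟨hs.1.le, hs.2.trans ht.2⟩]
      · rw [hcid _ (hcm t)]; rfl
    have e : v₂ t = v t := by rw [hcontr.fixedPoint_unique' hv₂ hv]
    change Real.exp (-(l * c t)) • u₂ (c t) = v t at e
    rw [hcid t ht] at e
    change u₂ t = Real.exp (l * t) • v t
    rw [← e, smul_smul, ← Real.exp_add]
    simp

end Caratheodory

end PseudoParabolic

/-! ### Time cells and averages -/

namespace PseudoParabolic

open scoped ENNReal NNReal

section Cells

/-- The `i`-th time cell `((i-1)τ, iτ]`, `τ = T/n`. -/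
def cell (T : ℝ) (n i : ℕ) : Set ℝ := Ioc (((i : ℝ) - 1) * (T / n)) ((i : ℝ) * (T / n))

variable {T : ℝ} {n i : ℕ}

theorem mem_cell_iff (hT : 0 < T) (hn : 1 ≤ n) (hi : 1 ≤ i) {s : ℝ} :
    s ∈ cell T n i ↔ stepIndex T n s = i := by
  have hτ : 0 < T / n := div_pos hT (by exact_mod_cast hn)
  rw [stepIndex, Nat.ceil_eq_iff (by omega), cell, mem_Ioc, lt_div_iff₀ hτ, div_le_iff₀ hτ,
    Nat.cast_sub hi, Nat.cast_one]

theorem stepIndex_mem (hT : 0 < T) (hn : 1 ≤ n) {s : ℝ} (hs : s ∈ Ioc 0 T) :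
    stepIndex T n s ∈ Finset.Icc 1 n := by
  have hn0 : (0 : ℝ) < n := by exact_mod_cast hn
  rw [Finset.mem_Icc, stepIndex]
  refine ⟨Nat.one_le_ceil_iff.2 (div_pos hs.1 (by positivity)), Nat.ceil_le.2 ?_⟩
  rw [div_le_iff₀ (by positivity), mul_div_cancel₀ _ hn0.ne']
  exact hs.2

theorem mem_cell_stepIndex (hT : 0 < T) (hn : 1 ≤ n) {s : ℝ} (hs : s ∈ Ioc 0 T) :
    s ∈ cell T n (stepIndex T n s) :=
  (mem_cell_iff hT hn (Finset.mem_Icc.1 (stepIndex_mem hT hn hs)).1).2 rfl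

theorem cell_subset (hT : 0 < T) (hn : 1 ≤ n) (hi : 1 ≤ i) (hin : i ≤ n) :
    cell T n i ⊆ Ioc 0 T := by
  have hn0 : (0 : ℝ) < n := by exact_mod_cast hn
  have hi1 : (1 : ℝ) ≤ i := by exact_mod_cast hi
  have hin' : (i : ℝ) ≤ n := by exact_mod_cast hin
  refine Ioc_subset_Ioc (mul_nonneg (by linarith) (by positivity)) ?_
  calc (i : ℝ) * (T / n) ≤ n * (T / n) := by gcongr
    _ = T := mul_div_cancel₀ _ hn0.ne'

theorem node_mem (hT : 0 < T) (hn : 1 ≤ n) (hin : i ≤ n) : (i : ℝ) * (T / n) ∈ Icc 0 T := by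
  have hn0 : (0 : ℝ) < n := by exact_mod_cast hn
  have hin' : (i : ℝ) ≤ n := by exact_mod_cast hin
  refine ⟨by positivity, ?_⟩
  calc (i : ℝ) * (T / n) ≤ n * (T / n) := by gcongr
    _ = T := mul_div_cancel₀ _ hn0.ne'

theorem measurableSet_cell : MeasurableSet (cell T n i) := measurableSet_Ioc

theorem volume_cell : volume (cell T n i) = ENNReal.ofReal (T / n) := by
  rw [cell, Real.volume_Ioc]; congr 1; ring

theorem lintegral_eq_sum_cells (hT : 0 < T) (hn : 1 ≤ n) (f : ℝ → ℝ≥0∞) :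
    ∫⁻ s in Ioo 0 T, f s = ∑ i ∈ Finset.Icc 1 n, ∫⁻ s in cell T n i, f s := by
  rw [Measure.restrict_congr_set Ioo_ae_eq_Ioc,
    ← lintegral_biUnion_finset _ fun i _ => measurableSet_cell]
  · congr 2
    ext s
    simp only [mem_iUnion, exists_prop]
    exact ⟨fun hs => ⟨_, stepIndex_mem hT hn hs, mem_cell_stepIndex hT hn hs⟩,
      fun ⟨i, hi, hs⟩ => cell_subset hT hn (Finset.mem_Icc.1 hi).1 (Finset.mem_Icc.1 hi).2 hs⟩
  · intro i hi j hj hij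
    refine Set.disjoint_left.2 fun s hs hs' => hij ?_
    rw [mem_cell_iff hT hn (Finset.mem_Icc.1 hi).1] at hs
    rw [mem_cell_iff hT hn (Finset.mem_Icc.1 hj).1] at hs'
    exact hs.symm.trans hs'

theorem measurable_stepIndex (T : ℝ) (n : ℕ) : Measurable (stepIndex T n) :=
  Nat.measurable_ceil.comp (measurable_id.div_const _)

theorem stronglyMeasurable_rotheStep {X : Type*} [TopologicalSpace X] (T : ℝ) (n : ℕ) (V : ℕ → X) :
    StronglyMeasurable (rotheStep T n V) :=
  (StronglyMeasurable.of_discrete (f := V)).comp_measurable (measurable_stepIndex T n)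

end Cells

section StepMean

variable {X : Type*} [NormedAddCommGroup X] [NormedSpace ℝ X] {T : ℝ} {n i : ℕ}

theorem stepMean_eq (hT : 0 < T) (z : ℝ → X) :
    stepMean T n z i = (T / n)⁻¹ • ∫ s in cell T n i, z s := by
  rw [stepMean, intervalIntegral.integral_of_le]; · rfl
  have : 0 ≤ T / n := by positivity
  nlinarith

theorem MemL2Time.integrableOn_cell {Y : Type*} [NormedAddCommGroup Y] {z : ℝ → Y}
    (hz : MemL2Time T z) (hT : 0 < T) (hn : 1 ≤ n)
    (hi : 1 ≤ i) (hin : i ≤ n) : IntegrableOn z (cell T n i) := by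
  have h : IntegrableOn z (Ioo 0 T) := MemLp.integrable (by norm_num) hz
  exact ((integrableOn_Ioc_iff_integrableOn_Ioo (by simp)).2 h).mono_set (cell_subset hT hn hi hin)

theorem stepMean_add (hT : 0 < T) {z w : ℝ → X} (hz : IntegrableOn z (cell T n i))
    (hw : IntegrableOn w (cell T n i)) :
    stepMean T n (fun s => z s + w s) i = stepMean T n z i + stepMean T n w i := by
  rw [stepMean_eq hT, stepMean_eq hT, stepMean_eq hT, integral_add hz hw, smul_add]

theorem stepMean_sub (hT : 0 < T) {z w : ℝ → X} (hz : IntegrableOn z (cell T n i))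
    (hw : IntegrableOn w (cell T n i)) :
    stepMean T n (fun s => z s - w s) i = stepMean T n z i - stepMean T n w i := by
  rw [stepMean_eq hT, stepMean_eq hT, stepMean_eq hT, integral_sub hz hw, smul_sub]

theorem stepMean_clm {Y : Type*} [NormedAddCommGroup Y] [NormedSpace ℝ Y] [CompleteSpace X]
    [CompleteSpace Y] (hT : 0 < T) (L : X →L[ℝ] Y) {z : ℝ → X} (hz : IntegrableOn z (cell T n i)) :
    stepMean T n (fun s => L (z s)) i = L (stepMean T n z i) := by
  rw [stepMean_eq hT, stepMean_eq hT, ContinuousLinearMap.integral_comp_comm L hz, map_smul]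

theorem stepMean_const [CompleteSpace X] (hT : 0 < T) (hn : 1 ≤ n) (c : X) :
    stepMean T n (fun _ => c) i = c := by
  have hn0 : (0 : ℝ) < n := by exact_mod_cast hn
  have hτ : 0 < T / n := by positivity
  rw [stepMean_eq hT, setIntegral_const, measureReal_def, volume_cell,
    ENNReal.toReal_ofReal hτ.le, smul_smul, inv_mul_cancel₀ hτ.ne', one_smul]

theorem stepMean_congr_ae (hT : 0 < T) {z w : ℝ → X}
    (h : ∀ᵐ s ∂(volume.restrict (cell T n i)), z s = w s) :
    stepMean T n z i = stepMean T n w i := by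
  rw [stepMean_eq hT, stepMean_eq hT, integral_congr_ae h]

theorem norm_stepMean_le (hT : 0 < T) {z : ℝ → X} {w : ℝ → ℝ} (hw : IntegrableOn w (cell T n i))
    (h : ∀ᵐ s ∂(volume.restrict (cell T n i)), ‖z s‖ ≤ w s) :
    ‖stepMean T n z i‖ ≤ stepMean T n w i := by
  have hτ : 0 ≤ T / n := by positivity
  rw [stepMean_eq hT, stepMean_eq hT, norm_smul, smul_eq_mul,
    Real.norm_of_nonneg (inv_nonneg.2 hτ)]
  gcongr
  exact norm_integral_le_of_norm_le hw h

/-- An almost everywhere statement on `(0,T)` holds almost everywhere on each cell. -/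
theorem ae_cell_of_ae (hT : 0 < T) (hn : 1 ≤ n) (hi : 1 ≤ i) (hin : i ≤ n) {P : ℝ → Prop}
    (h : ∀ᵐ s ∂(volume.restrict (Ioo 0 T)), P s) : ∀ᵐ s ∂(volume.restrict (cell T n i)), P s := by
  rw [Measure.restrict_congr_set Ioo_ae_eq_Ioc] at h
  exact ae_restrict_of_ae_restrict_of_subset (cell_subset hT hn hi hin) h

/-- Jensen's inequality on a cell. -/
theorem enorm_stepMean_sq_le (hT : 0 < T) (hn : 1 ≤ n) {z : ℝ → X}
    (hz : AEStronglyMeasurable z (volume.restrict (cell T n i))) :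
    ENNReal.ofReal (T / n) * ‖stepMean T n z i‖ₑ ^ 2 ≤ ∫⁻ s in cell T n i, ‖z s‖ₑ ^ 2 := by
  have hn0 : (0 : ℝ) < n := by exact_mod_cast hn
  have hτ : 0 < T / n := by positivity
  set c : ℝ≥0∞ := ENNReal.ofReal (T / n) with hc
  have hc0 : c ≠ 0 := by simpa [hc] using hτ
  have hct : c ≠ ⊤ := ENNReal.ofReal_ne_top
  have h1 : ‖stepMean T n z i‖ₑ ≤ ∫⁻ s in cell T n i, c⁻¹ * ‖z s‖ₑ := by
    rw [stepMean_eq hT, enorm_smul, lintegral_const_mul' _ _ (ENNReal.inv_ne_top.2 hc0),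
      Real.enorm_eq_ofReal (inv_nonneg.2 hτ.le), ENNReal.ofReal_inv_of_pos hτ]
    gcongr
    exact enorm_integral_le_lintegral_enorm _
  have h2 : (∫⁻ s in cell T n i, c⁻¹ * ‖z s‖ₑ) ^ 2 ≤ ∫⁻ s in cell T n i, c⁻¹ * ‖z s‖ₑ ^ 2 := by
    refine lintegral_mul_sq_le measurable_const hz.enorm ?_
    rw [lintegral_const, Measure.restrict_apply_univ, volume_cell, ENNReal.inv_mul_cancel hc0 hct]
  calc _ ≤ c * ∫⁻ s in cell T n i, c⁻¹ * ‖z s‖ₑ ^ 2 := by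
        gcongr; exact (pow_le_pow_left' h1 2).trans h2
    _ = _ := by
        rw [lintegral_const_mul' _ _ (ENNReal.inv_ne_top.2 hc0), ← mul_assoc,
          ENNReal.mul_inv_cancel hc0 hct, one_mul]

/-- Averaging over the time cells is a contraction of `L²`. -/
theorem eLpNorm_rotheStep_stepMean_le (hT : 0 < T) (hn : 1 ≤ n) {z : ℝ → X}
    (hz : AEStronglyMeasurable z (volume.restrict (Ioo 0 T))) :
    eLpNorm (rotheStep T n (stepMean T n z)) 2 (volume.restrict (Ioo 0 T)) ≤
      eLpNorm z 2 (volume.restrict (Ioo 0 T)) := by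
  rw [← ENNReal.pow_le_pow_left_iff two_ne_zero, eLpNorm_two_sq, eLpNorm_two_sq,
    lintegral_eq_sum_cells hT hn, lintegral_eq_sum_cells hT hn]
  refine Finset.sum_le_sum fun i hi => ?_
  obtain ⟨hi, hin⟩ := Finset.mem_Icc.1 hi
  have hz' : AEStronglyMeasurable z (volume.restrict (cell T n i)) := by
    rw [Measure.restrict_congr_set Ioo_ae_eq_Ioc] at hz
    exact hz.mono_set (cell_subset hT hn hi hin)
  refine le_trans (le_of_eq ?_) (enorm_stepMean_sq_le hT hn hz')
  rw [← volume_cell (i := i), mul_comm, ← setLIntegral_const]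
  refine setLIntegral_congr_fun measurableSet_cell fun s hs => ?_
  rw [rotheStep, (mem_cell_iff hT hn hi).1 hs]

end StepMean

section L2Convergence

variable {X : Type*} [NormedAddCommGroup X] {T : ℝ}

/-- The functions `e n` tend to `0` in `L²((0,T); X)`. -/
def L2Null (T : ℝ) (e : ℕ → ℝ → X) : Prop :=
  Tendsto (fun n => eLpNorm (e n) 2 (volume.restrict (Ioo 0 T))) atTop (𝓝 0)

theorem L2Null.mono {Y : Type*} [NormedAddCommGroup Y] {e : ℕ → ℝ → X} {e' : ℕ → ℝ → Y}
    (h : L2Null T e) (hle : ∀ᶠ n in atTop, ∀ᵐ s ∂(volume.restrict (Ioo 0 T)), ‖e' n s‖ ≤ ‖e n s‖) :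
    L2Null T e' :=
  tendsto_of_tendsto_of_tendsto_of_le_of_le' tendsto_const_nhds h (.of_forall fun _ => zero_le)
    (hle.mono fun _ hn => eLpNorm_mono_ae hn)

theorem L2Null.add {e e' : ℕ → ℝ → X} (h : L2Null T e) (h' : L2Null T e')
    (he : ∀ n, AEStronglyMeasurable (e n) (volume.restrict (Ioo 0 T)))
    (he' : ∀ n, AEStronglyMeasurable (e' n) (volume.restrict (Ioo 0 T))) :
    L2Null T fun n s => e n s + e' n s := by
  have hl : Tendsto (fun n => eLpNorm (e n) 2 (volume.restrict (Ioo 0 T)) +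
      eLpNorm (e' n) 2 (volume.restrict (Ioo 0 T))) atTop (𝓝 0) := by
    simpa using Tendsto.add h h'
  exact tendsto_of_tendsto_of_tendsto_of_le_of_le tendsto_const_nhds hl (fun _ => zero_le)
    fun n => eLpNorm_add_le (he n) (he' n) (by norm_num)

theorem L2Null.norm {e : ℕ → ℝ → X} (h : L2Null T e) : L2Null T fun n s => ‖e n s‖ :=
  h.mono (.of_forall fun _ => .of_forall fun _ => by simp)

theorem L2Null.const_mul {e : ℕ → ℝ → ℝ} (h : L2Null T e) (c : ℝ) :
    L2Null T fun n s => c * e n s := by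
  have hl : Tendsto (fun n => ‖c‖ₑ * eLpNorm (e n) 2 (volume.restrict (Ioo 0 T))) atTop (𝓝 0) := by
    simpa using ENNReal.Tendsto.const_mul h (Or.inr (enorm_ne_top (x := c)))
  refine hl.congr fun n => ?_
  rw [← eLpNorm_const_smul]
  rfl

/-- Uniformly small functions tend to `0` in `L²((0,T))`, also after multiplication by a fixed
square integrable function. -/
theorem L2Null.of_uniform_mul {e : ℕ → ℝ → X} {w : ℝ → ℝ} (hw : MemL2Time T w)
    (h : ∀ ε : ℝ, 0 < ε → ∀ᶠ n in atTop, ∀ s ∈ Ioo 0 T, ‖e n s‖ ≤ ε * |w s|) : L2Null T e := by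
  have hwt : eLpNorm w 2 (volume.restrict (Ioo 0 T)) ≠ ⊤ := hw.2.ne
  rw [L2Null, ENNReal.tendsto_nhds_zero]
  intro δ hδ
  obtain ⟨ε, hε, hεδ⟩ : ∃ ε : ℝ≥0, 0 < ε ∧ ε * eLpNorm w 2 (volume.restrict (Ioo 0 T)) ≤ δ := by
    have ht : Tendsto (fun ε : ℝ≥0 => (ε : ℝ≥0∞) * eLpNorm w 2 (volume.restrict (Ioo 0 T)))
        (𝓝[>] 0) (𝓝 0) := by
      have h1 : Tendsto (fun ε : ℝ≥0 => (ε : ℝ≥0∞)) (𝓝[>] 0) (𝓝 0) :=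
        (ENNReal.tendsto_coe.2 tendsto_id).mono_left nhdsWithin_le_nhds
      simpa using ENNReal.Tendsto.mul_const h1 (Or.inr hwt)
    obtain ⟨ε, h1, h2⟩ := ((ht.eventually (Iic_mem_nhds hδ)).and self_mem_nhdsWithin).exists
    exact ⟨ε, h2, h1⟩
  filter_upwards [h ε hε] with n hn
  refine (eLpNorm_le_mul_eLpNorm_of_ae_le_mul (c := ε) (g := w) ?_ 2).trans ?_
  · filter_upwards [ae_restrict_mem measurableSet_Ioo] with s hs using hn s hs
  · rwa [← ENNReal.ofReal_coe_nnreal] at hεδ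

theorem memL2Time_const (T : ℝ) (c : X) : MemL2Time T fun _ => c := memLp_const c

theorem L2Null.of_uniform {e : ℕ → ℝ → X}
    (h : ∀ ε : ℝ, 0 < ε → ∀ᶠ n in atTop, ∀ s ∈ Ioo 0 T, ‖e n s‖ ≤ ε) : L2Null T e :=
  L2Null.of_uniform_mul (memL2Time_const T (1 : ℝ)) (by simpa using h)

/-- A function that is continuous on `[0,T]` varies little over a cell. -/
theorem eventually_norm_sub_node_le {x : ℝ → X} (hT : 0 < T) (hx : ContinuousOn x (Icc 0 T)) {ε : ℝ}
    (hε : 0 < ε) : ∀ᶠ n : ℕ in atTop, ∀ i, 1 ≤ i → i ≤ n → ∀ s ∈ cell T n i,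
      ‖x s - x (i * (T / n))‖ ≤ ε ∧ ‖x s - x ((i - 1 : ℕ) * (T / n))‖ ≤ ε := by
  have hu := isCompact_Icc.uniformContinuousOn_of_continuous hx
  obtain ⟨δ, hδ, hδ'⟩ := Metric.uniformContinuousOn_iff.1 hu ε hε
  have hl : Tendsto (fun n : ℕ => T / n) atTop (𝓝 0) := tendsto_const_div_atTop_nhds_zero_nat T
  filter_upwards [hl.eventually (gt_mem_nhds hδ), eventually_ge_atTop 1] with n hn hn1 i hi hin s hs
  have hsT := Ioc_subset_Icc_self (cell_subset hT hn1 hi hin hs)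
  have hc : (((i - 1 : ℕ) : ℝ)) = (i : ℝ) - 1 := by rw [Nat.cast_sub hi, Nat.cast_one]
  rw [← dist_eq_norm, ← dist_eq_norm]
  refine ⟨(hδ' s hsT _ (node_mem hT hn1 hin) ?_).le,
    (hδ' s hsT _ (node_mem hT hn1 (by omega)) ?_).le⟩
  · rw [Real.dist_eq, abs_lt]
    have := hs.1; have := hs.2
    constructor <;> linarith
  · rw [hc, Real.dist_eq, abs_lt]
    have := hs.1; have := hs.2
    constructor <;> linarith

variable [NormedSpace ℝ X]

/-- The averages of a square integrable function over the time cells converge to it. -/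
theorem l2Null_stepMean_sub [CompleteSpace X] (hT : 0 < T) {z : ℝ → X} (hz : MemL2Time T z) :
    L2Null T fun n s => rotheStep T n (stepMean T n z) s - z s := by
  rw [L2Null, ENNReal.tendsto_nhds_zero]
  intro ε hε
  -- approximation by a continuous function; averaging does not increase the error
  obtain ⟨w, hwc, hwz, hw, hwm⟩ := hz.exists_hasCompactSupport_eLpNorm_sub_le (by norm_num)
    (ENNReal.div_pos hε.ne' (by norm_num : (3 : ℝ≥0∞) ≠ ⊤)).ne'
  have hw0 : L2Null T fun n s => rotheStep T n (stepMean T n w) s - w s := by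
    refine L2Null.of_uniform fun η hη => ?_
    filter_upwards [eventually_norm_sub_node_le (ε := η / 2) hT hw.continuousOn (by positivity),
      eventually_ge_atTop 1] with n hn hn1 s hs
    obtain ⟨hi, hin⟩ := Finset.mem_Icc.1 (stepIndex_mem hT hn1 (Ioo_subset_Ioc_self hs))
    have hsc := mem_cell_stepIndex hT hn1 (Ioo_subset_Ioc_self hs)
    set i := stepIndex T n s with hi_def
    have e : rotheStep T n (stepMean T n w) s - w s = stepMean T n (fun r => w r - w s) i := by
      rw [stepMean_sub hT (MemL2Time.integrableOn_cell hwm hT hn1 hi hin)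
        ((memL2Time_const T (w s)).integrableOn_cell hT hn1 hi hin), stepMean_const hT hn1]
      rfl
    rw [e]
    refine (norm_stepMean_le (w := fun _ => η) hT
      ((memL2Time_const T η).integrableOn_cell hT hn1 hi hin) ?_).trans_eq (stepMean_const hT hn1 η)
    filter_upwards [ae_restrict_mem measurableSet_cell] with r hr
    have h1 := (hn i hi hin r hr).1
    have h2 := (hn i hi hin s hsc).1
    calc ‖w r - w s‖ = ‖(w r - w (i * (T / n))) - (w s - w (i * (T / n)))‖ := by congr 1; abel
      _ ≤ _ := (norm_sub_le _ _).trans (by linarith)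
  filter_upwards [(ENNReal.tendsto_nhds_zero.1 hw0) (ε / 3)
    (ENNReal.div_pos hε.ne' (by norm_num)), eventually_ge_atTop 1] with n hn hn1
  have hzw : MemL2Time T (fun s => z s - w s) := hz.sub hwm
  have hsm := fun V : ℕ → X => (stronglyMeasurable_rotheStep T n V).aestronglyMeasurable
    (μ := volume.restrict (Ioo 0 T))
  have e : (fun s => rotheStep T n (stepMean T n z) s - z s) =ᵐ[volume.restrict (Ioo 0 T)]
      (rotheStep T n (stepMean T n fun s => z s - w s) +
        fun s => rotheStep T n (stepMean T n w) s - w s) - fun s => z s - w s := by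
    filter_upwards [ae_restrict_mem measurableSet_Ioo] with s hs
    obtain ⟨hi, hin⟩ := Finset.mem_Icc.1 (stepIndex_mem hT hn1 (Ioo_subset_Ioc_self hs))
    simp only [Pi.sub_apply, Pi.add_apply, rotheStep]
    rw [stepMean_sub hT (MemL2Time.integrableOn_cell hz hT hn1 hi hin)
      (MemL2Time.integrableOn_cell hwm hT hn1 hi hin)]
    abel
  rw [eLpNorm_congr_ae e]
  refine (eLpNorm_sub_le ((hsm _).add ((hsm _).sub hwm.1)) hzw.1 (by norm_num)).trans ?_
  refine (add_le_add (eLpNorm_add_le (hsm _) ((hsm _).sub hwm.1) (by norm_num)) le_rfl).trans ?_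
  calc _ ≤ ε / 3 + ε / 3 + ε / 3 := by
        gcongr
        · exact (eLpNorm_rotheStep_stepMean_le hT hn1 hzw.1).trans hwz
        · exact hn
        · exact hwz
    _ = ε := ENNReal.add_thirds ε

end L2Convergence

end PseudoParabolic

/-! ### The abstract evolution equation -/

namespace PseudoParabolic

open scoped ENNReal NNReal

section Evolution

theorem memL2Time_of_continuousOn {X : Type*} [NormedAddCommGroup X] {T : ℝ}
    {z : ℝ → X} (hz : ContinuousOn z (Icc 0 T)) : MemL2Time T z := by
  obtain ⟨C, hC⟩ := isCompact_Icc.exists_bound_of_continuousOn hz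
  obtain h | h := (Icc (0 : ℝ) T).eq_empty_or_nonempty
  · have : Ioo (0 : ℝ) T = ∅ := subset_empty_iff.1 (h ▸ Ioo_subset_Icc_self)
    simp [MemL2Time, this]
  refine MemLp.of_bound (AEStronglyMeasurable.mono_measure (μ := volume.restrict (Icc 0 T)) ?_
    (Measure.restrict_mono Ioo_subset_Icc_self le_rfl)) C ?_
  · exact hz.aestronglyMeasurable_of_isCompact isCompact_Icc measurableSet_Icc
  · filter_upwards [ae_restrict_mem measurableSet_Ioo] with s hs using hC s (Ioo_subset_Icc_self hs)

/-- The data of the abstract evolution equation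
`A(t) u' + K(t) u = f(u) + b(t) + (ν(t) - j(u)) q(t)`, `u(0) = u₀`, in a Hilbert space. The last
term is the source `h(t) p(t)` after elimination of `h`. -/
structure EvolutionProblem (V : Type*) [NormedAddCommGroup V] [InnerProductSpace ℝ V] where
  A : ℝ → V →L[ℝ] V
  K : ℝ → V →L[ℝ] V
  f : V → V
  j : V → ℝ
  q : ℝ → V
  b : ℝ → V
  ν : ℝ → ℝ
  u₀ : V

variable {V : Type*} [NormedAddCommGroup V] [InnerProductSpace ℝ V]

/-- The standing assumptions on an evolution problem, with one constant `M` for all upper bounds. -/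
structure EvolutionProblem.Regular (P : EvolutionProblem V) (T α M : ℝ) : Prop where
  α_pos : 0 < α
  M_nonneg : 0 ≤ M
  A_meas : ∀ w, StronglyMeasurable fun t => P.A t w
  K_meas : ∀ w, StronglyMeasurable fun t => P.K t w
  A_bound : ∀ t, ‖P.A t‖ ≤ M
  K_bound : ∀ t, ‖P.K t‖ ≤ M
  coercive : ∀ t v, α * ‖v‖ ^ 2 ≤ ⟪P.A t v, v⟫_ℝ
  f_lip : ∀ v w, ‖P.f v - P.f w‖ ≤ M * ‖v - w‖
  j_lip : ∀ v w, |P.j v - P.j w| ≤ M * ‖v - w‖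
  q_cont : ContinuousOn P.q (Icc 0 T)
  q_bound : ∀ t ∈ Icc 0 T, ‖P.q t‖ ≤ M
  b_mem : MemL2Time T P.b
  ν_mem : MemL2Time T P.ν

namespace EvolutionProblem

variable {P : EvolutionProblem V} {T α M : ℝ}

/-- The right-hand side of the equation. -/
noncomputable def rhs (P : EvolutionProblem V) (t : ℝ) (v : V) : V :=
  P.f v + P.b t + (P.ν t - P.j v) • P.q t

theorem Regular.f_continuous (h : P.Regular T α M) : Continuous P.f :=
  (LipschitzWith.of_dist_le_mul (K := ⟨M, h.M_nonneg⟩) fun v w => by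
    rw [dist_eq_norm, dist_eq_norm]; exact h.f_lip v w).continuous

theorem Regular.j_continuous (h : P.Regular T α M) : Continuous P.j :=
  (LipschitzWith.of_dist_le_mul (K := ⟨M, h.M_nonneg⟩) fun v w => by
    rw [Real.dist_eq, dist_eq_norm]; exact h.j_lip v w).continuous

theorem Regular.aestronglyMeasurable_q (h : P.Regular T α M) :
    AEStronglyMeasurable P.q (volume.restrict (Ioo 0 T)) :=
  (h.q_cont.mono Ioo_subset_Icc_self).aestronglyMeasurable measurableSet_Ioo

theorem Regular.memL2Time_rhs (h : P.Regular T α M) {x : ℝ → V} (hx : ContinuousOn x (Icc 0 T)) :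
    MemL2Time T fun s => P.rhs s (x s) := by
  have h1 : MemL2Time T fun s => P.ν s - P.j (x s) :=
    h.ν_mem.sub (memL2Time_of_continuousOn (h.j_continuous.comp_continuousOn hx))
  have h2 : MemL2Time T fun s => (P.ν s - P.j (x s)) • P.q s := by
    refine MemLp.of_le_mul (c := M) h1 (h1.1.smul h.aestronglyMeasurable_q) ?_
    filter_upwards [ae_restrict_mem measurableSet_Ioo] with s hs
    rw [norm_smul, mul_comm]
    gcongr
    exact h.q_bound s (Ioo_subset_Icc_self hs)
  exact ((memL2Time_of_continuousOn (h.f_continuous.comp_continuousOn hx)).add h.b_mem).add h2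

theorem Regular.norm_rhs_sub_le (h : P.Regular T α M) {s : ℝ} (hs : s ∈ Icc 0 T) (v w : V) :
    ‖P.rhs s v - P.rhs s w‖ ≤ (M + M * M) * ‖v - w‖ := by
  have e : P.rhs s v - P.rhs s w = (P.f v - P.f w) + (P.j w - P.j v) • P.q s := by
    simp only [rhs]; module
  have hM := h.M_nonneg
  rw [e]
  calc _ ≤ ‖P.f v - P.f w‖ + ‖(P.j w - P.j v) • P.q s‖ := norm_add_le _ _
    _ ≤ M * ‖v - w‖ + (M * ‖v - w‖) * M := by
        rw [norm_smul, Real.norm_eq_abs, abs_sub_comm]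
        gcongr
        · exact h.f_lip v w
        · exact h.j_lip v w
        · exact h.q_bound s hs
    _ = _ := by ring

variable [CompleteSpace V]

/-- The velocity prescribed by the equation. -/
noncomputable def velocity (P : EvolutionProblem V) (t : ℝ) (v : V) : V :=
  Ring.inverse (P.A t) (P.rhs t v - P.K t v)

theorem Regular.eq_velocity_iff (h : P.Regular T α M) (t : ℝ) (v w : V) :
    P.A t w + P.K t v = P.rhs t v ↔ w = P.velocity t v := by
  rw [velocity, ← eq_sub_iff_add_eq]
  constructor
  · intro e
    rw [← e, inverse_apply_of_coercive h.α_pos (h.coercive t)]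
  · rintro rfl
    exact apply_inverse_of_coercive h.α_pos (h.coercive t) _

/-- Along a continuous curve the velocity is square integrable in time. -/
theorem Regular.memL2Time_velocity (h : P.Regular T α M) {x : ℝ → V}
    (hx : ContinuousOn x (Icc 0 T)) :
    MemL2Time T fun s => P.velocity s (x s) := by
  have hxm := (hx.mono Ioo_subset_Icc_self).aestronglyMeasurable (μ := volume) measurableSet_Ioo
  obtain ⟨C, hC⟩ := isCompact_Icc.exists_bound_of_continuousOn hx
  have hK : MemL2Time T fun s => P.K s (x s) := by
    refine MemLp.of_bound (aestronglyMeasurable_apply h.K_meas hxm) (M * C) ?_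
    filter_upwards [ae_restrict_mem measurableSet_Ioo] with s hs
    exact ((P.K s).le_opNorm _).trans (mul_le_mul (h.K_bound s) (hC s (Ioo_subset_Icc_self hs))
      (norm_nonneg _) h.M_nonneg)
  have hR := (h.memL2Time_rhs hx).sub hK
  refine MemLp.of_le_mul (c := α⁻¹) hR (aestronglyMeasurable_apply
    (fun w => stronglyMeasurable_inverse h.A_meas h.α_pos h.A_bound h.coercive w) hR.1) ?_
  exact .of_forall fun s => norm_inverse_le_of_coercive h.α_pos (h.coercive s) _

theorem Regular.isCaratheodory (h : P.Regular T α M) :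
    IsCaratheodory T (α⁻¹ * (M + M * M + M)) P.velocity where
  meas x hx := by
    rw [Measure.restrict_congr_set Ioo_ae_eq_Ioc.symm]
    exact (h.memL2Time_velocity hx.continuousOn).1
  lip s hs v w := by
    have hs' : s ∈ Icc 0 T := Ioc_subset_Icc_self hs
    have hα := h.α_pos
    rw [velocity, velocity, ← map_sub]
    refine (norm_inverse_le_of_coercive h.α_pos (h.coercive s) _).trans ?_
    rw [mul_assoc]
    gcongr
    have e : P.rhs s v - P.K s v - (P.rhs s w - P.K s w) =
        (P.rhs s v - P.rhs s w) - P.K s (v - w) := by rw [map_sub]; abel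
    rw [e, add_mul]
    exact (norm_sub_le _ _).trans (add_le_add (h.norm_rhs_sub_le hs' v w)
      ((P.K s).le_of_opNorm_le (h.K_bound s) _))
  int := by
    rw [integrableOn_Ioc_iff_integrableOn_Ioo (by simp)]
    exact MemLp.integrable (by norm_num) (h.memL2Time_velocity continuousOn_const)

/-- The evolution problem in integrated form, with velocity `du`. -/
structure IsSolution (P : EvolutionProblem V) (T : ℝ) (u du : ℝ → V) : Prop where
  cont : ContinuousOn u (Icc 0 T)
  mem : MemL2Time T du
  integral_eq : ∀ t ∈ Icc 0 T, u t = P.u₀ + ∫ s in 0..t, du s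
  eqn : ∀ᵐ s ∂(volume.restrict (Ioo 0 T)), P.A s (du s) + P.K s (u s) = P.rhs s (u s)

/-- The evolution problem is well posed: it is the Carathéodory equation `u' = velocity(t, u)`. -/
theorem Regular.exists_unique_solution (hT : 0 < T) (h : P.Regular T α M) :
    ∃ u du : ℝ → V, P.IsSolution T u du ∧ ∀ u₂ du₂ : ℝ → V, P.IsSolution T u₂ du₂ →
      (∀ t ∈ Icc 0 T, u₂ t = u t) ∧ ∀ᵐ s ∂(volume.restrict (Ioo 0 T)), du₂ s = du s := by
  have hL : 0 ≤ α⁻¹ * (M + M * M + M) := by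
    have := h.α_pos; have := h.M_nonneg; positivity
  obtain ⟨u, hu, hueq, huniq⟩ := h.isCaratheodory.exists_unique hT.le hL P.u₀
  refine ⟨u, fun s => P.velocity s (u s), ⟨hu.continuousOn, h.memL2Time_velocity hu.continuousOn,
    hueq, .of_forall fun s => (h.eq_velocity_iff s _ _).2 rfl⟩, fun u₂ du₂ h₂ => ?_⟩
  have hv : ∀ᵐ s ∂(volume.restrict (Ioo 0 T)), du₂ s = P.velocity s (u₂ s) := by
    filter_upwards [h₂.eqn] with s hs using (h.eq_velocity_iff s _ _).1 hs
  have heq : ∀ t ∈ Icc 0 T, u₂ t = u t := by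
    refine huniq u₂ h₂.cont fun t ht => ?_
    rw [h₂.integral_eq t ht]
    congr 1
    rw [intervalIntegral.integral_of_le ht.1, intervalIntegral.integral_of_le ht.1]
    refine integral_congr_ae ?_
    rw [Measure.restrict_congr_set Ioo_ae_eq_Ioc] at hv
    exact ae_restrict_of_ae_restrict_of_subset (Ioc_subset_Ioc_right ht.2) hv
  refine ⟨heq, ?_⟩
  filter_upwards [hv, ae_restrict_mem measurableSet_Ioo] with s hs hsm
  rw [hs, heq s (Ioo_subset_Icc_self hsm)]

end EvolutionProblem

end Evolution

end PseudoParabolic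

/-! ### Consistency of the semi-implicit scheme -/

namespace PseudoParabolic

open scoped ENNReal NNReal

section NodeValues

theorem memL2Time_sub_rotheStep {X : Type*} [NormedAddCommGroup X] {T : ℝ} (hT : 0 < T) {n : ℕ}
    (hn : 1 ≤ n) {z : ℝ → X} (hz : MemL2Time T z) (W : ℕ → X) :
    MemL2Time T fun s => rotheStep T n W s - z s := by
  refine MemLp.sub (MemLp.of_bound (stronglyMeasurable_rotheStep T n W).aestronglyMeasurable
    (∑ i ∈ Finset.Icc 1 n, ‖W i‖) ?_) hz
  filter_upwards [ae_restrict_mem measurableSet_Ioo] with s hs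
  exact Finset.single_le_sum (f := fun i => ‖W i‖) (fun _ _ => norm_nonneg _)
    (stepIndex_mem hT hn (Ioo_subset_Ioc_self hs))

/-- Values at the right or left end of the cells, multiplied by a square integrable function. -/
theorem l2Null_node_sub {X : Type*} [NormedAddCommGroup X] {T : ℝ} (hT : 0 < T) {x : ℝ → X}
    (hx : ContinuousOn x (Icc 0 T)) {w : ℝ → ℝ} (hw : MemL2Time T w) :
    L2Null T (fun n s => |w s| * ‖rotheStep T n (fun i => x (i * (T / n))) s - x s‖) ∧
    L2Null T (fun n s => |w s| * ‖rotheStep T n (fun i => x ((i - 1 : ℕ) * (T / n))) s - x s‖) := by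
  constructor
  all_goals
    refine L2Null.of_uniform_mul hw fun ε hε => ?_
    filter_upwards [eventually_norm_sub_node_le hT hx hε, eventually_ge_atTop 1] with n hn hn1 s hs
    obtain ⟨hi, hin⟩ := Finset.mem_Icc.1 (stepIndex_mem hT hn1 (Ioo_subset_Ioc_self hs))
    have hsc := mem_cell_stepIndex hT hn1 (Ioo_subset_Ioc_self hs)
    rw [norm_mul, norm_norm, Real.norm_eq_abs, abs_abs, mul_comm, norm_sub_rev]
    gcongr
  · exact (hn _ hi hin s hsc).1
  · exact (hn _ hi hin s hsc).2

end NodeValues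

section Evolution

variable {V : Type*} [NormedAddCommGroup V] [InnerProductSpace ℝ V]

namespace EvolutionProblem

variable {P : EvolutionProblem V} {T α M : ℝ}

/-- The semi-implicit Euler scheme with `n` steps for an evolution problem, where the step data
`bd`, `νd` need not be the exact means of `b`, `ν`. -/
structure IsScheme (P : EvolutionProblem V) (T : ℝ) (n : ℕ) (bd : ℕ → V) (νd : ℕ → ℝ)
    (U : ℕ → V) : Prop where
  initial : U 0 = P.u₀
  step : ∀ i, 1 ≤ i → i ≤ n →
    stepMean T n (fun s => P.A s (backwardDiff T n U i)) i + stepMean T n (fun s => P.K s (U i)) i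
      = P.f (U (i - 1)) + bd i + (νd i - P.j (U (i - 1))) • P.q (i * (T / n))

/-- The local consistency error of the scheme: the oscillation of the data and of the solution over
a time cell, together with the error `γ` of the step data. -/
noncomputable def consistency (P : EvolutionProblem V) (T : ℝ) (u du : ℝ → V) (γ : ℝ → ℝ) (n : ℕ)
    (s : ℝ) : ℝ :=
  ‖rotheStep T n (stepMean T n du) s - du s‖ +
    ‖rotheStep T n (fun i => u (i * (T / n))) s - u s‖ +
    ‖rotheStep T n (fun i => u ((i - 1 : ℕ) * (T / n))) s - u s‖ +
    |P.ν s - P.j (u s)| * ‖rotheStep T n (fun i => P.q (i * (T / n))) s - P.q s‖ + γ s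

theorem Regular.memL2Time_ν_sub (h : P.Regular T α M) {u : ℝ → V} (hu : ContinuousOn u (Icc 0 T)) :
    MemL2Time T fun s => P.ν s - P.j (u s) :=
  h.ν_mem.sub (memL2Time_of_continuousOn (h.j_continuous.comp_continuousOn hu))

theorem Regular.memL2Time_consistency (hT : 0 < T) (h : P.Regular T α M) {u du : ℝ → V}
    (hs : P.IsSolution T u du) {γ : ℝ → ℝ} (hγ : MemL2Time T γ) {n : ℕ} (hn : 1 ≤ n) :
    MemL2Time T (P.consistency T u du γ n) := by
  have hu := memL2Time_of_continuousOn hs.cont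
  refine MemLp.add (MemLp.add (MemLp.add (MemLp.add ?_ ?_) ?_) ?_) hγ
  · exact (memL2Time_sub_rotheStep hT hn hs.mem _).norm
  · exact (memL2Time_sub_rotheStep hT hn hu _).norm
  · exact (memL2Time_sub_rotheStep hT hn hu _).norm
  · have hq := memL2Time_of_continuousOn h.q_cont
    have hν := h.memL2Time_ν_sub hs.cont
    refine MemLp.of_le_mul (c := (∑ i ∈ Finset.Icc 1 n, ‖P.q (i * (T / n))‖) + M) hν
      (hν.1.norm.mul (memL2Time_sub_rotheStep hT hn hq _).1.norm) ?_
    filter_upwards [ae_restrict_mem measurableSet_Ioo] with s hs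
    rw [norm_mul, norm_norm, Real.norm_eq_abs, abs_abs, Real.norm_eq_abs, mul_comm]
    gcongr
    refine (norm_sub_le _ _).trans (add_le_add ?_ (h.q_bound s (Ioo_subset_Icc_self hs)))
    exact Finset.single_le_sum (f := fun i : ℕ => ‖P.q (i * (T / n))‖) (fun _ _ => norm_nonneg _)
      (stepIndex_mem hT hn (Ioo_subset_Ioc_self hs))

/-- The increments of the exact solution are the averages of its velocity. -/
theorem IsSolution.node_sub (hT : 0 < T) {u du : ℝ → V} (hs : P.IsSolution T u du) {n i : ℕ}
    (hn : 1 ≤ n) (hi : 1 ≤ i) (hin : i ≤ n) :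
    u (i * (T / n)) = u ((i - 1 : ℕ) * (T / n)) + (T / n) • stepMean T n du i := by
  have hn0 : (0 : ℝ) < n := by exact_mod_cast hn
  have hτ : 0 < T / n := by positivity
  have hint : ∀ t ∈ Icc 0 T, IntervalIntegrable du volume 0 t := by
    intro t ht
    have h1 : IntegrableOn du (Ioo 0 T) := MemLp.integrable (by norm_num) hs.mem
    rw [intervalIntegrable_iff_integrableOn_Ioc_of_le ht.1]
    exact ((integrableOn_Ioc_iff_integrableOn_Ioo (by simp)).2 h1).mono_set
      (Ioc_subset_Ioc_right ht.2)
  have m1 := node_mem hT hn hin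
  have m2 := node_mem hT hn (by omega : i - 1 ≤ n)
  rw [hs.integral_eq _ m1, hs.integral_eq _ m2, stepMean, smul_smul, mul_inv_cancel₀ hτ.ne',
    one_smul, add_assoc]
  congr 1
  have hc : (i : ℝ) - 1 = ((i - 1 : ℕ) : ℝ) := by rw [Nat.cast_sub hi, Nat.cast_one]
  rw [hc]
  exact (intervalIntegral.integral_add_adjacent_intervals (hint _ m2)
    ((hint _ m2).symm.trans (hint _ m1))).symm

theorem node_sub_backwardDiff (hT : 0 < T) {n : ℕ} (hn : 1 ≤ n) (U : ℕ → V) (i : ℕ) :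
    U i = U (i - 1) + (T / n) • backwardDiff T n U i := by
  have hn0 : (0 : ℝ) < n := by exact_mod_cast hn
  have hτ : 0 < T / n := by positivity
  rw [backwardDiff, smul_smul, mul_inv_cancel₀ hτ.ne', one_smul, add_sub_cancel]

theorem integrableOn_cell_apply {B : ℝ → V →L[ℝ] V} (hB : ∀ w, StronglyMeasurable fun t => B t w)
    (hM : ∀ t, ‖B t‖ ≤ M) (n i : ℕ) (w : V) : IntegrableOn (fun s => B s w) (cell T n i) := by
  refine Measure.integrableOn_of_bounded (M := M * ‖w‖) ?_ (hB w).aestronglyMeasurable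
    (.of_forall fun s => (B s).le_of_opNorm_le (hM s) w)
  rw [volume_cell]; exact ENNReal.ofReal_ne_top

theorem norm_stepMean_apply_le (hT : 0 < T) {n : ℕ} (hn : 1 ≤ n) {B : ℝ → V →L[ℝ] V}
    (hM : ∀ t, ‖B t‖ ≤ M) (i : ℕ) (w : V) : ‖stepMean T n (fun s => B s w) i‖ ≤ M * ‖w‖ := by
  refine (norm_stepMean_le hT (w := fun _ => M * ‖w‖) ?_
    (.of_forall fun s => (B s).le_of_opNorm_le (hM s) w)).trans_eq (stepMean_const hT hn _)
  exact integrableOn_const (by rw [volume_cell]; exact ENNReal.ofReal_ne_top)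

variable [CompleteSpace V]

/-- The consistency error tends to zero in `L²(0,T)`. No regularity of the coefficients in time is
involved, since the scheme uses their exact averages. -/
theorem Regular.l2Null_consistency (hT : 0 < T) (h : P.Regular T α M) {u du : ℝ → V}
    (hs : P.IsSolution T u du) {γ : ℕ → ℝ → ℝ} (hγ : ∀ n, MemL2Time T (γ n)) (hγ0 : L2Null T γ) :
    L2Null T fun n => P.consistency T u du (γ n) n := by
  have hu := memL2Time_of_continuousOn hs.cont
  have hq := memL2Time_of_continuousOn h.q_cont
  have hν := h.memL2Time_ν_sub hs.cont
  have h1 := l2Null_node_sub hT hs.cont (memL2Time_const T (1 : ℝ))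
  simp only [abs_one, one_mul] at h1
  have h2 := (l2Null_node_sub hT h.q_cont hν).1
  have hsm : ∀ {X : Type _} [NormedAddCommGroup X] (z : ℝ → X), MemL2Time T z →
      ∀ (W : ℕ → X) (n : ℕ),
      AEStronglyMeasurable (fun s => ‖rotheStep T n W s - z s‖) (volume.restrict (Ioo 0 T)) :=
    fun z hz W n => ((stronglyMeasurable_rotheStep T n W).aestronglyMeasurable.sub hz.1).norm
  have m1 := fun n : ℕ => hsm du hs.mem (stepMean T n du) n
  have m2 := fun n : ℕ => hsm u hu (fun i => u (i * (T / n))) n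
  have m3 := fun n : ℕ => hsm u hu (fun i => u ((i - 1 : ℕ) * (T / n))) n
  have m4 := fun n : ℕ => hν.1.norm.mul (hsm P.q hq (fun i => P.q (i * (T / n))) n)
  exact L2Null.add (L2Null.add (L2Null.add (L2Null.add (l2Null_stepMean_sub hT hs.mem).norm h1.1
    m1 m2) h1.2 (fun n => (m1 n).add (m2 n)) m3) h2
    (fun n => ((m1 n).add (m2 n)).add (m3 n)) m4) hγ0
    (fun n => (((m1 n).add (m2 n)).add (m3 n)).add (m4 n)) fun n => (hγ n).1

/-- Averages over a cell of the leading operators inherit their coercivity. -/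
theorem Regular.stepMean_coercive (hT : 0 < T) (h : P.Regular T α M) {n : ℕ} (hn : 1 ≤ n) (i : ℕ)
    (w : V) : α * ‖w‖ ^ 2 ≤ ⟪stepMean T n (fun s => P.A s w) i, w⟫_ℝ := by
  have hi := integrableOn_cell_apply (T := T) h.A_meas h.A_bound n i w
  have e := stepMean_clm hT (innerSL ℝ w) hi
  simp only [innerSL_apply_apply] at e
  rw [real_inner_comm, ← e, ← stepMean_const (T := T) (i := i) hT hn (α * ‖w‖ ^ 2)]
  have hi' : IntegrableOn (fun s => ⟪w, P.A s w⟫_ℝ) (cell T n i) :=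
    (innerSL ℝ w).integrable_comp hi
  refine (Real.le_norm_self _).trans (norm_stepMean_le hT hi' ?_)
  refine .of_forall fun s => ?_
  rw [Real.norm_of_nonneg (mul_nonneg h.α_pos.le (sq_nonneg _)), real_inner_comm]
  exact h.coercive s w

/-- The residual of the exact solution in the scheme, by comparison with the average over a cell of
the differential equation. -/
theorem Regular.norm_residual_le (hT : 0 < T) (h : P.Regular T α M) {u du : ℝ → V}
    (hs : P.IsSolution T u du) {γ : ℝ → ℝ} (hγ : MemL2Time T γ) {n : ℕ} (hn : 1 ≤ n)
    {bd : ℕ → V} {νd : ℕ → ℝ} {U : ℕ → V} (hU : P.IsScheme T n bd νd U) {i : ℕ} (hi : 1 ≤ i)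
    (hin : i ≤ n) (hb : ‖bd i - stepMean T n P.b i‖ ≤ stepMean T n γ i)
    (hν : |νd i - stepMean T n P.ν i| ≤ stepMean T n γ i) :
    ‖stepMean T n (fun s => P.A s (backwardDiff T n U i - stepMean T n du i)) i
        + stepMean T n (fun s => P.K s (U i - u (i * (T / n)))) i‖ ≤
      (1 + M) ^ 2 * (‖U (i - 1) - u ((i - 1 : ℕ) * (T / n))‖
        + stepMean T n (P.consistency T u du γ n) i) := by
  have hM := h.M_nonneg
  set τ := T / n
  set dm := stepMean T n du i with hdm
  set um := u (i * τ) with hum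
  set q := P.q (i * τ) with hq
  set E := ‖U (i - 1) - u ((i - 1 : ℕ) * τ)‖ with hE
  have iA := fun w => integrableOn_cell_apply (T := T) h.A_meas h.A_bound n i w
  have iK := fun w => integrableOn_cell_apply (T := T) h.K_meas h.K_bound n i w
  have ib : IntegrableOn P.b (cell T n i) := h.b_mem.integrableOn_cell hT hn hi hin
  have iν : IntegrableOn P.ν (cell T n i) := h.ν_mem.integrableOn_cell hT hn hi hin
  have hv : volume (cell T n i) ≠ ⊤ := by rw [volume_cell]; exact ENNReal.ofReal_ne_top
  have iνq : IntegrableOn (fun s => P.ν s • q) (cell T n i) := iν.smul_const q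
  have iγ : IntegrableOn γ (cell T n i) := hγ.integrableOn_cell hT hn hi hin
  have iε : IntegrableOn (P.consistency T u du γ n) (cell T n i) :=
    (h.memL2Time_consistency hT hs hγ hn).integrableOn_cell hT hn hi hin
  -- the part of the residual that does not come from the error of the step data
  set c := P.f (U (i - 1)) - P.j (U (i - 1)) • q with hc
  have e1 : stepMean T n (fun s => (c + (P.b s + P.ν s • q)) - (P.A s dm + P.K s um)) i =
      (c + (stepMean T n P.b i + stepMean T n P.ν i • q)) -
        (stepMean T n (fun s => P.A s dm) i + stepMean T n (fun s => P.K s um) i) := by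
    have eν : stepMean T n (fun s => P.ν s • q) i = stepMean T n P.ν i • q :=
      stepMean_clm hT ((1 : ℝ →L[ℝ] ℝ).smulRight q) iν
    have ibν : IntegrableOn (fun s => P.b s + P.ν s • q) (cell T n i) := ib.add iνq
    have icb : IntegrableOn (fun s => c + (P.b s + P.ν s • q)) (cell T n i) :=
      (integrableOn_const hv).add ibν
    have iAK : IntegrableOn (fun s => P.A s dm + P.K s um) (cell T n i) := (iA dm).add (iK um)
    rw [stepMean_sub hT icb iAK, stepMean_add hT (integrableOn_const hv) ibν, stepMean_add hT ib iνq,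
      stepMean_add hT (iA dm) (iK um), stepMean_const hT hn, eν]
  have e2 : stepMean T n (fun s => P.A s (backwardDiff T n U i - dm)) i
        + stepMean T n (fun s => P.K s (U i - um)) i =
      stepMean T n (fun s => (c + (P.b s + P.ν s • q)) - (P.A s dm + P.K s um)) i
        + ((bd i - stepMean T n P.b i) + (νd i - stepMean T n P.ν i) • q) := by
    simp only [map_sub]
    rw [e1, stepMean_sub hT (iA _) (iA _), stepMean_sub hT (iK _) (iK _), sub_add_sub_comm,
      hU.step i hi hin, hc]
    module
  have iEε : IntegrableOn (fun s => E + P.consistency T u du γ n s) (cell T n i) :=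
    (integrableOn_const hv).add iε
  have iEγ : IntegrableOn (fun s => (E + P.consistency T u du γ n s) - γ s) (cell T n i) :=
    iEε.sub iγ
  have b1 : ‖stepMean T n (fun s => (c + (P.b s + P.ν s • q)) - (P.A s dm + P.K s um)) i‖ ≤
      stepMean T n (fun s => (1 + M) ^ 2 • ((E + P.consistency T u du γ n s) - γ s)) i := by
    refine norm_stepMean_le hT (iEγ.const_mul _) ?_
    filter_upwards [ae_cell_of_ae hT hn hi hin hs.eqn, ae_restrict_mem measurableSet_cell]
      with s hs1 hs2
    have hsT : s ∈ Icc 0 T := Ioc_subset_Icc_self (cell_subset hT hn hi hin hs2)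
    have hsi := (mem_cell_iff hT hn hi).1 hs2
    -- the differential equation at time `s` is subtracted
    have e3 : (c + (P.b s + P.ν s • q)) - (P.A s dm + P.K s um) =
        (P.f (U (i - 1)) - P.f (u s)) + (P.j (u s) - P.j (U (i - 1))) • q
          + (P.ν s - P.j (u s)) • (q - P.q s) + P.A s (du s - dm) + P.K s (u s - um) := by
      have : P.A s (du s) = P.rhs s (u s) - P.K s (u s) := eq_sub_of_add_eq hs1
      rw [map_sub, map_sub, this, rhs, hc]
      module
    have hEs : ‖U (i - 1) - u s‖ ≤ E + ‖u ((i - 1 : ℕ) * τ) - u s‖ :=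
      norm_sub_le_norm_sub_add_norm_sub _ _ _
    have n1 := h.f_lip (U (i - 1)) (u s)
    have n2 : ‖(P.j (u s) - P.j (U (i - 1))) • q‖ ≤ (M * ‖U (i - 1) - u s‖) * M := by
      rw [norm_smul, Real.norm_eq_abs, abs_sub_comm]
      exact mul_le_mul (h.j_lip _ _) (h.q_bound _ (node_mem hT hn hin)) (norm_nonneg _)
        (by positivity)
    have n3 : ‖(P.ν s - P.j (u s)) • (q - P.q s)‖ = |P.ν s - P.j (u s)| * ‖q - P.q s‖ := by
      rw [norm_smul, Real.norm_eq_abs]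
    have n4 : ‖P.A s (du s - dm)‖ ≤ M * ‖dm - du s‖ := by
      rw [norm_sub_rev]; exact (P.A s).le_of_opNorm_le (h.A_bound s) _
    have n5 : ‖P.K s (u s - um)‖ ≤ M * ‖um - u s‖ := by
      rw [norm_sub_rev]; exact (P.K s).le_of_opNorm_le (h.K_bound s) _
    have hcons : E + P.consistency T u du γ n s - γ s = E + ‖dm - du s‖ + ‖um - u s‖ +
        ‖u ((i - 1 : ℕ) * τ) - u s‖ + |P.ν s - P.j (u s)| * ‖q - P.q s‖ := by
      simp only [consistency, rotheStep, hsi]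
      ring
    rw [e3, smul_eq_mul, hcons]
    have p3 : 0 ≤ |P.ν s - P.j (u s)| * ‖q - P.q s‖ := by positivity
    have p1 := norm_nonneg (dm - du s)
    have p2 := norm_nonneg (um - u s)
    have p4 := norm_nonneg (u ((i - 1 : ℕ) * τ) - u s)
    have p5 : 0 ≤ E := norm_nonneg _
    have tri := norm_add_le ((P.f (U (i - 1)) - P.f (u s)) + (P.j (u s) - P.j (U (i - 1))) • q
          + (P.ν s - P.j (u s)) • (q - P.q s) + P.A s (du s - dm)) (P.K s (u s - um))
    have tri2 := norm_add_le ((P.f (U (i - 1)) - P.f (u s)) + (P.j (u s) - P.j (U (i - 1))) • q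
          + (P.ν s - P.j (u s)) • (q - P.q s)) (P.A s (du s - dm))
    have tri3 := norm_add_le ((P.f (U (i - 1)) - P.f (u s)) + (P.j (u s) - P.j (U (i - 1))) • q)
          ((P.ν s - P.j (u s)) • (q - P.q s))
    have tri4 := norm_add_le (P.f (U (i - 1)) - P.f (u s)) ((P.j (u s) - P.j (U (i - 1))) • q)
    have t1 : (M + M * M) * ‖U (i - 1) - u s‖ ≤ (M + M * M) * (E + ‖u ((i - 1 : ℕ) * τ) - u s‖) := by
      gcongr
    nlinarith [mul_nonneg hM p1, mul_nonneg hM p2, mul_nonneg hM p3, mul_nonneg hM p4,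
      mul_nonneg hM p5, mul_nonneg (mul_nonneg hM hM) p1, mul_nonneg (mul_nonneg hM hM) p2,
      mul_nonneg (mul_nonneg hM hM) p3]
  have e4 : stepMean T n (fun s => (1 + M) ^ 2 • ((E + P.consistency T u du γ n s) - γ s)) i =
      (1 + M) ^ 2 * ((E + stepMean T n (P.consistency T u du γ n) i) - stepMean T n γ i) := by
    have : stepMean T n (fun s => (1 + M) ^ 2 • ((E + P.consistency T u du γ n s) - γ s)) i =
        (1 + M) ^ 2 • stepMean T n (fun s => (E + P.consistency T u du γ n s) - γ s) i :=
      stepMean_clm hT ((1 + M) ^ 2 • (1 : ℝ →L[ℝ] ℝ)) iEγ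
    rw [this, stepMean_sub hT iEε iγ, stepMean_add hT (integrableOn_const hv) iε,
      stepMean_const hT hn, smul_eq_mul]
  have b2 : ‖(bd i - stepMean T n P.b i) + (νd i - stepMean T n P.ν i) • q‖ ≤
      stepMean T n γ i + stepMean T n γ i * M := by
    refine (norm_add_le _ _).trans (add_le_add hb ?_)
    rw [norm_smul]
    exact mul_le_mul hν (h.q_bound _ (node_mem hT hn hin)) (norm_nonneg _)
      ((abs_nonneg _).trans hν)
  have hγ0 : 0 ≤ stepMean T n γ i := (abs_nonneg _).trans hν
  rw [e2]
  refine (norm_add_le _ _).trans ((add_le_add (b1.trans_eq e4) b2).trans ?_)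
  nlinarith [mul_nonneg hM hγ0, mul_nonneg (mul_nonneg hM hM) hγ0]

end EvolutionProblem

end Evolution

end PseudoParabolic

/-! ### Stability and convergence of the scheme -/

namespace PseudoParabolic

open scoped ENNReal NNReal

section Evolution

theorem L2Null.tendsto_integral_norm {X : Type*} [NormedAddCommGroup X] {T : ℝ} {e : ℕ → ℝ → X}
    (h : L2Null T e) (he : ∀ᶠ n in atTop, MemL2Time T (e n)) :
    Tendsto (fun n => ∫ s in Ioo 0 T, ‖e n s‖) atTop (𝓝 0) := by
  have h1 : Tendsto (fun n => eLpNorm (e n) 1 (volume.restrict (Ioo 0 T))) atTop (𝓝 0) := by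
    have hl : Tendsto (fun n => eLpNorm (e n) 2 (volume.restrict (Ioo 0 T)) *
        (volume.restrict (Ioo 0 T)) univ ^ (1 / (1 : ℝ≥0∞).toReal - 1 / (2 : ℝ≥0∞).toReal))
        atTop (𝓝 0) := by
      have := ENNReal.Tendsto.mul_const (b := (volume.restrict (Ioo 0 T)) univ ^
        (1 / (1 : ℝ≥0∞).toReal - 1 / (2 : ℝ≥0∞).toReal)) h (Or.inr
        (ENNReal.rpow_ne_top_of_nonneg (by norm_num) (by simp)))
      simpa using this
    refine tendsto_of_tendsto_of_tendsto_of_le_of_le' tendsto_const_nhds hl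
      (.of_forall fun _ => zero_le) (he.mono fun n hn => ?_)
    exact eLpNorm_le_eLpNorm_mul_rpow_measure_univ (by norm_num) hn.1
  refine ((ENNReal.tendsto_toReal (by simp)).comp h1).congr' (he.mono fun n hn => ?_)
  simp only [Function.comp_apply]
  rw [eLpNorm_one_eq_lintegral_enorm, integral_norm_eq_lintegral_enorm hn.1]

theorem stepMean_mono {T : ℝ} {n i : ℕ} (hT : 0 < T) {z w : ℝ → ℝ}
    (hz : IntegrableOn z (cell T n i)) (hw : IntegrableOn w (cell T n i))
    (h : ∀ᵐ s ∂(volume.restrict (cell T n i)), z s ≤ w s) :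
    stepMean T n z i ≤ stepMean T n w i := by
  rw [stepMean_eq hT, stepMean_eq hT, smul_eq_mul, smul_eq_mul]
  exact mul_le_mul_of_nonneg_left (integral_mono_ae hz hw h) (by positivity)

theorem aestronglyMeasurable_rotheStep {X : Type*} [TopologicalSpace X] (T : ℝ) (n : ℕ) (W : ℕ → X)
    (μ : Measure ℝ) : AEStronglyMeasurable (rotheStep T n W) μ :=
  (stronglyMeasurable_rotheStep T n W).aestronglyMeasurable

namespace EvolutionProblem

variable {V : Type*} [NormedAddCommGroup V] [InnerProductSpace ℝ V]
  {P : EvolutionProblem V} {T α M : ℝ}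

theorem Regular.stepMean_le_consistency (hT : 0 < T) (h : P.Regular T α M) {u du : ℝ → V}
    (hs : P.IsSolution T u du) {γ : ℝ → ℝ} (hγ : MemL2Time T γ) {n : ℕ} (hn : 1 ≤ n) {i : ℕ}
    (hi : 1 ≤ i) (hin : i ≤ n) :
    stepMean T n γ i ≤ stepMean T n (P.consistency T u du γ n) i := by
  refine stepMean_mono hT (hγ.integrableOn_cell hT hn hi hin)
    ((h.memL2Time_consistency hT hs hγ hn).integrableOn_cell hT hn hi hin) (.of_forall fun s => ?_)
  exact le_add_of_nonneg_left (by positivity)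

variable [CompleteSpace V]

/-- Stability of one step: coercivity absorbs the part of the residual that contains the new
error, once the step is small. -/
theorem Regular.norm_backwardDiff_sub_le (hT : 0 < T) (h : P.Regular T α M) {u du : ℝ → V}
    (hs : P.IsSolution T u du) {γ : ℝ → ℝ} (hγ : MemL2Time T γ) {n : ℕ} (hn : 1 ≤ n)
    {bd : ℕ → V} {νd : ℕ → ℝ} {U : ℕ → V} (hU : P.IsScheme T n bd νd U) {i : ℕ} (hi : 1 ≤ i)
    (hin : i ≤ n) (hb : ‖bd i - stepMean T n P.b i‖ ≤ stepMean T n γ i)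
    (hν : |νd i - stepMean T n P.ν i| ≤ stepMean T n γ i) (hsmall : M * (T / n) ≤ α / 2) :
    ‖backwardDiff T n U i - stepMean T n du i‖ ≤
      2 * ((1 + M) ^ 2 + M) / α * (‖U (i - 1) - u ((i - 1 : ℕ) * (T / n))‖
        + stepMean T n (P.consistency T u du γ n) i) := by
  have hα := h.α_pos
  have hM := h.M_nonneg
  have hn0 : (0 : ℝ) < n := by exact_mod_cast hn
  have hτ : 0 < T / n := by positivity
  set D := backwardDiff T n U i - stepMean T n du i with hD
  set E := U (i - 1) - u ((i - 1 : ℕ) * (T / n)) with hE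
  set ε := stepMean T n (P.consistency T u du γ n) i with hε
  have hres := h.norm_residual_le hT hs hγ hn hU hi hin hb hν
  have hE' : U i - u (i * (T / n)) = E + (T / n) • D := by
    rw [node_sub_backwardDiff hT hn U i, hs.node_sub hT hn hi hin, hE, hD]
    module
  have hEn : ‖U i - u (i * (T / n))‖ ≤ ‖E‖ + T / n * ‖D‖ := by
    rw [hE']
    refine (norm_add_le _ _).trans_eq ?_
    rw [norm_smul, Real.norm_of_nonneg hτ.le]
  have hε0 : 0 ≤ ‖E‖ + ε := by
    have := (norm_nonneg _).trans hres
    exact nonneg_of_mul_nonneg_right this (by positivity)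
  have hK := norm_stepMean_apply_le (T := T) hT hn h.K_bound i (U i - u (i * (T / n)))
  have hA : α * ‖D‖ ≤ ‖stepMean T n (fun s => P.A s D) i‖ := by
    by_cases hD0 : ‖D‖ = 0
    · rw [hD0, mul_zero]; exact norm_nonneg _
    · have hDp : 0 < ‖D‖ := lt_of_le_of_ne (norm_nonneg _) (Ne.symm hD0)
      have := (h.stepMean_coercive hT hn i D).trans (real_inner_le_norm _ _)
      rw [pow_two, ← mul_assoc] at this
      exact le_of_mul_le_mul_right this hDp
  have htri : ‖stepMean T n (fun s => P.A s D) i‖ ≤ (1 + M) ^ 2 * (‖E‖ + ε) +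
      M * (‖E‖ + T / n * ‖D‖) := by
    refine (norm_le_add_norm_add _ _).trans (add_le_add hres (hK.trans ?_))
    gcongr
  rw [div_mul_eq_mul_div, le_div_iff₀ hα]
  have h1 : M * (T / n) * ‖D‖ ≤ α / 2 * ‖D‖ := by gcongr
  have h2 : M * ‖E‖ ≤ M * (‖E‖ + ε) := by
    have := (abs_nonneg _).trans (hν.trans (h.stepMean_le_consistency hT hs hγ hn hi hin))
    gcongr
    linarith
  nlinarith

/-- The error at the nodes is bounded by the consistency error in `L¹`, by a discrete Gronwall
argument. -/
theorem Regular.norm_scheme_sub_le (hT : 0 < T) (h : P.Regular T α M) {u du : ℝ → V}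
    (hs : P.IsSolution T u du) {γ : ℝ → ℝ} (hγ : MemL2Time T γ) {n : ℕ} (hn : 1 ≤ n)
    {bd : ℕ → V} {νd : ℕ → ℝ} {U : ℕ → V} (hU : P.IsScheme T n bd νd U)
    (hb : ∀ i, 1 ≤ i → i ≤ n → ‖bd i - stepMean T n P.b i‖ ≤ stepMean T n γ i)
    (hν : ∀ i, 1 ≤ i → i ≤ n → |νd i - stepMean T n P.ν i| ≤ stepMean T n γ i)
    (hsmall : M * (T / n) ≤ α / 2) {C : ℝ} (hC : C = 2 * ((1 + M) ^ 2 + M) / α) :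
    ∀ i ≤ n, ‖U i - u (i * (T / n))‖ ≤
      Real.exp (C * T) * C * ∫ s in Ioo 0 T, ‖P.consistency T u du γ n s‖ := by
  have hα := h.α_pos
  have hM := h.M_nonneg
  have hC0 : 0 ≤ C := by rw [hC]; positivity
  have hn0 : (0 : ℝ) < n := by exact_mod_cast hn
  have hτ : 0 < T / n := by positivity
  set ε := P.consistency T u du γ n with hε
  have hεm : MemL2Time T ε := h.memL2Time_consistency hT hs hγ hn
  have hεi : IntervalIntegrable ε volume 0 T := by
    rw [intervalIntegrable_iff_integrableOn_Ioo_of_le hT.le]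
    exact MemLp.integrable (by norm_num) hεm
  have hεit : ∀ a ∈ Icc 0 T, ∀ b ∈ Icc 0 T, IntervalIntegrable ε volume a b := fun a ha b hb =>
    hεi.mono_set (uIcc_subset_uIcc (by rwa [uIcc_of_le hT.le]) (by rwa [uIcc_of_le hT.le]))
  have h0T : (0 : ℝ) ∈ Icc 0 T := ⟨le_rfl, hT.le⟩
  -- `e_i ≤ (1 + τC) e_{i-1} + τCε_i` for the errors `e_i`, summed up by induction
  have key : ∀ i ≤ n, 0 ≤ (∫ s in (0 : ℝ)..(i * (T / n)), ε s) ∧ ‖U i - u (i * (T / n))‖ ≤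
      (1 + T / n * C) ^ i * C * ∫ s in (0 : ℝ)..(i * (T / n)), ε s := by
    intro i
    induction i with
    | zero =>
      intro _
      have : u 0 = P.u₀ := by rw [hs.integral_eq 0 h0T]; simp
      simp [hU.initial, this]
    | succ i ih =>
      intro hin
      obtain ⟨ih0, ih⟩ := ih (by omega)
      have hstep := h.norm_backwardDiff_sub_le hT hs hγ hn hU (i := i + 1) (by omega) hin
        (hb _ (by omega) hin) (hν _ (by omega) hin) hsmall
      have hε0 : 0 ≤ stepMean T n ε (i + 1) := (abs_nonneg _).trans ((hν _ (by omega) hin).trans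
        (h.stepMean_le_consistency hT hs hγ hn (by omega) hin))
      rw [← hC, Nat.add_sub_cancel] at hstep
      have hI : (∫ s in (0 : ℝ)..((i + 1 : ℕ) * (T / n)), ε s) =
          (∫ s in (0 : ℝ)..(i * (T / n)), ε s) + T / n * stepMean T n ε (i + 1) := by
        have m1 := node_mem hT hn hin
        have m2 := node_mem hT hn (by omega : i ≤ n)
        rw [← intervalIntegral.integral_add_adjacent_intervals (hεit _ h0T _ m2)
          (hεit _ m2 _ m1), stepMean, smul_eq_mul, mul_inv_cancel_left₀ hτ.ne']
        push_cast
        rw [add_sub_cancel_right]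
      have hEn : ‖U (i + 1) - u ((i + 1 : ℕ) * (T / n))‖ ≤ ‖U i - u (i * (T / n))‖ +
          T / n * ‖backwardDiff T n U (i + 1) - stepMean T n du (i + 1)‖ := by
        have e : U (i + 1) - u ((i + 1 : ℕ) * (T / n)) = (U i - u (i * (T / n))) +
            (T / n) • (backwardDiff T n U (i + 1) - stepMean T n du (i + 1)) := by
          rw [node_sub_backwardDiff hT hn U (i + 1),
            hs.node_sub hT hn (by omega : 1 ≤ i + 1) hin, Nat.add_sub_cancel]
          module
        rw [e]
        refine (norm_add_le _ _).trans_eq ?_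
        rw [norm_smul, Real.norm_of_nonneg hτ.le]
      refine ⟨by rw [hI]; positivity, ?_⟩
      have h1 : (1 : ℝ) ≤ (1 + T / n * C) ^ (i + 1) := one_le_pow₀ (by nlinarith)
      have hx := norm_nonneg (U i - u (i * (T / n)))
      calc _ ≤ ‖U i - u (i * (T / n))‖ + T / n * (C * (‖U i - u (i * (T / n))‖ +
            stepMean T n ε (i + 1))) := by
            refine hEn.trans ?_
            gcongr
        _ = (1 + T / n * C) * ‖U i - u (i * (T / n))‖ +
            1 * (C * (T / n * stepMean T n ε (i + 1))) := by ring
        _ ≤ (1 + T / n * C) * ((1 + T / n * C) ^ i * C * ∫ s in (0 : ℝ)..(i * (T / n)), ε s) +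
            (1 + T / n * C) ^ (i + 1) * (C * (T / n * stepMean T n ε (i + 1))) := by gcongr
        _ = _ := by rw [hI]; ring
  intro i hin
  refine (key i hin).2.trans ?_
  gcongr
  · exact (key i hin).1
  · calc (1 + T / n * C) ^ i ≤ (1 + T / n * C) ^ n := by
          gcongr
          nlinarith
      _ ≤ Real.exp (T / n * C) ^ n := by
          gcongr
          rw [add_comm]; exact Real.add_one_le_exp _
      _ = Real.exp (C * T) := by
          rw [← Real.exp_nat_mul]; congr 1; field_simp
  · refine (le_abs_self _).trans ?_
    rw [← Real.norm_eq_abs, intervalIntegral.integral_of_le (node_mem hT hn hin).1]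
    refine (norm_integral_le_integral_norm _).trans ?_
    rw [← integral_Ioc_eq_integral_Ioo]
    refine setIntegral_mono_set ?_ (.of_forall fun _ => norm_nonneg _)
      (Ioc_subset_Ioc_right (node_mem hT hn hin).2).eventuallyLE
    exact ((intervalIntegrable_iff_integrableOn_Ioc_of_le hT.le).1 hεi).norm

/-- Convergence of the semi-implicit Euler scheme: uniformly at the nodes, and in `L²` for the
difference quotients and for the factors of the source. -/
theorem Regular.scheme_convergence (hT : 0 < T) (h : P.Regular T α M) {u du : ℝ → V}
    (hs : P.IsSolution T u du) {γ : ℕ → ℝ → ℝ} (hγ : ∀ n, MemL2Time T (γ n)) (hγ0 : L2Null T γ)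
    {bd : ℕ → ℕ → V} {νd : ℕ → ℕ → ℝ} {U : ℕ → ℕ → V}
    (hU : ∀ n, 1 ≤ n → P.IsScheme T n (bd n) (νd n) (U n))
    (hb : ∀ n, 1 ≤ n → ∀ i, 1 ≤ i → i ≤ n →
      ‖bd n i - stepMean T n P.b i‖ ≤ stepMean T n (γ n) i)
    (hν : ∀ n, 1 ≤ n → ∀ i, 1 ≤ i → i ≤ n →
      |νd n i - stepMean T n P.ν i| ≤ stepMean T n (γ n) i) :
    (∀ ε : ℝ, 0 < ε → ∀ᶠ n : ℕ in atTop, ∀ i ≤ n, ‖U n i - u (i * (T / n))‖ ≤ ε) ∧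
    L2Null T (fun n s => rotheStep T n (backwardDiff T n (U n)) s - du s) ∧
    L2Null T (fun n s => rotheStep T n (fun i => νd n i - P.j (U n (i - 1))) s
      - (P.ν s - P.j (u s))) := by
  have hα := h.α_pos
  have hM := h.M_nonneg
  obtain ⟨C, hC⟩ : ∃ C : ℝ, C = 2 * ((1 + M) ^ 2 + M) / α := ⟨_, rfl⟩
  have hC0 : 0 ≤ C := by rw [hC]; positivity
  have hnull := h.l2Null_consistency hT hs hγ hγ0
  have hsmall : ∀ᶠ n : ℕ in atTop, M * (T / n) ≤ α / 2 := by
    have hl : Tendsto (fun n : ℕ => M * (T / n)) atTop (𝓝 (M * 0)) :=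
      (tendsto_const_div_atTop_nhds_zero_nat T).const_mul M
    rw [mul_zero] at hl
    exact hl.eventually (Iic_mem_nhds (by positivity))
  have hunif : ∀ ε : ℝ, 0 < ε → ∀ᶠ n : ℕ in atTop, ∀ i ≤ n, ‖U n i - u (i * (T / n))‖ ≤ ε := by
    intro ε hε
    have hl := (hnull.tendsto_integral_norm ((eventually_ge_atTop 1).mono fun n hn =>
      h.memL2Time_consistency hT hs (hγ n) hn)).const_mul (Real.exp (C * T) * C)
    rw [mul_zero] at hl
    filter_upwards [hl.eventually (Iic_mem_nhds hε), hsmall, eventually_ge_atTop 1]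
      with n hn hn2 hn1 i hin
    exact (h.norm_scheme_sub_le hT hs (hγ n) hn1 (hU n hn1) (hb n hn1) (hν n hn1) hn2 hC i
      hin).trans hn
  have hUnull : L2Null T fun n s =>
      rotheStep T n (fun i => U n (i - 1) - u ((i - 1 : ℕ) * (T / n))) s := by
    refine L2Null.of_uniform fun ε hε => ?_
    filter_upwards [hunif ε hε, eventually_ge_atTop 1] with n hn hn1 s hs
    have := Finset.mem_Icc.1 (stepIndex_mem hT hn1 (Ioo_subset_Ioc_self hs))
    exact hn _ (by omega)
  -- the mean of the consistency error; the step `n = 0` is irrelevant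
  have hεnull : L2Null T fun n => rotheStep T n (stepMean T n (P.consistency T u du (γ n) n)) := by
    refine tendsto_of_tendsto_of_tendsto_of_le_of_le' tendsto_const_nhds hnull
      (.of_forall fun _ => zero_le) ((eventually_ge_atTop 1).mono fun n hn =>
        eLpNorm_rotheStep_stepMean_le hT hn (h.memL2Time_consistency hT hs (hγ n) hn).1)
  have hr := fun (W : ℕ → ℝ) (n : ℕ) =>
    (aestronglyMeasurable_rotheStep T n W (volume.restrict (Ioo 0 T))).norm
  have hrV := fun (W : ℕ → V) (n : ℕ) =>
    (aestronglyMeasurable_rotheStep T n W (volume.restrict (Ioo 0 T))).norm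
  have m1 := fun n : ℕ => ((aestronglyMeasurable_rotheStep T n (stepMean T n du) _).sub
    hs.mem.1).norm
  have m2 := fun n : ℕ => ((aestronglyMeasurable_rotheStep T n (stepMean T n P.ν) _).sub
    h.ν_mem.1).norm
  have m3 := fun n : ℕ => ((aestronglyMeasurable_rotheStep T n
    (fun i => u ((i - 1 : ℕ) * (T / n))) _).sub (memL2Time_of_continuousOn hs.cont).1).norm
  refine ⟨hunif, ?_, ?_⟩
  · have hsum := L2Null.add ((L2Null.add hUnull.norm hεnull.norm (fun n => hrV _ n)
        fun n => hr _ n).const_mul C) (l2Null_stepMean_sub hT hs.mem).norm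
        (fun n => ((hrV _ n).add (hr _ n)).const_mul C) m1
    refine hsum.mono ?_
    filter_upwards [hsmall, eventually_ge_atTop 1] with n hn hn1
    filter_upwards [ae_restrict_mem measurableSet_Ioo] with s hs'
    obtain ⟨hi, hin⟩ := Finset.mem_Icc.1 (stepIndex_mem hT hn1 (Ioo_subset_Ioc_self hs'))
    have := h.norm_backwardDiff_sub_le hT hs (hγ n) hn1 (hU n hn1) hi hin (hb n hn1 _ hi hin)
      (hν n hn1 _ hi hin) hn
    rw [← hC] at this
    refine (norm_sub_le_norm_sub_add_norm_sub _ (rotheStep T n (stepMean T n du) s) _).trans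
      ((add_le_add (this.trans ?_) le_rfl).trans (Real.le_norm_self _))
    gcongr
    · exact le_rfl
    · exact Real.le_norm_self _
  · have hsum := L2Null.add (L2Null.add hεnull.norm (l2Null_stepMean_sub hT h.ν_mem).norm
        (fun n => hr _ n) m2)
      ((L2Null.add hUnull.norm (l2Null_node_sub hT hs.cont (memL2Time_const T (1 : ℝ))).2
        (fun n => hrV _ n) fun n => (m3 n).const_mul _).const_mul M)
      (fun n => (hr _ n).add (m2 n))
      fun n => ((hrV _ n).add ((m3 n).const_mul _)).const_mul M
    refine hsum.mono ?_
    filter_upwards [eventually_ge_atTop 1] with n hn1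
    filter_upwards [ae_restrict_mem measurableSet_Ioo] with s hs'
    obtain ⟨hi, hin⟩ := Finset.mem_Icc.1 (stepIndex_mem hT hn1 (Ioo_subset_Ioc_self hs'))
    simp only [rotheStep]
    set i := stepIndex T n s with hi'
    refine le_trans ?_ (Real.le_norm_self _)
    have e : νd n i - P.j (U n (i - 1)) - (P.ν s - P.j (u s)) =
        ((νd n i - stepMean T n P.ν i) + (stepMean T n P.ν i - P.ν s)) -
          (P.j (U n (i - 1)) - P.j (u s)) := by ring
    rw [e]
    refine (norm_sub_le _ _).trans (add_le_add ((norm_add_le _ _).trans (add_le_add ?_ le_rfl)) ?_)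
    · exact (hν n hn1 _ hi hin).trans ((h.stepMean_le_consistency hT hs (hγ n) hn1 hi hin).trans
        (Real.le_norm_self _))
    · refine (h.j_lip _ _).trans ?_
      rw [abs_one, one_mul]
      gcongr
      exact norm_sub_le_norm_sub_add_norm_sub _ _ _

end EvolutionProblem

end Evolution

end PseudoParabolic

/-! ### Rothe functions and solvability of the scheme -/

namespace PseudoParabolic

open scoped ENNReal NNReal

section RotheFunctions

variable {V : Type*} [NormedAddCommGroup V]

/-- Strong convergence in `L²((0,T); V)` implies weak convergence. -/
theorem L2Null.tendsto_integral_inner [InnerProductSpace ℝ V] {T : ℝ} {x : ℕ → ℝ → V} {y φ : ℝ → V}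
    (h : L2Null T fun n s => x n s - y s) (hx : ∀ᶠ n in atTop, MemL2Time T fun s => x n s - y s)
    (hy : MemL2Time T y) (hφ : MemL2Time T φ) :
    Tendsto (fun n => ∫ s in Ioo 0 T, ⟪x n s, φ s⟫_ℝ) atTop (𝓝 (∫ s in Ioo 0 T, ⟪y s, φ s⟫_ℝ)) := by
  have hi : ∀ {z : ℝ → V}, MemL2Time T z →
      Integrable (fun s => ⟪z s, φ s⟫_ℝ) (volume.restrict (Ioo 0 T)) := by
    intro z hz
    refine Integrable.mono' (hz.norm.integrable_mul hφ.norm) (hz.1.inner hφ.1) (.of_forall fun s => ?_)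
    exact norm_inner_le_norm _ _
  refine tendsto_integral_of_L1' _ (hi hy).1 ?_ ?_
  · filter_upwards [hx] with n hn
    have := hi (hn.add hy)
    simpa using this
  · have hl : Tendsto (fun n => 1 * eLpNorm (fun s => x n s - y s) 2 (volume.restrict (Ioo 0 T)) *
        eLpNorm φ 2 (volume.restrict (Ioo 0 T))) atTop (𝓝 0) := by
      have := ENNReal.Tendsto.mul_const (b := eLpNorm φ 2 (volume.restrict (Ioo 0 T))) h
        (Or.inr hφ.2.ne)
      simpa using this
    refine tendsto_of_tendsto_of_tendsto_of_le_of_le' tendsto_const_nhds hl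
      (.of_forall fun _ => zero_le) ?_
    filter_upwards [hx] with n hn
    have e : ((fun s => ⟪x n s, φ s⟫_ℝ) - fun s => ⟪y s, φ s⟫_ℝ) =
        fun s => ⟪x n s - y s, φ s⟫_ℝ := by
      funext s; simp [inner_sub_left]
    rw [e]
    have := eLpNorm_le_eLpNorm_mul_eLpNorm_of_nnnorm (p := 2) (q := 2) (r := 1)
      (μ := volume.restrict (Ioo 0 T)) hn.1 hφ.1 (fun a b => ⟪a, b⟫_ℝ) 1
      (.of_forall fun s => by simpa using nnnorm_inner_le_nnnorm (𝕜 := ℝ) (x n s - y s) (φ s))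
    simpa using this

/-- Multiplication by the node values of a continuous function preserves convergence in `L²`. -/
theorem L2Null.mul_node {T : ℝ} (hT : 0 < T) {X : ℕ → ℕ → ℝ} {x r : ℝ → ℝ}
    (hr : ContinuousOn r (Icc 0 T)) (hx : MemL2Time T x)
    (h : L2Null T fun n s => rotheStep T n (X n) s - x s) :
    L2Null T fun n s => rotheStep T n (fun i => r (i * (T / n)) * X n i) s - r s * x s := by
  obtain ⟨C, hC⟩ := isCompact_Icc.exists_bound_of_continuousOn hr
  have hr2 := memL2Time_of_continuousOn hr
  have hsum := (h.norm.const_mul C).add (l2Null_node_sub hT hr hx).1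
    (fun n => (((aestronglyMeasurable_rotheStep T n (X n) _).sub hx.1).norm).const_mul C)
    (fun n => hx.1.norm.mul ((aestronglyMeasurable_rotheStep T n
      (fun i => r (i * (T / n))) _).sub hr2.1).norm)
  refine hsum.mono ?_
  filter_upwards [eventually_ge_atTop 1] with n hn
  filter_upwards [ae_restrict_mem measurableSet_Ioo] with s hs
  obtain ⟨hi, hin⟩ := Finset.mem_Icc.1 (stepIndex_mem hT hn (Ioo_subset_Ioc_self hs))
  refine le_trans ?_ (Real.le_norm_self _)
  simp only [rotheStep]
  set i := stepIndex T n s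
  have e : r (i * (T / n)) * X n i - r s * x s =
      r (i * (T / n)) * (X n i - x s) + x s * (r (i * (T / n)) - r s) := by ring
  rw [e]
  refine (norm_add_le _ _).trans ?_
  rw [norm_mul, norm_mul, Real.norm_eq_abs (x s)]
  gcongr
  exact hC _ (node_mem hT hn hin)

/-- Convergence at the nodes gives uniform convergence of both Rothe functions. -/
theorem eventually_norm_rothe_sub_le [NormedSpace ℝ V] {T : ℝ} (hT : 0 < T) {U : ℕ → ℕ → V}
    {u : ℝ → V} (hu : ContinuousOn u (Icc 0 T))
    (h : ∀ ε : ℝ, 0 < ε → ∀ᶠ n : ℕ in atTop, ∀ i ≤ n, ‖U n i - u (i * (T / n))‖ ≤ ε)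
    {ε : ℝ} (hε : 0 < ε) :
    ∀ᶠ n : ℕ in atTop, ∀ t ∈ Icc 0 T,
      ‖rotheStep T n (U n) t - u t‖ ≤ ε ∧ ‖rotheLinear T n (U n) t - u t‖ ≤ ε := by
  filter_upwards [h (ε / 2) (by positivity), eventually_norm_sub_node_le (ε := ε / 2) hT hu
    (by positivity), eventually_ge_atTop 1] with n hn hn2 hn1 t ht
  have hn0 : (0 : ℝ) < n := by exact_mod_cast hn1
  have hτ : 0 < T / n := by positivity
  obtain h0 | h0 := ht.1.eq_or_lt
  · have := hn 0 (Nat.zero_le _)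
    rw [Nat.cast_zero, zero_mul] at this
    have e : stepIndex T n 0 = 0 := by simp [stepIndex]
    subst h0
    simp only [rotheStep, rotheLinear, e, le_refl, if_true]
    constructor <;> linarith
  · have htc := mem_cell_stepIndex hT hn1 ⟨h0, ht.2⟩
    obtain ⟨hi, hin⟩ := Finset.mem_Icc.1 (stepIndex_mem hT hn1 ⟨h0, ht.2⟩)
    simp only [rotheStep, rotheLinear, not_le.2 h0, if_false]
    set i := stepIndex T n t
    obtain ⟨b1, b2⟩ := hn2 i hi hin t htc
    have c1 : ‖U n i - u t‖ ≤ ε := by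
      have := norm_sub_le_norm_sub_add_norm_sub (U n i) (u (i * (T / n))) (u t)
      rw [norm_sub_rev (u (i * (T / n)))] at this
      linarith [hn i hin]
    have c2 : ‖U n (i - 1) - u t‖ ≤ ε := by
      have := norm_sub_le_norm_sub_add_norm_sub (U n (i - 1)) (u ((i - 1 : ℕ) * (T / n))) (u t)
      rw [norm_sub_rev (u ((i - 1 : ℕ) * (T / n)))] at this
      linarith [hn (i - 1) (by omega)]
    refine ⟨c1, ?_⟩
    -- the interpolant is a convex combination of the values at the two ends of the cell
    obtain ⟨θ, hθ⟩ : ∃ θ : ℝ, θ = (t - ((i : ℝ) - 1) * (T / n)) / (T / n) := ⟨_, rfl⟩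
    have hθ0 : 0 ≤ θ := by rw [hθ]; exact div_nonneg (by linarith [htc.1]) hτ.le
    have hθ1 : θ ≤ 1 := by rw [hθ, div_le_one hτ]; linarith [htc.2]
    have e : U n (i - 1) + (t - ((i : ℝ) - 1) * (T / n)) • backwardDiff T n (U n) i - u t =
        (1 - θ) • (U n (i - 1) - u t) + θ • (U n i - u t) := by
      rw [backwardDiff, smul_smul, ← div_eq_mul_inv, ← hθ]
      module
    rw [e]
    refine (norm_add_le _ _).trans ?_
    rw [norm_smul, norm_smul, Real.norm_of_nonneg hθ0, Real.norm_of_nonneg (sub_nonneg.2 hθ1)]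
    nlinarith

end RotheFunctions

namespace EvolutionProblem

variable {V : Type*} [NormedAddCommGroup V] [InnerProductSpace ℝ V] [CompleteSpace V]
  {P : EvolutionProblem V} {T α M : ℝ}

/-- The average over a time cell of a strongly measurable family of operators is an operator. -/
theorem exists_stepMean_operator (hT : 0 < T) {n : ℕ} (hn : 1 ≤ n) {B : ℝ → V →L[ℝ] V}
    (hB : ∀ w, StronglyMeasurable fun t => B t w) (hM : ∀ t, ‖B t‖ ≤ M) (i : ℕ) :
    ∃ L : V →L[ℝ] V, ∀ w, L w = stepMean T n (fun s => B s w) i := by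
  have hI := integrableOn_cell_apply (T := T) hB hM n i
  refine ⟨LinearMap.mkContinuous
    { toFun := fun w => stepMean T n (fun s => B s w) i
      map_add' := fun v w => by simp only [map_add]; exact stepMean_add hT (hI v) (hI w)
      map_smul' := fun c w => by
        simp only [map_smul]
        exact stepMean_clm hT (c • ContinuousLinearMap.id ℝ V) (hI w) } M
    fun w => norm_stepMean_apply_le hT hn hM i w, fun w => rfl⟩

/-- Each step of the scheme is a linear problem with a coercive operator. -/
theorem Regular.exists_unique_scheme (hT : 0 < T) (h : P.Regular T α M)
    (hK : ∀ t v, 0 ≤ ⟪P.K t v, v⟫_ℝ) {n : ℕ} (hn : 1 ≤ n) (bd : ℕ → V) (νd : ℕ → ℝ) :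
    ∃ U : ℕ → V, P.IsScheme T n bd νd U ∧ ∀ U₂ : ℕ → V, P.IsScheme T n bd νd U₂ →
      ∀ i ≤ n, U₂ i = U i := by
  have hn0 : (0 : ℝ) < n := by exact_mod_cast hn
  have hτ : 0 < T / n := by positivity
  choose A hA using exists_stepMean_operator hT hn h.A_meas h.A_bound
  choose K hK' using exists_stepMean_operator hT hn h.K_meas h.K_bound
  set S : ℕ → V →L[ℝ] V := fun i => A i + (T / n) • K i with hS
  have hSc : ∀ i v, α * ‖v‖ ^ 2 ≤ ⟪S i v, v⟫_ℝ := by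
    intro i v
    have h1 := h.stepMean_coercive hT hn i v
    have h2 : 0 ≤ ⟪K i v, v⟫_ℝ := by
      have hi := integrableOn_cell_apply (T := T) h.K_meas h.K_bound n i v
      rw [hK', real_inner_comm, ← innerSL_apply_apply ℝ, ← stepMean_clm hT (innerSL ℝ v) hi,
        stepMean_eq hT]
      refine smul_nonneg (by positivity) (integral_nonneg fun s => ?_)
      rw [innerSL_apply_apply, real_inner_comm]
      exact hK s v
    simp only [hS, add_apply, smul_apply, inner_add_left, real_inner_smul_left]
    rw [hA]
    have := mul_nonneg hτ.le h2
    linarith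
  -- the equation for one step, solved for the difference quotient
  set R : ℕ → V → V := fun i v =>
    P.f v + bd i + (νd i - P.j v) • P.q (i * (T / n)) - K i v with hR
  have hstep : ∀ (U : ℕ → V) (i : ℕ),
      (stepMean T n (fun s => P.A s (backwardDiff T n U i)) i + stepMean T n (fun s => P.K s (U i)) i
        = P.f (U (i - 1)) + bd i + (νd i - P.j (U (i - 1))) • P.q (i * (T / n))) ↔
      backwardDiff T n U i = Ring.inverse (S i) (R i (U (i - 1))) := by
    intro U i
    rw [← hA, ← hK']
    have e : A i (backwardDiff T n U i) + K i (U i) =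
        S i (backwardDiff T n U i) + K i (U (i - 1)) := by
      conv_lhs => rw [node_sub_backwardDiff hT hn U i]
      simp only [hS, add_apply, smul_apply, map_add, map_smul]
      abel
    rw [e, ← eq_sub_iff_add_eq]
    constructor
    · intro e2
      simp only [hR]
      rw [← e2, inverse_apply_of_coercive h.α_pos (hSc i)]
    · intro e2
      rw [e2, apply_inverse_of_coercive h.α_pos (hSc i)]
  let U : ℕ → V := fun i => Nat.rec P.u₀
    (fun k v => v + (T / n) • Ring.inverse (S (k + 1)) (R (k + 1) v)) i
  have hUs : ∀ k, U (k + 1) = U k + (T / n) • Ring.inverse (S (k + 1)) (R (k + 1) (U k)) :=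
    fun _ => rfl
  refine ⟨U, ⟨rfl, fun i hi _ => (hstep U i).2 ?_⟩, fun U₂ hU₂ i => ?_⟩
  · obtain ⟨k, rfl⟩ := Nat.exists_eq_add_of_le' hi
    rw [backwardDiff, Nat.add_sub_cancel, hUs, add_sub_cancel_left, smul_smul,
      inv_mul_cancel₀ hτ.ne', one_smul]
  · induction i with
    | zero => intro _; exact hU₂.initial
    | succ k ih =>
      intro hk
      have e1 := (hstep U₂ (k + 1)).1 (hU₂.step (k + 1) (by omega) hk)
      rw [Nat.add_sub_cancel, ih (by omega)] at e1
      rw [node_sub_backwardDiff hT hn U₂ (k + 1), e1, Nat.add_sub_cancel, ih (by omega), hUs]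

end EvolutionProblem

end PseudoParabolic

/-! ### Weak derivatives in time -/

namespace PseudoParabolic

section WeakTimeDerivative

variable {X : Type*} [NormedAddCommGroup X] [NormedSpace ℝ X] {T : ℝ}

theorem setIntegral_deriv_test {φ : ℝ → ℝ} (hφ : ContDiff ℝ ∞ φ) (hs : tsupport φ ⊆ Ioo 0 T) {s : ℝ}
    (hsT : s ≤ T) : ∫ t in Ioo s T, deriv φ t = -φ s := by
  have hT : φ T = 0 := image_eq_zero_of_notMem_tsupport fun h => lt_irrefl T (hs h).2
  rw [← integral_Ioc_eq_integral_Ioo, ← intervalIntegral.integral_of_le hsT,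
    intervalIntegral.integral_deriv_eq_sub (fun x _ => (hφ.differentiable (by simp)).differentiableAt)
      ((hφ.continuous_deriv (by simp)).intervalIntegrable _ _), hT, zero_sub]

/-- A primitive has the integrand as its weak derivative, by exchanging the order of integration. -/
theorem hasWeakTimeDeriv_of_eq_integral [CompleteSpace X] (hT : 0 < T) {u w : ℝ → X} {c : X}
    (hw : IntegrableOn w (Ioo 0 T)) (hu : ∀ t ∈ Ioo 0 T, u t = c + ∫ s in (0 : ℝ)..t, w s) :
    HasWeakTimeDeriv T u w := by
  intro φ hφ hc hs
  have hφ' : Continuous (deriv φ) := hφ.continuous_deriv (by simp)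
  have h0 : φ 0 = 0 := image_eq_zero_of_notMem_tsupport fun h => lt_irrefl 0 (hs h).1
  have hφi : IntegrableOn (deriv φ) (Ioo 0 T) :=
    (hφ'.integrableOn_Icc (a := 0) (b := T)).mono_set Ioo_subset_Icc_self
  set μ : Measure ℝ := volume.restrict (Ioo 0 T) with hμ
  set f : ℝ → ℝ → X := fun t s => {z : ℝ × ℝ | z.2 < z.1}.indicator
    (fun z : ℝ × ℝ => deriv φ z.1 • w z.2) (t, s) with hf
  have hfi : Integrable (Function.uncurry f) (μ.prod μ) :=
    (Integrable.smul_prod hφi hw).indicator (measurableSet_lt measurable_snd measurable_fst)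
  have e1 : ∀ t ∈ Ioo 0 T, deriv φ t • u t = deriv φ t • c + ∫ s, f t s ∂μ := by
    intro t ht
    have : ∀ s, f t s = (Iio t).indicator (fun s => deriv φ t • w s) s := fun s => by
      simp only [hf, indicator]
      rfl
    simp only [this]
    rw [hu t ht, smul_add, integral_indicator measurableSet_Iio, hμ,
      Measure.restrict_restrict measurableSet_Iio, integral_smul,
      intervalIntegral.integral_of_le ht.1.le, integral_Ioc_eq_integral_Ioo]
    congr 4
    ext s
    simp only [mem_Ioo, mem_inter_iff, mem_Iio]
    exact ⟨fun h => ⟨h.2, h.1, h.2.trans ht.2⟩, fun h => ⟨h.2.1, h.1⟩⟩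
  have e2 : ∀ s ∈ Ioo 0 T, ∫ t, f t s ∂μ = -(φ s • w s) := by
    intro s hs'
    have : ∀ t, f t s = (Ioi s).indicator (fun t => deriv φ t • w s) t := fun t => by
      simp only [hf, indicator]
      rfl
    simp only [this]
    rw [integral_indicator measurableSet_Ioi, hμ, Measure.restrict_restrict measurableSet_Ioi,
      integral_smul_const, ← neg_smul, ← setIntegral_deriv_test hφ hs hs'.2.le]
    congr 3
    ext t
    simp only [mem_Ioo, mem_inter_iff, mem_Ioi]
    exact ⟨fun h => ⟨h.1, h.2.2⟩, fun h => ⟨h.1, hs'.1.trans h.1, h.2⟩⟩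
  calc ∫ t in Ioo 0 T, deriv φ t • u t
      = ∫ t in Ioo 0 T, (deriv φ t • c + ∫ s, f t s ∂μ) :=
        setIntegral_congr_fun measurableSet_Ioo e1
    _ = (∫ t in Ioo 0 T, deriv φ t • c) + ∫ t, ∫ s, f t s ∂μ ∂μ :=
        integral_add (hφi.smul_const c) hfi.integral_prod_left
    _ = ∫ t, ∫ s, f t s ∂μ ∂μ := by
        rw [integral_smul_const, setIntegral_deriv_test hφ hs hT.le, h0, neg_zero, zero_smul,
          zero_add]
    _ = ∫ s, ∫ t, f t s ∂μ ∂μ := integral_integral_swap hfi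
    _ = ∫ s in Ioo 0 T, -(φ s • w s) := setIntegral_congr_fun measurableSet_Ioo e2
    _ = _ := integral_neg _

/-- A test function on `(0,T)` with vanishing integral is the derivative of a test function. -/
theorem exists_test_primitive (hT : 0 < T) {θ : ℝ → ℝ} (hθ : ContDiff ℝ ∞ θ)
    (hc : HasCompactSupport θ) (hs : tsupport θ ⊆ Ioo 0 T) (h0 : ∫ t in Ioo 0 T, θ t = 0) :
    ∃ φ : ℝ → ℝ, ContDiff ℝ ∞ φ ∧ HasCompactSupport φ ∧ tsupport φ ⊆ Ioo 0 T ∧ deriv φ = θ := by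
  -- the point `T / 2` only serves to make the compact set nonempty
  have hK : IsCompact (insert (T / 2) (tsupport θ)) := hc.isCompact.insert _
  have hKs : insert (T / 2) (tsupport θ) ⊆ Ioo 0 T :=
    insert_subset ⟨by positivity, by linarith⟩ hs
  obtain ⟨a, ha⟩ := hK.exists_isLeast (insert_nonempty _ _)
  obtain ⟨b, hb⟩ := hK.exists_isGreatest (insert_nonempty _ _)
  have haT := hKs ha.1
  have hbT := hKs hb.1
  have hz : ∀ t, t ∉ Icc a b → θ t = 0 := fun t ht =>
    image_eq_zero_of_notMem_tsupport fun h =>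
      ht ⟨ha.2 (mem_insert_of_mem _ h), hb.2 (mem_insert_of_mem _ h)⟩
  have hd : ∀ t, HasDerivAt (fun t => ∫ s in (0 : ℝ)..t, θ s) (θ t) t := fun t =>
    hθ.continuous.integral_hasStrictDerivAt 0 t |>.hasDerivAt
  have hderiv : deriv (fun t => ∫ s in (0 : ℝ)..t, θ s) = θ := funext fun t => (hd t).deriv
  have hint : ∀ x y : ℝ, IntervalIntegrable θ volume x y := hθ.continuous.intervalIntegrable
  have hsup : Function.support (fun t => ∫ s in (0 : ℝ)..t, θ s) ⊆ Icc a b := by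
    intro t ht
    by_contra hn
    refine ht ?_
    rw [mem_Icc, not_and_or, not_le, not_le] at hn
    obtain hn | hn := hn
    · refine intervalIntegral.integral_zero_ae (.of_forall fun s hs => hz s fun h => ?_)
      obtain hh | hh := mem_uIoc.1 hs
      · linarith [hh.2, h.1]
      · linarith [hh.2, h.1, haT.1]
    · have e1 : ∫ s in (0 : ℝ)..T, θ s = 0 := by
        rw [intervalIntegral.integral_of_le hT.le, integral_Ioc_eq_integral_Ioo, h0]
      have e2 : ∫ s in t..T, θ s = 0 := by
        refine intervalIntegral.integral_zero_ae (.of_forall fun s hs => hz s fun h => ?_)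
        obtain hh | hh := mem_uIoc.1 hs
        · linarith [hh.1, h.2]
        · linarith [hh.1, h.2, hbT.2]
      have := intervalIntegral.integral_add_adjacent_intervals (hint 0 t) (hint t T)
      rw [e1, e2, add_zero] at this
      exact this
  have hts : tsupport (fun t => ∫ s in (0 : ℝ)..t, θ s) ⊆ Icc a b :=
    closure_minimal hsup isClosed_Icc
  refine ⟨_, contDiff_infty_iff_deriv.2 ⟨fun t => (hd t).differentiableAt, by rwa [hderiv]⟩,
    isCompact_Icc.of_isClosed_subset (isClosed_tsupport _) hts, hts.trans fun t ht =>
      ⟨haT.1.trans_le ht.1, ht.2.trans_lt hbT.2⟩, hderiv⟩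

/-- The lemma of du Bois-Reymond: a function with vanishing weak derivative is constant. -/
theorem HasWeakTimeDeriv.eq_const [CompleteSpace X] (hT : 0 < T) {x : ℝ → X}
    (hx : ContinuousOn x (Icc 0 T)) (h : HasWeakTimeDeriv T x fun _ => 0) :
    ∀ t ∈ Icc 0 T, x t = x 0 := by
  have hxi : IntegrableOn x (Ioo 0 T) :=
    (hx.integrableOn_Icc).mono_set Ioo_subset_Icc_self
  have hb : ∃ ψ : ℝ → ℝ, ContDiff ℝ ∞ ψ ∧ HasCompactSupport ψ ∧ tsupport ψ ⊆ Ioo 0 T ∧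
      ∫ t in Ioo 0 T, ψ t = 1 := by
    let B : ContDiffBump (T / 2 : ℝ) := ⟨T / 8, T / 4, by positivity, by linarith⟩
    have hB : tsupport (B.normed volume) ⊆ Ioo 0 T := by
      rw [B.tsupport_normed_eq]
      intro t ht
      rw [Metric.mem_closedBall, Real.dist_eq, abs_le] at ht
      have h1 : B.rOut = T / 4 := rfl
      rw [h1] at ht
      constructor <;> linarith [ht.1, ht.2]
    refine ⟨B.normed volume, B.contDiff_normed, B.hasCompactSupport_normed, hB, ?_⟩
    rw [setIntegral_eq_integral_of_forall_compl_eq_zero, B.integral_normed]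
    exact fun t ht => image_eq_zero_of_notMem_tsupport fun h' => ht (hB h')
  obtain ⟨ψ, hψ, hψc, hψs, hψ1⟩ := hb
  have hti : ∀ g : ℝ → ℝ, Continuous g → IntegrableOn g (Ioo 0 T) ∧
      IntegrableOn (fun t => g t • x t) (Ioo 0 T) := by
    intro g hg
    exact ⟨(hg.integrableOn_Icc).mono_set Ioo_subset_Icc_self,
      ((hg.continuousOn.smul hx).integrableOn_Icc).mono_set Ioo_subset_Icc_self⟩
  set c : X := ∫ t in Ioo 0 T, ψ t • x t with hcdef
  have hae : ∀ᵐ t, t ∈ Ioo 0 T → x t - c = 0 := by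
    refine isOpen_Ioo.ae_eq_zero_of_integral_contDiff_smul_eq_zero ?_ fun g hg hgc hgs => ?_
    · exact (hxi.sub (integrableOn_const (by simp))).locallyIntegrableOn
    -- `g - (∫ g) ψ` has vanishing integral, hence is the derivative of a test function
    obtain ⟨r, hr⟩ : ∃ r : ℝ, r = ∫ t in Ioo 0 T, g t := ⟨_, rfl⟩
    have hθs : tsupport (fun t => g t - r * ψ t) ⊆ Ioo 0 T :=
      (tsupport_sub _ _).trans (union_subset hgs ((tsupport_mul_subset_right).trans hψs))
    obtain ⟨φ, h1, h2, h3, h4⟩ := exists_test_primitive hT (hg.sub (contDiff_const.mul hψ))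
      (hgc.sub hψc.mul_left) hθs (by
        have h1 := (hti g hg.continuous).1
        have h2 := (hti ψ hψ.continuous).1.const_mul r
        rw [integral_sub h1 h2, integral_const_mul, hψ1, ← hr]; ring)
    have h5 := h φ h1 h2 h3
    rw [h4] at h5
    simp only [smul_zero, integral_zero, neg_zero, sub_smul, mul_smul] at h5
    have i2 : IntegrableOn (fun t => r • ψ t • x t) (Ioo 0 T) := (hti ψ hψ.continuous).2.smul r
    rw [integral_sub (hti g hg.continuous).2 i2, integral_smul,
      ← hcdef] at h5
    have h6 : ∫ t, g t • (x t - c) = ∫ t in Ioo 0 T, g t • (x t - c) := by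
      rw [setIntegral_eq_integral_of_forall_compl_eq_zero]
      exact fun t ht => by
        rw [image_eq_zero_of_notMem_tsupport fun h' => ht (hgs h'), zero_smul]
    rw [h6]
    simp only [smul_sub]
    rw [integral_sub (hti g hg.continuous).2 ((hti g hg.continuous).1.smul_const c),
      integral_smul_const, ← hr, h5]
  have heq : EqOn x (fun _ => c) (Icc 0 T) := by
    refine Measure.eqOn_Icc_of_ae_eq volume hT.ne ?_ hx continuousOn_const
    rw [← Measure.restrict_congr_set Ioo_ae_eq_Icc]
    filter_upwards [ae_restrict_mem measurableSet_Ioo, ae_restrict_of_ae hae] with t h1 h2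
    exact sub_eq_zero.1 (h2 h1)
  intro t ht
  rw [heq ht, heq ⟨le_rfl, hT.le⟩]

/-- A continuous function with an integrable weak derivative is a primitive of it. -/
theorem HasWeakTimeDeriv.eq_integral [CompleteSpace X] (hT : 0 < T) {u w : ℝ → X}
    (hu : ContinuousOn u (Icc 0 T)) (hw : IntegrableOn w (Ioo 0 T)) (h : HasWeakTimeDeriv T u w) :
    ∀ t ∈ Icc 0 T, u t = u 0 + ∫ s in (0 : ℝ)..t, w s := by
  have hwI : IntervalIntegrable w volume 0 T :=
    (intervalIntegrable_iff_integrableOn_Ioo_of_le hT.le).2 hw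
  have hP : ContinuousOn (fun t => ∫ s in (0 : ℝ)..t, w s) (Icc 0 T) := by
    have := intervalIntegral.continuousOn_primitive_interval' hwI left_mem_uIcc
    rwa [uIcc_of_le hT.le] at this
  have hPw := hasWeakTimeDeriv_of_eq_integral (u := fun t => ∫ s in (0 : ℝ)..t, w s) (c := 0) hT hw
    fun t _ => (zero_add _).symm
  have hd : HasWeakTimeDeriv T (fun t => u t - ∫ s in (0 : ℝ)..t, w s) fun _ => 0 := by
    intro φ hφ hc hs
    have hφ' : Continuous (deriv φ) := hφ.continuous_deriv (by simp)
    have i1 : IntegrableOn (fun t => deriv φ t • u t) (Ioo 0 T) :=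
      ((hφ'.continuousOn.smul hu).integrableOn_Icc (μ := volume)).mono_set
      Ioo_subset_Icc_self
    have i2 : IntegrableOn (fun t => deriv φ t • ∫ s in (0 : ℝ)..t, w s) (Ioo 0 T) :=
      ((hφ'.continuousOn.smul hP).integrableOn_Icc (μ := volume)).mono_set
      Ioo_subset_Icc_self
    simp only [smul_sub, smul_zero, integral_zero, neg_zero]
    rw [integral_sub i1 i2, h φ hφ hc hs, hPw φ hφ hc hs, sub_self]
  intro t ht
  have := hd.eq_const hT (hu.sub hP) t ht
  simp only [Pi.sub_apply, intervalIntegral.integral_same, sub_zero] at this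
  rw [← this, sub_add_cancel]

end WeakTimeDerivative

end PseudoParabolic

/-! ### Multiplication and superposition operators on `L²` -/

namespace PseudoParabolic

open scoped ENNReal NNReal

section Superposition

variable {Y : Type*} [MeasurableSpace Y] {μ : Measure Y}

section Multiplication

variable {E : Type*} [NormedAddCommGroup E] [InnerProductSpace ℝ E]

/-- Multiplication by a bounded measurable function is a bounded operator on `L²`. -/
theorem exists_mulOp {m : Y → ℝ} (hm : Measurable m) {M : ℝ} (hM : 0 ≤ M) (hb : ∀ y, |m y| ≤ M) :
    ∃ L : Lp E 2 μ →L[ℝ] Lp E 2 μ, (∀ w, L w =ᵐ[μ] fun y => m y • w y) ∧ ‖L‖ ≤ M := by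
  have hle : ∀ (w : Lp E 2 μ), ∀ᵐ y ∂μ, ‖m y • w y‖ ≤ M * ‖w y‖ := fun w =>
    .of_forall fun y => by
      rw [norm_smul]
      gcongr
      exact hb y
  have hmem : ∀ w : Lp E 2 μ, MemLp (fun y => m y • w y) 2 μ := fun w =>
    MemLp.of_le_mul (Lp.memLp w) (hm.aestronglyMeasurable.smul (Lp.aestronglyMeasurable w)) (hle w)
  refine ⟨LinearMap.mkContinuous
    { toFun := fun w => (hmem w).toLp _
      map_add' := fun v w => ?_
      map_smul' := fun c w => ?_ } M fun w => ?_, fun w => (hmem w).coeFn_toLp,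
    LinearMap.mkContinuous_norm_le _ hM _⟩
  · refine Lp.ext ?_
    filter_upwards [(hmem (v + w)).coeFn_toLp, (hmem v).coeFn_toLp, (hmem w).coeFn_toLp,
      Lp.coeFn_add v w, Lp.coeFn_add ((hmem v).toLp _) ((hmem w).toLp _)] with y h1 h2 h3 h4 h5
    rw [h1, h5, Pi.add_apply, h2, h3, h4, Pi.add_apply, smul_add]
  · refine Lp.ext ?_
    filter_upwards [(hmem (c • w)).coeFn_toLp, (hmem w).coeFn_toLp, Lp.coeFn_smul c w,
      Lp.coeFn_smul c ((hmem w).toLp _)] with y h1 h2 h3 h4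
    rw [h1, RingHom.id_apply, h4, Pi.smul_apply, h2, h3, Pi.smul_apply, smul_comm]
  · refine Lp.norm_le_mul_norm_of_ae_le_mul ?_
    filter_upwards [(hmem w).coeFn_toLp, hle w] with y h1 h2
    change ‖((hmem w).toLp _) y‖ ≤ _
    rw [h1]
    exact h2

open Classical in
/-- Multiplication by the bounded measurable function `m` on `L²(μ; E)`; zero by default for other
functions `m`. -/
noncomputable def mulOp (μ : Measure Y) (E : Type*) [NormedAddCommGroup E] [InnerProductSpace ℝ E]
    (m : Y → ℝ) : Lp E 2 μ →L[ℝ] Lp E 2 μ :=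
  if h : Measurable m ∧ ∃ M, 0 ≤ M ∧ ∀ y, |m y| ≤ M then
    (exists_mulOp h.1 h.2.choose_spec.1 h.2.choose_spec.2).choose else 0

theorem mulOp_ae {m : Y → ℝ} (hm : Measurable m) {M : ℝ} (hb : ∀ y, |m y| ≤ M) (w : Lp E 2 μ) :
    mulOp μ E m w =ᵐ[μ] fun y => m y • w y := by
  have h : Measurable m ∧ ∃ M, 0 ≤ M ∧ ∀ y, |m y| ≤ M :=
    ⟨hm, max M 0, le_max_right _ _, fun y => (hb y).trans (le_max_left _ _)⟩
  rw [mulOp, dif_pos h]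
  exact (exists_mulOp h.1 h.2.choose_spec.1 h.2.choose_spec.2).choose_spec.1 w

theorem norm_mulOp_le {m : Y → ℝ} (hm : Measurable m) {M : ℝ} (hM : 0 ≤ M) (hb : ∀ y, |m y| ≤ M) :
    ‖mulOp μ E m‖ ≤ M := by
  refine ContinuousLinearMap.opNorm_le_bound _ hM fun w => Lp.norm_le_mul_norm_of_ae_le_mul ?_
  filter_upwards [mulOp_ae hm hb w] with y h1
  rw [h1, norm_smul]
  gcongr
  exact hb y

theorem inner_mulOp {m : Y → ℝ} (hm : Measurable m) {M : ℝ} (hb : ∀ y, |m y| ≤ M)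
    (w φ : Lp E 2 μ) : ⟪mulOp μ E m w, φ⟫_ℝ = ∫ y, m y * ⟪w y, φ y⟫_ℝ ∂μ := by
  rw [L2.inner_def]
  refine integral_congr_ae ?_
  filter_upwards [mulOp_ae hm hb w] with y h1
  rw [h1, real_inner_smul_left]

theorem integrable_mul_inner {m : Y → ℝ} (hm : Measurable m) {M : ℝ} (hb : ∀ y, |m y| ≤ M)
    (w φ : Lp E 2 μ) : Integrable (fun y => m y * ⟪w y, φ y⟫_ℝ) μ :=
  (L2.integrable_inner (𝕜 := ℝ) w φ).bdd_mul hm.aestronglyMeasurable (.of_forall hb)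

variable {a : ℝ → Y → ℝ} {M : ℝ}

theorem stronglyMeasurable_mulOp [CompleteSpace E] [SFinite μ] [SecondCountableTopology (Lp E 2 μ)]
    (ha : Measurable (Function.uncurry a)) (hb : ∀ t y, |a t y| ≤ M) (w : Lp E 2 μ) :
    StronglyMeasurable fun t => mulOp μ E (a t) w := by
  refine stronglyMeasurable_of_inner fun φ => ?_
  have e : (fun t => ⟪φ, mulOp μ E (a t) w⟫_ℝ) = fun t => ∫ y, a t y * ⟪w y, φ y⟫_ℝ ∂μ := by
    funext t
    rw [real_inner_comm, inner_mulOp (ha.of_uncurry_left) (hb t)]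
  rw [e]
  have hs : StronglyMeasurable fun z : ℝ × Y => a z.1 z.2 * ⟪w z.2, φ z.2⟫_ℝ :=
    ha.stronglyMeasurable.mul
      (((Lp.stronglyMeasurable w).comp_measurable measurable_snd).inner
        ((Lp.stronglyMeasurable φ).comp_measurable measurable_snd))
  exact hs.integral_prod_right.measurable

theorem measurable_stepMean {T : ℝ} (hT : 0 < T) {n i : ℕ} (ha : Measurable (Function.uncurry a)) :
    Measurable fun y => stepMean T n (fun s => a s y) i := by
  have e : (fun y => stepMean T n (fun s => a s y) i) =
      fun y => (T / n)⁻¹ * ∫ s in cell T n i, a s y := by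
    funext y
    rw [stepMean_eq hT, smul_eq_mul]
  rw [e]
  have hs : StronglyMeasurable fun z : Y × ℝ => a z.2 z.1 :=
    (ha.comp measurable_swap).stronglyMeasurable
  exact hs.integral_prod_right'.measurable.const_mul _

theorem abs_stepMean_le {Z : Type*} {a : ℝ → Z → ℝ} {T : ℝ} (hT : 0 < T) {n i : ℕ} (hn : 1 ≤ n)
    (hb : ∀ t y, |a t y| ≤ M)
    (y : Z) : |stepMean T n (fun s => a s y) i| ≤ M := by
  rw [← Real.norm_eq_abs]
  exact (norm_stepMean_le hT (integrableOn_const (by rw [volume_cell]; exact ENNReal.ofReal_ne_top))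
    (.of_forall fun s => hb s y)).trans_eq (stepMean_const (T := T) (i := i) hT hn M)

/-- Averaging in time commutes with multiplication by the coefficient. -/
theorem stepMean_mulOp [CompleteSpace E] [SFinite μ] [SecondCountableTopology (Lp E 2 μ)] {T : ℝ}
    (hT : 0 < T) {n i : ℕ} (hn : 1 ≤ n)
    (ha : Measurable (Function.uncurry a)) (hb : ∀ t y, |a t y| ≤ M) (w : Lp E 2 μ) :
    stepMean T n (fun s => mulOp μ E (a s) w) i =
      mulOp μ E (fun y => stepMean T n (fun s => a s y) i) w := by
  have hint : IntegrableOn (fun s => mulOp μ E (a s) w) (cell T n i) := by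
    refine Measure.integrableOn_of_bounded (M := |M| * ‖w‖) (by
      rw [volume_cell]; exact ENNReal.ofReal_ne_top)
      (stronglyMeasurable_mulOp ha hb w).aestronglyMeasurable (.of_forall fun s => ?_)
    exact (mulOp μ E (a s)).le_of_opNorm_le (norm_mulOp_le ha.of_uncurry_left (abs_nonneg _)
      fun y => (hb s y).trans (le_abs_self _)) w
  refine ext_inner_right ℝ fun φ => ?_
  have e1 := stepMean_clm hT (innerSL ℝ φ) hint
  simp only [innerSL_apply_apply] at e1
  have hprod : Integrable (Function.uncurry fun s y => a s y * ⟪w y, φ y⟫_ℝ)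
      ((volume.restrict (cell T n i)).prod μ) := by
    have : IsFiniteMeasure (volume.restrict (cell T n i)) :=
      ⟨by rw [Measure.restrict_apply_univ, volume_cell]; exact ENNReal.ofReal_lt_top⟩
    have h1 : Integrable (fun z : ℝ × Y => (1 : ℝ) * ⟪w z.2, φ z.2⟫_ℝ)
        ((volume.restrict (cell T n i)).prod μ) :=
      Integrable.mul_prod (integrable_const 1) (L2.integrable_inner (𝕜 := ℝ) w φ)
    simp only [one_mul] at h1
    exact h1.bdd_mul ha.aestronglyMeasurable (.of_forall fun z => hb z.1 z.2)
  rw [real_inner_comm, ← e1, inner_mulOp (measurable_stepMean hT ha) (abs_stepMean_le hT hn hb),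
    stepMean_eq hT]
  have e2 : ∀ s, ⟪φ, mulOp μ E (a s) w⟫_ℝ = ∫ y, a s y * ⟪w y, φ y⟫_ℝ ∂μ := fun s => by
    rw [real_inner_comm, inner_mulOp ha.of_uncurry_left (hb s)]
  simp only [e2]
  rw [integral_integral_swap hprod, smul_eq_mul, ← integral_const_mul]
  refine integral_congr_ae (.of_forall fun y => ?_)
  simp only
  rw [integral_mul_const, stepMean_eq hT, smul_eq_mul, mul_assoc]

end Multiplication

section Nemytskii

variable [IsFiniteMeasure μ] {F : ℝ → ℝ} {L : ℝ≥0}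

theorem memLp_lipschitz_comp (hF : LipschitzWith L F) (v : Lp ℝ 2 μ) :
    MemLp (fun y => F (v y)) 2 μ := by
  have h1 : MemLp (fun y => ‖F 0‖ + L * ‖v y‖) 2 μ :=
    MemLp.add (memLp_const ‖F 0‖) (MemLp.const_mul (Lp.memLp v).norm (L : ℝ))
  refine MemLp.of_le h1 (hF.continuous.comp_aestronglyMeasurable (Lp.aestronglyMeasurable v))
    (.of_forall fun y => ?_)
  have := hF.norm_sub_le (v y) 0
  rw [sub_zero] at this
  refine le_trans ?_ (Real.le_norm_self _)
  linarith [norm_le_norm_add_norm_sub' (F (v y)) (F 0)]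

open Classical in
/-- The superposition operator `v ↦ F ∘ v` on `L²(μ)`, for Lipschitz `F` and finite `μ`. -/
noncomputable def nemytskii (μ : Measure Y) (F : ℝ → ℝ) (v : Lp ℝ 2 μ) : Lp ℝ 2 μ :=
  if h : MemLp (fun y => F (v y)) 2 μ then h.toLp _ else 0

theorem nemytskii_ae (hF : LipschitzWith L F) (v : Lp ℝ 2 μ) :
    nemytskii μ F v =ᵐ[μ] fun y => F (v y) := by
  rw [nemytskii, dif_pos (memLp_lipschitz_comp hF v)]
  exact MemLp.coeFn_toLp _

theorem norm_nemytskii_sub_le (hF : LipschitzWith L F) (v w : Lp ℝ 2 μ) :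
    ‖nemytskii μ F v - nemytskii μ F w‖ ≤ L * ‖v - w‖ := by
  refine Lp.norm_le_mul_norm_of_ae_le_mul ?_
  filter_upwards [nemytskii_ae hF v, nemytskii_ae hF w, Lp.coeFn_sub v w,
    Lp.coeFn_sub (nemytskii μ F v) (nemytskii μ F w)] with y h1 h2 h3 h4
  rw [h4, h3, Pi.sub_apply, Pi.sub_apply, h1, h2]
  exact hF.norm_sub_le _ _

/-- Integration over a finite measure space as a functional on `L²`. -/
theorem exists_integral_clm (μ : Measure Y) [IsFiniteMeasure μ] :
    ∃ I : Lp ℝ 2 μ →L[ℝ] ℝ, ∀ v, I v = ∫ y, v y ∂μ := by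
  refine ⟨innerSL ℝ ((memLp_const (1 : ℝ)).toLp _), fun v => ?_⟩
  rw [innerSL_apply_apply, L2.inner_def]
  refine integral_congr_ae ?_
  filter_upwards [(memLp_const (μ := μ) (p := 2) (1 : ℝ)).coeFn_toLp] with y hy
  rw [hy]
  simp

end Nemytskii

end Superposition

end PseudoParabolic

/-! ### Operators of the variational problem -/

namespace PseudoParabolic

open scoped ENNReal NNReal

section Operators

variable {V Y E : Type*} [NormedAddCommGroup V] [InnerProductSpace ℝ V] [CompleteSpace V]
  [MeasurableSpace Y] [NormedAddCommGroup E] [InnerProductSpace ℝ E] [CompleteSpace E]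
  {μ σ : Measure Y} (ι : V →L[ℝ] Lp ℝ 2 μ) (D : V →L[ℝ] Lp E 2 μ) (tr : V →L[ℝ] Lp ℝ 2 σ)

/-- The operator of the form `(κ Dv, Dφ)` on `V`. -/
noncomputable def stiffness (k : Y → ℝ) : V →L[ℝ] V := D.adjoint ∘L mulOp μ E k ∘L D

/-- The operator of the form `(ιw, ιφ) + (η Dw, Dφ)` on `V`. -/
noncomputable def leading (e : Y → ℝ) : V →L[ℝ] V := ι.adjoint ∘L ι + stiffness D e

/-- The functional `(F(ιv), ιφ)`, represented in `V`. -/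
noncomputable def reaction (F : ℝ → ℝ) (v : V) : V := ι.adjoint (nemytskii μ F (ι v))

/-- The functional `(η ∂ₜG, tr φ) + (g, tr φ)`, represented in `V`. -/
noncomputable def boundaryLoad (e : Y → ℝ) (dG g : Lp ℝ 2 σ) : V :=
  tr.adjoint (mulOp σ ℝ e dG + g)

variable {ι D tr} {e k : Y → ℝ} {M : ℝ}

theorem inner_stiffness (hk : Measurable k) (hb : ∀ x, |k x| ≤ M) (v φ : V) :
    ⟪stiffness D k v, φ⟫_ℝ = ∫ x, k x * ⟪D v x, D φ x⟫_ℝ ∂μ := by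
  rw [stiffness, ContinuousLinearMap.comp_apply, ContinuousLinearMap.adjoint_inner_left,
    ContinuousLinearMap.comp_apply, inner_mulOp hk hb]

theorem inner_adjoint_eq_integral (z : Lp ℝ 2 μ) (φ : V) :
    ⟪ι.adjoint z, φ⟫_ℝ = ∫ x, z x * ι φ x ∂μ := by
  rw [ContinuousLinearMap.adjoint_inner_left, L2.inner_def]
  refine integral_congr_ae (.of_forall fun x => ?_)
  simp only [RCLike.inner_apply, conj_trivial]
  ring

theorem inner_leading (he : Measurable e) (hb : ∀ x, |e x| ≤ M) (w φ : V) :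
    ⟪leading ι D e w, φ⟫_ℝ = (∫ x, ι w x * ι φ x ∂μ) + ∫ x, e x * ⟪D w x, D φ x⟫_ℝ ∂μ := by
  rw [leading, add_apply, inner_add_left, inner_stiffness he hb, ContinuousLinearMap.comp_apply,
    inner_adjoint_eq_integral]

theorem inner_boundaryLoad (he : Measurable e) (hb : ∀ x, |e x| ≤ M) (dG g : Lp ℝ 2 σ) (φ : V) :
    ⟪boundaryLoad tr e dG g, φ⟫_ℝ = (∫ x, e x * dG x * tr φ x ∂σ) + ∫ x, g x * tr φ x ∂σ := by
  rw [boundaryLoad, map_add, inner_add_left, inner_adjoint_eq_integral, inner_adjoint_eq_integral]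
  congr 1
  refine integral_congr_ae ?_
  filter_upwards [mulOp_ae he hb dG] with x hx
  rw [hx, smul_eq_mul]

theorem inner_reaction [IsFiniteMeasure μ] {F : ℝ → ℝ} {L : ℝ≥0} (hF : LipschitzWith L F)
    (z φ : V) : ⟪reaction ι F z, φ⟫_ℝ = ∫ x, F (ι z x) * ι φ x ∂μ := by
  rw [reaction, inner_adjoint_eq_integral]
  refine integral_congr_ae ?_
  filter_upwards [nemytskii_ae hF (ι z)] with x hx
  rw [hx]

/-- The variational equation as an equation in `V`. -/
theorem variational_iff [IsFiniteMeasure μ] {F : ℝ → ℝ} {L : ℝ≥0} (hF : LipschitzWith L F)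
    (he : Measurable e) (heb : ∀ x, |e x| ≤ M) (hk : Measurable k) (hkb : ∀ x, |k x| ≤ M)
    (dG g : Lp ℝ 2 σ) (p : Lp ℝ 2 μ) (h : ℝ) (w v z : V) :
    (∀ φ : V, (∫ x, ι w x * ι φ x ∂μ) + (∫ x, e x * ⟪D w x, D φ x⟫_ℝ ∂μ)
        + (∫ x, k x * ⟪D v x, D φ x⟫_ℝ ∂μ)
      = h * (∫ x, p x * ι φ x ∂μ) + (∫ x, F (ι z x) * ι φ x ∂μ)
        + (∫ x, e x * dG x * tr φ x ∂σ) + ∫ x, g x * tr φ x ∂σ) ↔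
      leading ι D e w + stiffness D k v =
        reaction ι F z + boundaryLoad tr e dG g + h • ι.adjoint p := by
  have l : ∀ φ, ⟪leading ι D e w + stiffness D k v, φ⟫_ℝ = (∫ x, ι w x * ι φ x ∂μ)
      + (∫ x, e x * ⟪D w x, D φ x⟫_ℝ ∂μ) + (∫ x, k x * ⟪D v x, D φ x⟫_ℝ ∂μ) := fun φ => by
    rw [inner_add_left, inner_leading he heb, inner_stiffness hk hkb]
  have r : ∀ φ, ⟪reaction ι F z + boundaryLoad tr e dG g + h • ι.adjoint p, φ⟫_ℝ =
      h * (∫ x, p x * ι φ x ∂μ) + (∫ x, F (ι z x) * ι φ x ∂μ)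
      + (∫ x, e x * dG x * tr φ x ∂σ) + ∫ x, g x * tr φ x ∂σ := fun φ => by
    rw [inner_add_left, inner_add_left, inner_reaction hF, inner_boundaryLoad he heb,
      real_inner_smul_left, inner_adjoint_eq_integral]
    ring
  constructor
  · intro hv
    refine ext_inner_right ℝ fun φ => ?_
    rw [l, r, hv]
  · intro hv φ
    rw [← l, ← r, hv]

/-- The form `(ιw, ιw) + (η Dw, Dw)` is coercive for the norm of `H¹`. -/
theorem leading_coercive (hV : ∀ v, ‖v‖ ^ 2 = ‖ι v‖ ^ 2 + ‖D v‖ ^ 2) {c : ℝ} (he : Measurable e)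
    (hb : ∀ x, |e x| ≤ M) (hc : ∀ x, c ≤ e x) (v : V) :
    min 1 c * ‖v‖ ^ 2 ≤ ⟪leading ι D e v, v⟫_ℝ := by
  have h1 : ∫ x, ι v x * ι v x ∂μ = ‖ι v‖ ^ 2 := by
    rw [← real_inner_self_eq_norm_sq, L2.inner_def]
    rfl
  have h2 : c * ‖D v‖ ^ 2 ≤ ∫ x, e x * ⟪D v x, D v x⟫_ℝ ∂μ := by
    rw [← real_inner_self_eq_norm_sq, L2.inner_def, ← integral_const_mul]
    refine integral_mono ((L2.integrable_inner (𝕜 := ℝ) _ _).const_mul c)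
      (integrable_mul_inner he hb _ _) fun x => ?_
    exact mul_le_mul_of_nonneg_right (hc x) real_inner_self_nonneg
  rw [inner_leading he hb, h1, hV, mul_add]
  refine add_le_add ?_ (le_trans ?_ h2)
  · exact mul_le_of_le_one_left (sq_nonneg _) (min_le_left _ _)
  · exact mul_le_mul_of_nonneg_right (min_le_right _ _) (sq_nonneg _)

theorem stiffness_nonneg (hk : Measurable k) (hb : ∀ x, |k x| ≤ M) (h0 : ∀ x, 0 ≤ k x) (v : V) :
    0 ≤ ⟪stiffness D k v, v⟫_ℝ := by
  rw [inner_stiffness hk hb]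
  exact integral_nonneg fun x => mul_nonneg (h0 x) real_inner_self_nonneg

theorem norm_stiffness_le (hM : 0 ≤ M) (hk : Measurable k) (hb : ∀ x, |k x| ≤ M) :
    ‖stiffness D k‖ ≤ ‖D.adjoint‖ * (M * ‖D‖) := by
  refine (ContinuousLinearMap.opNorm_comp_le _ _).trans ?_
  gcongr
  refine (ContinuousLinearMap.opNorm_comp_le _ _).trans ?_
  gcongr
  exact norm_mulOp_le hk hM hb

theorem norm_leading_le (hM : 0 ≤ M) (he : Measurable e) (hb : ∀ x, |e x| ≤ M) :
    ‖leading ι D e‖ ≤ ‖ι.adjoint‖ * ‖ι‖ + ‖D.adjoint‖ * (M * ‖D‖) :=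
  (norm_add_le _ _).trans (add_le_add (ContinuousLinearMap.opNorm_comp_le _ _)
    (norm_stiffness_le hM he hb))

section TimeDependent

variable {a : ℝ → Y → ℝ} {T : ℝ} {n i : ℕ} [SFinite μ]

theorem integrableOn_cell_mulOp [SecondCountableTopology (Lp E 2 μ)]
    (ha : Measurable (Function.uncurry a)) (hb : ∀ t y, |a t y| ≤ M) (hM : 0 ≤ M) (w : Lp E 2 μ) :
    IntegrableOn (fun s => mulOp μ E (a s) w) (cell T n i) :=
  Measure.integrableOn_of_bounded (M := M * ‖w‖)
    (by rw [volume_cell]; exact ENNReal.ofReal_ne_top)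
    (stronglyMeasurable_mulOp ha hb w).aestronglyMeasurable
    (.of_forall fun s => (mulOp μ E (a s)).le_of_opNorm_le
      (norm_mulOp_le ha.of_uncurry_left hM (hb s)) w)

variable [SecondCountableTopology (Lp E 2 μ)]

theorem stronglyMeasurable_stiffness (ha : Measurable (Function.uncurry a))
    (hb : ∀ t y, |a t y| ≤ M) (w : V) : StronglyMeasurable fun t => stiffness D (a t) w :=
  D.adjoint.continuous.comp_stronglyMeasurable (stronglyMeasurable_mulOp ha hb _)

theorem stronglyMeasurable_leading (ha : Measurable (Function.uncurry a))
    (hb : ∀ t y, |a t y| ≤ M) (w : V) : StronglyMeasurable fun t => leading ι D (a t) w :=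
  stronglyMeasurable_const.add (stronglyMeasurable_stiffness ha hb w)

theorem stepMean_stiffness (hT : 0 < T) (hn : 1 ≤ n) (ha : Measurable (Function.uncurry a))
    (hb : ∀ t y, |a t y| ≤ M) (hM : 0 ≤ M) (w : V) :
    stepMean T n (fun s => stiffness D (a s) w) i =
      stiffness D (fun x => stepMean T n (fun s => a s x) i) w := by
  have := stepMean_clm hT D.adjoint (integrableOn_cell_mulOp (T := T) (n := n) (i := i) ha hb hM
    (D w))
  rw [stepMean_mulOp hT hn ha hb] at this
  exact this

theorem stepMean_leading (hT : 0 < T) (hn : 1 ≤ n) (ha : Measurable (Function.uncurry a))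
    (hb : ∀ t y, |a t y| ≤ M) (hM : 0 ≤ M) (w : V) :
    stepMean T n (fun s => leading ι D (a s) w) i =
      leading ι D (fun x => stepMean T n (fun s => a s x) i) w := by
  have h1 : IntegrableOn (fun s => stiffness D (a s) w) (cell T n i) :=
    D.adjoint.integrable_comp (integrableOn_cell_mulOp ha hb hM (D w))
  have h2 : IntegrableOn (fun _ => (ι.adjoint ∘L ι) w) (cell T n i) :=
    integrableOn_const (by rw [volume_cell]; exact ENNReal.ofReal_ne_top)
  simp only [leading, add_apply]
  rw [stepMean_add hT h2 h1, stepMean_const hT hn, stepMean_stiffness hT hn ha hb hM]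

end TimeDependent

end Operators

end PseudoParabolic

/-! ### The model problem as an evolution equation -/

namespace PseudoParabolic

open scoped ENNReal NNReal

theorem memL2Time_rotheStep_sub {X : Type*} [NormedAddCommGroup X] {T : ℝ} (hT : 0 < T) (n : ℕ)
    {z : ℝ → X} (hz : MemL2Time T z) (W : ℕ → X) : MemL2Time T fun s => rotheStep T n W s - z s := by
  obtain rfl | hn := Nat.eq_zero_or_pos n
  · have e : rotheStep T 0 W = fun _ => W 0 := by
      funext s
      simp [rotheStep, stepIndex]
    rw [e]
    exact (memL2Time_const T (W 0)).sub hz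
  · exact memL2Time_sub_rotheStep hT hn hz W

theorem MemL2Time.continuousOn_mul {T : ℝ} {r x : ℝ → ℝ} (hr : ContinuousOn r (Icc 0 T))
    (hx : MemL2Time T x) : MemL2Time T fun t => r t * x t := by
  obtain ⟨C, hC⟩ := isCompact_Icc.exists_bound_of_continuousOn hr
  refine MemLp.of_le_mul (c := C) hx ((memL2Time_of_continuousOn hr).1.mul hx.1) ?_
  filter_upwards [ae_restrict_mem measurableSet_Ioo] with s hs
  rw [norm_mul]
  gcongr
  exact hC s (Ioo_subset_Icc_self hs)

section MulOpTime

variable {Y E : Type*} [MeasurableSpace Y] [NormedAddCommGroup E] [InnerProductSpace ℝ E]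
  [CompleteSpace E] {μ : Measure Y} [SFinite μ] [SecondCountableTopology (Lp E 2 μ)]
  {a : ℝ → Y → ℝ} {M T : ℝ}

theorem memL2Time_mulOp (ha : Measurable (Function.uncurry a)) (hb : ∀ t y, |a t y| ≤ M)
    (hM : 0 ≤ M) {z : ℝ → Lp E 2 μ} (hz : MemL2Time T z) :
    MemL2Time T fun t => mulOp μ E (a t) (z t) := by
  have hs : ∀ w, StronglyMeasurable fun t => mulOp μ E (a t) w :=
    fun w => stronglyMeasurable_mulOp ha hb w
  have hm : AEStronglyMeasurable (fun t => mulOp μ E (a t) (z t)) (volume.restrict (Ioo 0 T)) :=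
    aestronglyMeasurable_apply (A := fun t => mulOp μ E (a t)) hs hz.1
  have hle : ∀ t, ‖mulOp μ E (a t) (z t)‖ ≤ M * ‖z t‖ := fun t =>
    (mulOp μ E (a t)).le_of_opNorm_le (norm_mulOp_le ha.of_uncurry_left hM (hb t)) _
  exact MemLp.of_le_mul hz hm (.of_forall hle)

/-- The product of the averages of a coefficient and of a function differs from the average of the
product by the oscillation of the function. -/
theorem norm_mulOp_stepMean_sub_le (hT : 0 < T) {n i : ℕ} (hn : 1 ≤ n) (hi : 1 ≤ i) (hin : i ≤ n)
    (ha : Measurable (Function.uncurry a)) (hb : ∀ t y, |a t y| ≤ M) (hM : 0 ≤ M)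
    {z : ℝ → Lp E 2 μ} (hz : MemL2Time T z) :
    ‖mulOp μ E (fun y => stepMean T n (fun s => a s y) i) (stepMean T n z i) -
        stepMean T n (fun s => mulOp μ E (a s) (z s)) i‖ ≤
      stepMean T n (fun s => M * ‖rotheStep T n (stepMean T n z) s - z s‖) i := by
  rw [← stepMean_mulOp hT hn ha hb, ← stepMean_sub hT (integrableOn_cell_mulOp ha hb hM _)
    ((memL2Time_mulOp ha hb hM hz).integrableOn_cell hT hn hi hin)]
  have hγ : MemL2Time T fun s => M * ‖rotheStep T n (stepMean T n z) s - z s‖ :=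
    (memL2Time_sub_rotheStep hT hn hz _).norm.const_mul M
  refine norm_stepMean_le hT (hγ.integrableOn_cell hT hn hi hin) ?_
  filter_upwards [ae_restrict_mem measurableSet_cell] with s hs
  rw [← map_sub, rotheStep, (mem_cell_iff hT hn hi).1 hs]
  exact (mulOp μ E (a s)).le_of_opNorm_le (norm_mulOp_le ha.of_uncurry_left hM (hb s)) _

end MulOpTime

section Model

variable {V Y E : Type*} [NormedAddCommGroup V] [InnerProductSpace ℝ V]
  [MeasurableSpace Y] [NormedAddCommGroup E] [InnerProductSpace ℝ E]

/-- The inverse problem in a Hilbert space `V` that plays the role of `H¹(Ω)`, with embedding `ι`,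
gradient `D` and trace `tr`; the measures `μ` and `σ` stand for those in `Ω` and on `∂Ω`. -/
structure Model (V E : Type*) [NormedAddCommGroup V] [InnerProductSpace ℝ V]
    [NormedAddCommGroup E] [InnerProductSpace ℝ E] {Y : Type*} [MeasurableSpace Y]
    (μ σ : Measure Y) where
  ι : V →L[ℝ] Lp ℝ 2 μ
  D : V →L[ℝ] Lp E 2 μ
  tr : V →L[ℝ] Lp ℝ 2 σ
  η : ℝ → Y → ℝ
  κ : ℝ → Y → ℝ
  F : ℝ → ℝ
  u₀ : V
  g : ℝ → Lp ℝ 2 σ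
  dG : ℝ → Lp ℝ 2 σ
  p : ℝ → Lp ℝ 2 μ
  dm : ℝ → ℝ

namespace Model

variable {μ σ : Measure Y}

/-- `ω(t) = ∫ p(t)`. -/
noncomputable def omega (S : Model V E μ σ) (t : ℝ) : ℝ := ∫ x, S.p t x ∂μ

/-- Data with everywhere measurable and bounded coefficients. -/
structure Regular (S : Model V E μ σ) (T η₀ M : ℝ) (L : ℝ≥0) : Prop where
  norm_sq : ∀ v, ‖v‖ ^ 2 = ‖S.ι v‖ ^ 2 + ‖S.D v‖ ^ 2
  η₀_pos : 0 < η₀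
  M_nonneg : 0 ≤ M
  η_meas : Measurable (Function.uncurry S.η)
  η_lower : ∀ t y, η₀ ≤ S.η t y
  η_upper : ∀ t y, |S.η t y| ≤ M
  κ_meas : Measurable (Function.uncurry S.κ)
  κ_nonneg : ∀ t y, 0 ≤ S.κ t y
  κ_upper : ∀ t y, |S.κ t y| ≤ M
  F_lip : LipschitzWith L S.F
  g_mem : MemL2Time T S.g
  dG_mem : MemL2Time T S.dG
  p_cont : ContinuousOn S.p (Icc 0 T)
  omega_ne : ∀ t ∈ Icc 0 T, S.omega t ≠ 0
  dm_mem : MemL2Time T S.dm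

variable {S : Model V E μ σ} {T η₀ M : ℝ} {L : ℝ≥0}

theorem Regular.continuousOn_omega_inv [IsFiniteMeasure μ] (h : S.Regular T η₀ M L) :
    ContinuousOn (fun t => (S.omega t)⁻¹) (Icc 0 T) := by
  obtain ⟨I, hI⟩ := exists_integral_clm μ
  have e : S.omega = fun t => I (S.p t) := funext fun t => (hI _).symm
  refine ContinuousOn.inv₀ ?_ h.omega_ne
  rw [e]
  exact I.continuous.comp_continuousOn h.p_cont

theorem integral_mulOp {m : Y → ℝ} (hm : Measurable m) (hb : ∀ y, |m y| ≤ M) (w : Lp ℝ 2 σ) :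
    ∫ x, mulOp σ ℝ m w x ∂σ = ∫ x, m x * w x ∂σ := by
  refine integral_congr_ae ?_
  filter_upwards [mulOp_ae hm hb w] with x hx
  rw [hx, smul_eq_mul]

variable [CompleteSpace V] [CompleteSpace E]

/-- The evolution equation that results from inserting the formula for the source. -/
noncomputable def evolution (S : Model V E μ σ) : EvolutionProblem V where
  A t := leading S.ι S.D (S.η t)
  K t := stiffness S.D (S.κ t)
  f := reaction S.ι S.F
  j v := ∫ x, S.F (S.ι v x) ∂μ
  q t := (S.omega t)⁻¹ • S.ι.adjoint (S.p t)
  b t := boundaryLoad S.tr (S.η t) (S.dG t) (S.g t)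
  ν t := S.dm t - (∫ x, S.η t x * S.dG t x ∂σ) - ∫ x, S.g t x ∂σ
  u₀ := S.u₀

/-- The boundary load at step `i`. -/
noncomputable def stepLoad (S : Model V E μ σ) (T : ℝ) (n i : ℕ) : V :=
  boundaryLoad S.tr (fun x => stepMean T n (fun s => S.η s x) i) (stepMean T n S.dG i)
    (stepMean T n S.g i)

/-- The part of the source at step `i` that does not depend on the solution. -/
noncomputable def stepSource (S : Model V E μ σ) (T : ℝ) (n i : ℕ) : ℝ :=
  stepMean T n S.dm i - (∫ x, stepMean T n (fun s => S.η s x) i * stepMean T n S.dG i x ∂σ)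
    - ∫ x, stepMean T n S.g i x ∂σ

/-- The model problem satisfies the assumptions of the abstract theory. The factor of the source is
`ν - j(u)`, the bracket in the formula for `h`, and `q = p / ω` as a functional on `V`. -/
theorem Regular.exists_regular_evolution [IsFiniteMeasure μ] [IsFiniteMeasure σ]
    [SecondCountableTopology (Lp E 2 μ)] [SecondCountableTopology (Lp ℝ 2 σ)]
    (h : S.Regular T η₀ M L) :
    ∃ α M', S.evolution.Regular T α M' := by
  obtain ⟨I, hI⟩ := exists_integral_clm μ
  obtain ⟨Iσ, hIσ⟩ := exists_integral_clm σ
  have hM := h.M_nonneg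
  have hq : ContinuousOn S.evolution.q (Icc 0 T) :=
    h.continuousOn_omega_inv.smul (S.ι.adjoint.continuous.comp_continuousOn h.p_cont)
  obtain ⟨Cq, hCq⟩ := isCompact_Icc.exists_bound_of_continuousOn hq
  have hdG := memL2Time_mulOp h.η_meas h.η_upper hM h.dG_mem
  have hν : S.evolution.ν = fun t => S.dm t - Iσ (mulOp σ ℝ (S.η t) (S.dG t)) - Iσ (S.g t) := by
    funext t
    rw [hIσ, hIσ, integral_mulOp h.η_meas.of_uncurry_left (h.η_upper t)]
    rfl
  set CA := ‖S.ι.adjoint‖ * ‖S.ι‖ + ‖S.D.adjoint‖ * (M * ‖S.D‖) with hCA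
  set Cf := ‖S.ι.adjoint‖ * (L * ‖S.ι‖) with hCf
  set Cj := ‖I‖ * (L * ‖S.ι‖) with hCj
  have pA : 0 ≤ CA := by positivity
  have pf : 0 ≤ Cf := by positivity
  have pj : 0 ≤ Cj := by positivity
  have pq : 0 ≤ |Cq| := abs_nonneg _
  have hN : ∀ v w : V, ‖nemytskii μ S.F (S.ι v) - nemytskii μ S.F (S.ι w)‖ ≤
      (L * ‖S.ι‖) * ‖v - w‖ := fun v w => by
    refine (norm_nemytskii_sub_le h.F_lip _ _).trans ?_
    rw [← map_sub, mul_assoc]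
    gcongr
    exact S.ι.le_opNorm _
  refine ⟨min 1 η₀, CA + Cf + Cj + |Cq|, ?_⟩
  exact
    { α_pos := lt_min one_pos h.η₀_pos
      M_nonneg := by positivity
      A_meas := fun w => stronglyMeasurable_leading h.η_meas h.η_upper w
      K_meas := fun w => stronglyMeasurable_stiffness h.κ_meas h.κ_upper w
      A_bound := fun t =>
        (norm_leading_le hM h.η_meas.of_uncurry_left (h.η_upper t)).trans (by linarith)
      K_bound := fun t => (norm_stiffness_le hM h.κ_meas.of_uncurry_left (h.κ_upper t)).trans (by
        have : 0 ≤ ‖S.ι.adjoint‖ * ‖S.ι‖ := by positivity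
        linarith)
      coercive := fun t v =>
        leading_coercive h.norm_sq h.η_meas.of_uncurry_left (h.η_upper t) (h.η_lower t) v
      f_lip := fun v w => by
        change ‖S.ι.adjoint _ - S.ι.adjoint _‖ ≤ _
        rw [← map_sub]
        refine ((S.ι.adjoint.le_opNorm _).trans (mul_le_mul_of_nonneg_left (hN v w)
          (norm_nonneg _))).trans ?_
        rw [← mul_assoc, ← hCf]
        gcongr
        linarith
      j_lip := fun v w => by
        have e : ∀ v, S.evolution.j v = I (nemytskii μ S.F (S.ι v)) := fun v => by
          rw [hI]
          exact (integral_congr_ae (nemytskii_ae h.F_lip _)).symm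
        rw [e, e, ← map_sub, ← Real.norm_eq_abs]
        refine ((I.le_opNorm _).trans (mul_le_mul_of_nonneg_left (hN v w) (norm_nonneg _))).trans ?_
        rw [← mul_assoc, ← hCj]
        gcongr
        linarith
      q_cont := hq
      q_bound := fun t ht => (hCq t ht).trans ((le_abs_self _).trans (by linarith))
      b_mem := S.tr.adjoint.comp_memLp' (hdG.add h.g_mem)
      ν_mem := by
        rw [hν]
        exact (h.dm_mem.sub (Iσ.comp_memLp' hdG)).sub (Iσ.comp_memLp' h.g_mem) }

/-- The step data are consistent with the means of the data of the evolution equation. -/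
theorem Regular.exists_step_error [IsFiniteMeasure σ] [SecondCountableTopology (Lp ℝ 2 σ)]
    (hT : 0 < T) (h : S.Regular T η₀ M L) :
    ∃ γ : ℕ → ℝ → ℝ, (∀ n, MemL2Time T (γ n)) ∧ L2Null T γ ∧
      (∀ n, 1 ≤ n → ∀ i, 1 ≤ i → i ≤ n →
        ‖S.stepLoad T n i - stepMean T n S.evolution.b i‖ ≤ stepMean T n (γ n) i) ∧
      ∀ n, 1 ≤ n → ∀ i, 1 ≤ i → i ≤ n →
        |S.stepSource T n i - stepMean T n S.evolution.ν i| ≤ stepMean T n (γ n) i := by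
  obtain ⟨Iσ, hIσ⟩ := exists_integral_clm σ
  have hM := h.M_nonneg
  have hdG := memL2Time_mulOp h.η_meas h.η_upper hM h.dG_mem
  have hν : S.evolution.ν = fun t => S.dm t - Iσ (mulOp σ ℝ (S.η t) (S.dG t)) - Iσ (S.g t) := by
    funext t
    rw [hIσ, hIσ, integral_mulOp h.η_meas.of_uncurry_left (h.η_upper t)]
    rfl
  set C := ‖S.tr.adjoint‖ + ‖Iσ‖ with hC
  set ρ : ℕ → ℝ → ℝ := fun n s => M * ‖rotheStep T n (stepMean T n S.dG) s - S.dG s‖ with hρ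
  have hρm : ∀ n, MemL2Time T (ρ n) := fun n =>
    (memL2Time_rotheStep_sub hT n h.dG_mem _).norm.const_mul M
  have hle : ∀ n, 1 ≤ n → ∀ i, 1 ≤ i → i ≤ n →
      ‖mulOp σ ℝ (fun y => stepMean T n (fun s => S.η s y) i) (stepMean T n S.dG i) -
        stepMean T n (fun s => mulOp σ ℝ (S.η s) (S.dG s)) i‖ ≤ stepMean T n (ρ n) i :=
    fun n hn i hi hin => norm_mulOp_stepMean_sub_le hT hn hi hin h.η_meas h.η_upper hM h.dG_mem
  have hmean : ∀ n, 1 ≤ n → ∀ i, 1 ≤ i → i ≤ n →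
      stepMean T n (fun s => C * ρ n s) i = C * stepMean T n (ρ n) i := fun n hn i hi hin =>
    stepMean_clm hT (C • (1 : ℝ →L[ℝ] ℝ)) ((hρm n).integrableOn_cell hT hn hi hin)
  refine ⟨fun n s => C * ρ n s, fun n => (hρm n).const_mul C,
    ((l2Null_stepMean_sub hT h.dG_mem).norm.const_mul M).const_mul C, fun n hn i hi hin => ?_,
    fun n hn i hi hin => ?_⟩
  · have iG := hdG.integrableOn_cell hT hn hi hin
    have ig := h.g_mem.integrableOn_cell hT hn hi hin
    have e : stepMean T n S.evolution.b i =
        S.tr.adjoint (stepMean T n (fun s => mulOp σ ℝ (S.η s) (S.dG s)) i + stepMean T n S.g i) := by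
      rw [← stepMean_add hT iG ig]
      exact stepMean_clm hT S.tr.adjoint (iG.add ig)
    rw [e, stepLoad, boundaryLoad, ← map_sub, add_sub_add_right_eq_sub, hmean n hn i hi hin]
    refine (S.tr.adjoint.le_opNorm _).trans (mul_le_mul ?_ (hle n hn i hi hin) (norm_nonneg _)
      (by positivity))
    exact le_add_of_nonneg_right (norm_nonneg _)
  · have iG := hdG.integrableOn_cell hT hn hi hin
    have ig := h.g_mem.integrableOn_cell hT hn hi hin
    have im := h.dm_mem.integrableOn_cell hT hn hi hin
    have iG' : IntegrableOn (fun s => Iσ (mulOp σ ℝ (S.η s) (S.dG s))) (cell T n i) :=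
      Iσ.integrable_comp iG
    have ig' : IntegrableOn (fun s => Iσ (S.g s)) (cell T n i) := Iσ.integrable_comp ig
    have im' : IntegrableOn (fun s => S.dm s - Iσ (mulOp σ ℝ (S.η s) (S.dG s))) (cell T n i) :=
      im.sub iG'
    rw [hν, stepMean_sub hT im' ig', stepMean_sub hT im iG', stepMean_clm hT Iσ iG,
      stepMean_clm hT Iσ ig, stepSource, ← integral_mulOp (measurable_stepMean hT h.η_meas)
        (abs_stepMean_le hT hn h.η_upper), ← hIσ, ← hIσ, hmean n hn i hi hin,
      sub_sub_sub_cancel_right, sub_sub_sub_cancel_left, ← map_sub, ← Real.norm_eq_abs,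
      ← norm_neg, ← map_neg, neg_sub]
    refine (Iσ.le_opNorm _).trans (mul_le_mul ?_ (hle n hn i hi hin) (norm_nonneg _)
      (by positivity))
    exact le_add_of_nonneg_left (norm_nonneg _)

end Model

end Model

end PseudoParabolic

/-! ### Solutions of the model problem -/

namespace PseudoParabolic

open scoped ENNReal NNReal

section Model

variable {V Y E : Type*} [NormedAddCommGroup V] [InnerProductSpace ℝ V] [CompleteSpace V]
  [MeasurableSpace Y] [NormedAddCommGroup E] [InnerProductSpace ℝ E] [CompleteSpace E]
  {μ σ : Measure Y}

namespace Model

/-- Weak solutions `{u, h}` of the model problem, with `∂ₜu = du`. -/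
structure IsWeakSolution (S : Model V E μ σ) (T : ℝ) (u du : ℝ → V) (h : ℝ → ℝ) : Prop where
  u_cont : ContinuousOn u (Icc 0 T)
  du_mem : MemL2Time T du
  du_deriv : HasWeakTimeDeriv T u du
  h_mem : MemL2Time T h
  initial : u 0 = S.u₀
  h_eq : ∀ᵐ t ∂(volume.restrict (Ioo 0 T)),
    h t = (S.omega t)⁻¹ * (S.evolution.ν t - S.evolution.j (u t))
  u_eq : ∀ᵐ t ∂(volume.restrict (Ioo 0 T)), leading S.ι S.D (S.η t) (du t)
    + stiffness S.D (S.κ t) (u t) = reaction S.ι S.F (u t)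
      + boundaryLoad S.tr (S.η t) (S.dG t) (S.g t) + h t • S.ι.adjoint (S.p t)

/-- The semi-implicit time-discrete problem for the model. -/
structure IsRotheScheme (S : Model V E μ σ) (T : ℝ) (n : ℕ) (U : ℕ → V) (H : ℕ → ℝ) : Prop where
  initial : U 0 = S.u₀
  source : ∀ i, 1 ≤ i → i ≤ n →
    H i = (S.omega (i * (T / n)))⁻¹ * (S.stepSource T n i - S.evolution.j (U (i - 1)))
  step : ∀ i, 1 ≤ i → i ≤ n →
    leading S.ι S.D (fun x => stepMean T n (fun s => S.η s x) i) (backwardDiff T n U i)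
      + stiffness S.D (fun x => stepMean T n (fun s => S.κ s x) i) (U i)
    = reaction S.ι S.F (U (i - 1)) + S.stepLoad T n i + H i • S.ι.adjoint (S.p (i * (T / n)))

variable {S : Model V E μ σ} {T η₀ M : ℝ} {L : ℝ≥0}

theorem smul_evolution_q (t c : ℝ) :
    c • S.evolution.q t = ((S.omega t)⁻¹ * c) • S.ι.adjoint (S.p t) := by
  rw [mul_comm, mul_smul]
  rfl

/-- Elimination of `h` turns a weak solution into a solution of the evolution equation. -/
theorem IsWeakSolution.isSolution (hT : 0 < T) {u du : ℝ → V} {h : ℝ → ℝ}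
    (hs : S.IsWeakSolution T u du h) : S.evolution.IsSolution T u du where
  cont := hs.u_cont
  mem := hs.du_mem
  integral_eq t ht := by
    rw [hs.du_deriv.eq_integral hT hs.u_cont (MemLp.integrable (by norm_num) hs.du_mem) t ht,
      hs.initial]
    rfl
  eqn := by
    filter_upwards [hs.h_eq, hs.u_eq] with t h1 h2
    rw [EvolutionProblem.rhs, smul_evolution_q, ← h1]
    exact h2

/-- Elimination of the `h_i` turns the discrete problem into the semi-implicit scheme for the evolution
equation; the averaged coefficients give the averaged operators. -/
theorem IsRotheScheme.isScheme [SFinite μ] [SecondCountableTopology (Lp E 2 μ)] (hT : 0 < T)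
    (h : S.Regular T η₀ M L) {n : ℕ} (hn : 1 ≤ n) {U : ℕ → V} {H : ℕ → ℝ}
    (hs : S.IsRotheScheme T n U H) :
    S.evolution.IsScheme T n (S.stepLoad T n) (S.stepSource T n) U where
  initial := hs.initial
  step i hi hin := by
    rw [smul_evolution_q, ← hs.source i hi hin]
    refine Eq.trans ?_ (hs.step i hi hin)
    rw [← stepMean_leading hT hn h.η_meas h.η_upper h.M_nonneg,
      ← stepMean_stiffness hT hn h.κ_meas h.κ_upper h.M_nonneg]
    rfl

theorem isRotheScheme_of_isScheme [SFinite μ] [SecondCountableTopology (Lp E 2 μ)] (hT : 0 < T)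
    (h : S.Regular T η₀ M L) {n : ℕ} (hn : 1 ≤ n) {U : ℕ → V}
    (hs : S.evolution.IsScheme T n (S.stepLoad T n) (S.stepSource T n) U) :
    S.IsRotheScheme T n U fun i =>
      (S.omega (i * (T / n)))⁻¹ * (S.stepSource T n i - S.evolution.j (U (i - 1))) where
  initial := hs.initial
  source _ _ _ := rfl
  step i hi hin := by
    rw [← smul_evolution_q, ← stepMean_leading hT hn h.η_meas h.η_upper h.M_nonneg,
      ← stepMean_stiffness hT hn h.κ_meas h.κ_upper h.M_nonneg]
    exact hs.step i hi hin

variable [IsFiniteMeasure μ] [IsFiniteMeasure σ] [SecondCountableTopology (Lp E 2 μ)]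
  [SecondCountableTopology (Lp ℝ 2 σ)]

theorem Regular.exists_unique_weakSolution (hT : 0 < T) (h : S.Regular T η₀ M L) :
    ∃ u du hh, S.IsWeakSolution T u du hh ∧ ∀ u₂ du₂ h₂, S.IsWeakSolution T u₂ du₂ h₂ →
      (∀ t ∈ Icc 0 T, u₂ t = u t) ∧ (∀ᵐ t ∂(volume.restrict (Ioo 0 T)), du₂ t = du t) ∧
      ∀ᵐ t ∂(volume.restrict (Ioo 0 T)), h₂ t = hh t := by
  obtain ⟨α, M', hP⟩ := h.exists_regular_evolution
  obtain ⟨u, du, hs, huniq⟩ := hP.exists_unique_solution hT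
  have hw : S.IsWeakSolution T u du
      fun t => (S.omega t)⁻¹ * (S.evolution.ν t - S.evolution.j (u t)) :=
    { u_cont := hs.cont
      du_mem := hs.mem
      du_deriv := hasWeakTimeDeriv_of_eq_integral hT (MemLp.integrable (by norm_num) hs.mem)
        fun t ht => hs.integral_eq t (Ioo_subset_Icc_self ht)
      h_mem := MemL2Time.continuousOn_mul h.continuousOn_omega_inv (hP.memL2Time_ν_sub hs.cont)
      initial := by
        rw [hs.integral_eq 0 ⟨le_rfl, hT.le⟩, intervalIntegral.integral_same, add_zero]
        rfl
      h_eq := .of_forall fun _ => rfl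
      u_eq := by
        filter_upwards [hs.eqn] with t h1
        rw [EvolutionProblem.rhs, smul_evolution_q] at h1
        exact h1 }
  refine ⟨u, du, _, hw, fun u₂ du₂ h₂ hw₂ => ?_⟩
  obtain ⟨h1, h2⟩ := huniq u₂ du₂ (hw₂.isSolution hT)
  refine ⟨h1, h2, ?_⟩
  filter_upwards [hw₂.h_eq, ae_restrict_mem measurableSet_Ioo] with t h3 h4
  rw [h3, h1 t (Ioo_subset_Icc_self h4)]

theorem Regular.exists_unique_rotheScheme (hT : 0 < T) (h : S.Regular T η₀ M L) {n : ℕ}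
    (hn : 1 ≤ n) :
    ∃ U H, S.IsRotheScheme T n U H ∧ ∀ U₂ H₂, S.IsRotheScheme T n U₂ H₂ →
      (∀ i ≤ n, U₂ i = U i) ∧ ∀ i, 1 ≤ i → i ≤ n → H₂ i = H i := by
  obtain ⟨α, M', hP⟩ := h.exists_regular_evolution
  obtain ⟨U, hU, huniq⟩ := hP.exists_unique_scheme hT (fun t v =>
    stiffness_nonneg h.κ_meas.of_uncurry_left (h.κ_upper t) (h.κ_nonneg t) v) hn
    (S.stepLoad T n) (S.stepSource T n)
  refine ⟨U, _, isRotheScheme_of_isScheme hT h hn hU, fun U₂ H₂ hs₂ => ?_⟩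
  have h1 := huniq U₂ (hs₂.isScheme hT h hn)
  refine ⟨h1, fun i hi hin => ?_⟩
  rw [hs₂.source i hi hin, h1 (i - 1) (by omega)]

/-- Strong convergence of the Rothe functions. -/
theorem Regular.rothe_convergence (hT : 0 < T) (h : S.Regular T η₀ M L) {u du : ℝ → V} {hh : ℝ → ℝ}
    (hs : S.IsWeakSolution T u du hh) {U : ℕ → ℕ → V} {H : ℕ → ℕ → ℝ}
    (hU : ∀ n, 1 ≤ n → S.IsRotheScheme T n (U n) (H n)) :
    (∀ ε : ℝ, 0 < ε → ∀ᶠ n : ℕ in atTop, ∀ t ∈ Icc 0 T,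
      ‖rotheStep T n (U n) t - u t‖ ≤ ε ∧ ‖rotheLinear T n (U n) t - u t‖ ≤ ε) ∧
    L2Null T (fun n s => rotheStep T n (backwardDiff T n (U n)) s - du s) ∧
    L2Null T (fun n s => rotheStep T n (H n) s - hh s) := by
  obtain ⟨α, M', hP⟩ := h.exists_regular_evolution
  obtain ⟨γ, hγ, hγ0, hb, hν⟩ := h.exists_step_error hT
  obtain ⟨h1, h2, h3⟩ := hP.scheme_convergence hT (hs.isSolution hT) hγ hγ0
    (fun n hn => (hU n hn).isScheme hT h hn) hb hν
  refine ⟨fun ε hε => eventually_norm_rothe_sub_le hT hs.u_cont h1 hε, h2, ?_⟩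
  refine (h3.mul_node hT h.continuousOn_omega_inv (hP.memL2Time_ν_sub hs.u_cont)).mono ?_
  filter_upwards [eventually_ge_atTop 1] with n hn
  filter_upwards [hs.h_eq, ae_restrict_mem measurableSet_Ioo] with s h4 h5
  obtain ⟨hi, hin⟩ := Finset.mem_Icc.1 (stepIndex_mem hT hn (Ioo_subset_Ioc_self h5))
  rw [h4]
  simp only [rotheStep]
  rw [(hU n hn).source _ hi hin]

end Model

end Model

end PseudoParabolic

/-! ### Realisation in `H¹(Ω)` -/

namespace PseudoParabolic

open scoped ENNReal NNReal

section Versions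

/-- A coefficient that is almost everywhere in `[c, C]` has a version that is measurable and bounded
everywhere. -/
theorem exists_bounded_version {Y : Type*} [MeasurableSpace Y] {ρ : Measure (ℝ × Y)}
    {a : ℝ → Y → ℝ} (ha : AEMeasurable (fun z : ℝ × Y => a z.1 z.2) ρ) {c C : ℝ} (hc : 0 < c)
    (hb : ∀ᵐ z ∂ρ, c ≤ a z.1 z.2 ∧ a z.1 z.2 ≤ C) :
    ∃ a' : ℝ → Y → ℝ, Measurable (Function.uncurry a') ∧ (∀ t y, c ≤ a' t y) ∧
      (∀ t y, |a' t y| ≤ max c C) ∧ ∀ᵐ z ∂ρ, a z.1 z.2 = a' z.1 z.2 := by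
  have hle : ∀ r : ℝ, c ≤ max c (min r C) := fun r => le_max_left _ _
  refine ⟨fun t y => max c (min (ha.mk _ (t, y)) C), ?_, fun t y => hle _, fun t y => ?_, ?_⟩
  · exact measurable_const.max (ha.measurable_mk.min measurable_const)
  · rw [abs_of_nonneg (hc.le.trans (hle _))]
    exact max_le_max_left _ (min_le_right _ _)
  · filter_upwards [hb, ha.ae_eq_mk] with z h1 h2
    simp only [Prod.mk.eta]
    rw [← h2, min_eq_left h1.2, max_eq_right h1.1]

variable {d : ℕ} {Ω : Set (Space d)} {T : ℝ}

theorem ae_closureMeasure_iff {q : Space d → Prop} :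
    (∀ᵐ x ∂(closureMeasure Ω), q x) ↔
      (∀ᵐ x ∂(volume.restrict Ω), q x) ∧ ∀ᵐ x ∂(surface Ω), q x := by
  rw [closureMeasure, ae_add_measure_iff]

theorem ae_ae_of_version [SFinite (closureMeasure Ω)] {a a' : ℝ → Space d → ℝ}
    (h : ∀ᵐ z ∂((volume.restrict (Ioo 0 T)).prod (closureMeasure Ω)), a z.1 z.2 = a' z.1 z.2) :
    ∀ᵐ t ∂(volume.restrict (Ioo 0 T)), ∀ᵐ x ∂(closureMeasure Ω), a t x = a' t x :=
  Measure.ae_ae_of_ae_prod h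

theorem ae_stepMean_eq_of_version [SFinite (closureMeasure Ω)] (hT : 0 < T)
    {a a' : ℝ → Space d → ℝ}
    (h : ∀ᵐ z ∂((volume.restrict (Ioo 0 T)).prod (closureMeasure Ω)), a z.1 z.2 = a' z.1 z.2)
    {n i : ℕ} (hn : 1 ≤ n) (hi : 1 ≤ i) (hin : i ≤ n) :
    ∀ᵐ x ∂(closureMeasure Ω),
      stepMean T n (fun s => a s x) i = stepMean T n (fun s => a' s x) i := by
  have h1 : ∀ᵐ z ∂((closureMeasure Ω).prod (volume.restrict (Ioo 0 T))),
      a z.2 z.1 = a' z.2 z.1 :=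
    Measure.measurePreserving_swap.quasiMeasurePreserving.ae h
  filter_upwards [Measure.ae_ae_of_ae_prod h1] with x hx
  exact stepMean_congr_ae hT (ae_cell_of_ae hT hn hi hin hx)

theorem sourceValue_congr {F : ℝ → ℝ} {om dm : ℝ} {e e' : Space d → ℝ} {dG g : L2Bdry Ω} {v : H1 Ω}
    (h : ∀ᵐ x ∂(surface Ω), e x = e' x) :
    sourceValue F om dm e dG g v = sourceValue F om dm e' dG g v := by
  rw [sourceValue, sourceValue]
  congr 4
  refine integral_congr_ae ?_
  filter_upwards [h] with x hx
  rw [hx]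

theorem variationalEq_congr {F : ℝ → ℝ} {e e' k k' : Space d → ℝ} {dG g : L2Bdry Ω} {p : L2 Ω}
    {h : ℝ} {w v z : H1 Ω} (he : ∀ᵐ x ∂(closureMeasure Ω), e x = e' x)
    (hk : ∀ᵐ x ∂(closureMeasure Ω), k x = k' x) :
    VariationalEq F e k dG g p h w v z ↔ VariationalEq F e' k' dG g p h w v z := by
  rw [ae_closureMeasure_iff] at he hk
  refine forall_congr' fun φ => ?_
  have h1 : ∫ x in Ω, e x * ⟪wgrad w x, wgrad φ x⟫_ℝ =
      ∫ x in Ω, e' x * ⟪wgrad w x, wgrad φ x⟫_ℝ := by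
    refine integral_congr_ae ?_
    filter_upwards [he.1] with x hx
    rw [hx]
  have h2 : ∫ x in Ω, k x * ⟪wgrad v x, wgrad φ x⟫_ℝ =
      ∫ x in Ω, k' x * ⟪wgrad v x, wgrad φ x⟫_ℝ := by
    refine integral_congr_ae ?_
    filter_upwards [hk.1] with x hx
    rw [hx]
  have h3 : ∫ x, e x * dG x * trace φ x ∂(surface Ω) =
      ∫ x, e' x * dG x * trace φ x ∂(surface Ω) := by
    refine integral_congr_ae ?_
    filter_upwards [he.2] with x hx
    rw [hx]
  rw [h1, h2, h3]

end Versions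

section Realisation

variable {d : ℕ} {Ω : Set (Space d)}

/-- The embedding `H¹(Ω) → L²(Ω)` as a bounded operator. -/
noncomputable def toL2L (Ω : Set (Space d)) : H1 Ω →L[ℝ] L2 Ω :=
  LinearMap.mkContinuous
    { toFun := toL2
      map_add' := fun _ _ => rfl
      map_smul' := fun _ _ => rfl } 1 fun v => by rw [one_mul]; exact norm_toL2_le v

/-- The weak gradient as a bounded operator. -/
noncomputable def wgradL (Ω : Set (Space d)) : H1 Ω →L[ℝ] L2Vec Ω :=
  LinearMap.mkContinuous
    { toFun := wgrad
      map_add' := fun _ _ => rfl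
      map_smul' := fun _ _ => rfl } 1 fun v => by rw [one_mul]; exact norm_wgrad_le v

theorem toL2L_apply (v : H1 Ω) : toL2L Ω v = toL2 v := rfl

theorem wgradL_apply (v : H1 Ω) : wgradL Ω v = wgrad v := rfl

theorem norm_sq_H1 (v : H1 Ω) : ‖v‖ ^ 2 = ‖toL2L Ω v‖ ^ 2 + ‖wgradL Ω v‖ ^ 2 :=
  WithLp.prod_norm_sq_eq_of_L2 v.1

/-- The inverse problem with coefficients `η`, `κ` in place of those of the data, as an instance of
the model problem. -/
noncomputable def Data.model (D : Data Ω) (tr : H1 Ω →L[ℝ] L2Bdry Ω) (η κ : ℝ → Space d → ℝ) :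
    Model (H1 Ω) (Space d) (volume.restrict Ω) (surface Ω) where
  ι := toL2L Ω
  D := wgradL Ω
  tr := tr
  η := η
  κ := κ
  F := D.F
  u₀ := D.u₀
  g := D.g
  dG := D.dG
  p := D.p
  dm := D.dm

theorem variationalEq_iff [IsFiniteMeasure (volume.restrict Ω)] {tr : H1 Ω →L[ℝ] L2Bdry Ω}
    (htr : ∀ v, tr v = trace v) {F : ℝ → ℝ} {L : ℝ≥0} (hF : LipschitzWith L F)
    {e k : Space d → ℝ} {M : ℝ}
    (he : Measurable e) (heb : ∀ x, |e x| ≤ M) (hk : Measurable k) (hkb : ∀ x, |k x| ≤ M)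
    (dG g : L2Bdry Ω) (p : L2 Ω) (h : ℝ) (w v z : H1 Ω) :
    VariationalEq F e k dG g p h w v z ↔
      leading (toL2L Ω) (wgradL Ω) e w + stiffness (wgradL Ω) k v =
        reaction (toL2L Ω) F z + boundaryLoad tr e dG g + h • (toL2L Ω).adjoint p := by
  rw [← variational_iff (tr := tr) hF he heb hk hkb]
  simp only [VariationalEq, htr, toL2L_apply, wgradL_apply]

/-- `η`, `κ` are bounded measurable versions of the coefficients of the data. -/
structure Data.IsVersion (D : Data Ω) (T M : ℝ) (η κ : ℝ → Space d → ℝ) : Prop where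
  η_meas : Measurable (Function.uncurry η)
  η_upper : ∀ t x, |η t x| ≤ M
  κ_meas : Measurable (Function.uncurry κ)
  κ_upper : ∀ t x, |κ t x| ≤ M
  η_eq : ∀ᵐ z ∂((volume.restrict (Ioo 0 T)).prod (closureMeasure Ω)), D.η z.1 z.2 = η z.1 z.2
  κ_eq : ∀ᵐ z ∂((volume.restrict (Ioo 0 T)).prod (closureMeasure Ω)), D.κ z.1 z.2 = κ z.1 z.2

/-- Admissible data give a model problem with coefficients bounded everywhere. -/
theorem Data.Admissible.exists_model {D : Data Ω} {T : ℝ} (hD : D.Admissible T)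
    (tr : H1 Ω →L[ℝ] L2Bdry Ω) :
    ∃ (η κ : ℝ → Space d → ℝ) (η₀ M : ℝ) (L : ℝ≥0), D.IsVersion T M η κ ∧
      LipschitzWith L D.F ∧ (D.model tr η κ).Regular T η₀ M L := by
  obtain ⟨η₀, η₁, hη₀, hηb⟩ := hD.η_bound
  obtain ⟨κ₀, κ₁, hκ₀, hκb⟩ := hD.κ_bound
  obtain ⟨L, hL⟩ := hD.F_lipschitz
  obtain ⟨dg, hg⟩ := hD.g_mem
  obtain ⟨η, h1, h2, h3, h4⟩ := exists_bounded_version hD.η_meas hη₀ hηb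
  obtain ⟨κ, k1, k2, k3, k4⟩ := exists_bounded_version hD.κ_meas hκ₀ hκb
  have hη3 : ∀ t x, |η t x| ≤ max (max η₀ η₁) (max κ₀ κ₁) :=
    fun t x => (h3 t x).trans (le_max_left _ _)
  have hκ3 : ∀ t x, |κ t x| ≤ max (max η₀ η₁) (max κ₀ κ₁) :=
    fun t x => (k3 t x).trans (le_max_right _ _)
  refine ⟨η, κ, η₀, max (max η₀ η₁) (max κ₀ κ₁), L, ⟨h1, hη3, k1, hκ3, h4, k4⟩, hL, ?_⟩
  exact
    { norm_sq := norm_sq_H1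
      η₀_pos := hη₀
      M_nonneg := hη₀.le.trans ((le_max_left _ _).trans (le_max_left _ _))
      η_meas := h1
      η_lower := h2
      η_upper := hη3
      κ_meas := k1
      κ_nonneg := fun t x => hκ₀.le.trans (k2 t x)
      κ_upper := hκ3
      F_lip := hL
      g_mem := hg.mem
      dG_mem := hD.G_mem.mem_deriv
      p_cont := hD.p_cont
      omega_ne := hD.omega_ne
      dm_mem := hD.m_mem.mem_deriv }

variable [IsFiniteMeasure (volume.restrict Ω)] [SFinite (closureMeasure Ω)] {D : Data Ω} {T M : ℝ}
  {η κ : ℝ → Space d → ℝ} {tr : H1 Ω →L[ℝ] L2Bdry Ω} {L : ℝ≥0}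

/-- Replacing the coefficients by versions does not affect the notion of weak solution. -/
theorem Data.IsVersion.isWeakSolution_iff (hv : D.IsVersion T M η κ)
    (htr : ∀ v, tr v = trace v) (hF : LipschitzWith L D.F) {u du : ℝ → H1 Ω} {h : ℝ → ℝ} :
    D.IsWeakSolution T u du h ↔ (D.model tr η κ).IsWeakSolution T u du h := by
  have hη := ae_ae_of_version hv.η_eq
  have hκ := ae_ae_of_version hv.κ_eq
  have e1 : ∀ᵐ t ∂(volume.restrict (Ioo 0 T)),
      (h t = sourceValue D.F (D.omega t) (D.dm t) (D.η t) (D.dG t) (D.g t) (u t) ↔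
        h t = ((D.model tr η κ).omega t)⁻¹ *
          ((D.model tr η κ).evolution.ν t - (D.model tr η κ).evolution.j (u t))) := by
    filter_upwards [hη] with t ht
    rw [sourceValue_congr (ae_closureMeasure_iff.1 ht).2, sourceValue, one_div]
    rfl
  have e2 : ∀ᵐ t ∂(volume.restrict (Ioo 0 T)),
      (VariationalEq D.F (D.η t) (D.κ t) (D.dG t) (D.g t) (D.p t) (h t) (du t) (u t) (u t) ↔
        leading (toL2L Ω) (wgradL Ω) (η t) (du t) + stiffness (wgradL Ω) (κ t) (u t) =
          reaction (toL2L Ω) D.F (u t) + boundaryLoad tr (η t) (D.dG t) (D.g t)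
            + h t • (toL2L Ω).adjoint (D.p t)) := by
    filter_upwards [hη, hκ] with t ht1 ht2
    exact (variationalEq_congr ht1 ht2).trans (variationalEq_iff htr hF
      hv.η_meas.of_uncurry_left (hv.η_upper t) hv.κ_meas.of_uncurry_left (hv.κ_upper t) _ _ _ _ _ _ _)
  constructor
  · intro hs
    exact
      { u_cont := hs.u_cont
        du_mem := hs.du_mem
        du_deriv := hs.du_deriv
        h_mem := hs.h_mem
        initial := hs.initial
        h_eq := by filter_upwards [e1, hs.h_eq] with t h1 h2 using h1.1 h2
        u_eq := by filter_upwards [e2, hs.u_eq] with t h1 h2 using h1.1 h2 }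
  · intro hs
    exact
      { u_cont := hs.u_cont
        du_mem := hs.du_mem
        du_deriv := hs.du_deriv
        h_mem := hs.h_mem
        initial := hs.initial
        h_eq := by filter_upwards [e1, hs.h_eq] with t h1 h2 using h1.2 h2
        u_eq := by filter_upwards [e2, hs.u_eq] with t h1 h2 using h1.2 h2 }

/-- Replacing the coefficients by versions does not affect the discrete problem: by Fubini, their
averages over the time cells agree almost everywhere. -/
theorem Data.IsVersion.isRotheScheme_iff (hv : D.IsVersion T M η κ) (hT : 0 < T)
    (htr : ∀ v, tr v = trace v) (hF : LipschitzWith L D.F) {n : ℕ} (hn : 1 ≤ n) {U : ℕ → H1 Ω}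
    {H : ℕ → ℝ} : D.IsRotheScheme T n U H ↔ (D.model tr η κ).IsRotheScheme T n U H := by
  have e1 : ∀ i, 1 ≤ i → i ≤ n →
      (H i = sourceValue D.F (D.omega (i * (T / n))) (stepMean T n D.dm i)
        (fun x => stepMean T n (fun s => D.η s x) i) (stepMean T n D.dG i) (stepMean T n D.g i)
        (U (i - 1)) ↔
      H i = ((D.model tr η κ).omega (i * (T / n)))⁻¹ *
        ((D.model tr η κ).stepSource T n i - (D.model tr η κ).evolution.j (U (i - 1)))) := by
    intro i hi hin
    rw [sourceValue_congr
      (ae_closureMeasure_iff.1 (ae_stepMean_eq_of_version hT hv.η_eq hn hi hin)).2, sourceValue,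
      one_div]
    rfl
  have e2 : ∀ i, 1 ≤ i → i ≤ n →
      (VariationalEq D.F (fun x => stepMean T n (fun s => D.η s x) i)
        (fun x => stepMean T n (fun s => D.κ s x) i) (stepMean T n D.dG i) (stepMean T n D.g i)
        (D.p (i * (T / n))) (H i) (backwardDiff T n U i) (U i) (U (i - 1)) ↔
      leading (toL2L Ω) (wgradL Ω) (fun x => stepMean T n (fun s => η s x) i) (backwardDiff T n U i)
        + stiffness (wgradL Ω) (fun x => stepMean T n (fun s => κ s x) i) (U i) =
      reaction (toL2L Ω) D.F (U (i - 1)) + boundaryLoad tr (fun x => stepMean T n (fun s => η s x) i)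
          (stepMean T n D.dG i) (stepMean T n D.g i)
        + H i • (toL2L Ω).adjoint (D.p (i * (T / n)))) := by
    intro i hi hin
    exact (variationalEq_congr (ae_stepMean_eq_of_version hT hv.η_eq hn hi hin)
      (ae_stepMean_eq_of_version hT hv.κ_eq hn hi hin)).trans (variationalEq_iff htr hF
        (measurable_stepMean hT hv.η_meas) (abs_stepMean_le hT hn hv.η_upper)
        (measurable_stepMean hT hv.κ_meas) (abs_stepMean_le hT hn hv.κ_upper) _ _ _ _ _ _ _)
  constructor
  · intro hs
    exact
      { initial := hs.initial
        source := fun i hi hin => (e1 i hi hin).1 (hs.source i hi hin)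
        step := fun i hi hin => (e2 i hi hin).1 (hs.step i hi hin) }
  · intro hs
    exact
      { initial := hs.initial
        source := fun i hi hin => (e1 i hi hin).2 (hs.source i hi hin)
        step := fun i hi hin => (e2 i hi hin).2 (hs.step i hi hin) }

end Realisation

theorem IsBoundedLipschitz.isFiniteMeasure_restrict {d : ℕ} {Ω : Set (Space d)}
    (hΩ : IsBoundedLipschitz Ω) : IsFiniteMeasure (volume.restrict Ω) :=
  ⟨by rw [Measure.restrict_apply_univ]; exact hΩ.isBounded.measure_lt_top⟩

/-- Strong convergence of the Rothe functions implies all the convergences asserted for them. -/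
theorem rotheConverges_of_strong {d : ℕ} {Ω : Set (Space d)} {T : ℝ} (hT : 0 < T)
    {U : ℕ → ℕ → H1 Ω} {H : ℕ → ℕ → ℝ} {u du : ℝ → H1 Ω} {h : ℝ → ℝ} (hdu : MemL2Time T du)
    (hh : MemL2Time T h)
    (h1 : ∀ ε : ℝ, 0 < ε → ∀ᶠ n : ℕ in atTop, ∀ t ∈ Icc 0 T,
      ‖rotheStep T n (U n) t - u t‖ ≤ ε ∧ ‖rotheLinear T n (U n) t - u t‖ ≤ ε)
    (h2 : L2Null T fun n s => rotheStep T n (backwardDiff T n (U n)) s - du s)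
    (h3 : L2Null T fun n s => rotheStep T n (H n) s - h s) : RotheConverges T U H u du h where
  uniform_L2 := by
    rw [Metric.tendstoUniformlyOn_iff]
    intro ε hε
    filter_upwards [h1 (ε / 2) (by positivity)] with n hn t ht
    rw [dist_comm, dist_eq_norm, ← toL2L_apply, ← toL2L_apply, ← map_sub]
    exact ((norm_toL2_le _).trans (hn t ht).2).trans_lt (by linarith)
  linear_weak t ht φ := by
    have : Tendsto (fun n => rotheLinear T n (U n) t) atTop (𝓝 (u t)) := by
      rw [Metric.tendsto_nhds]
      intro ε hε
      filter_upwards [h1 (ε / 2) (by positivity)] with n hn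
      rw [dist_eq_norm]
      linarith [(hn t ht).2]
    exact this.inner tendsto_const_nhds
  step_weak t ht φ := by
    have : Tendsto (fun n => rotheStep T n (U n) t) atTop (𝓝 (u t)) := by
      rw [Metric.tendsto_nhds]
      intro ε hε
      filter_upwards [h1 (ε / 2) (by positivity)] with n hn
      rw [dist_eq_norm]
      linarith [(hn t ht).1]
    exact this.inner tendsto_const_nhds
  deriv_weak φ hφ := h2.tendsto_integral_inner
    (.of_forall fun n => memL2Time_rotheStep_sub hT n hdu _) hdu hφ
  source_weak φ hφ := by
    have := h3.tendsto_integral_inner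
      (.of_forall fun n => memL2Time_rotheStep_sub hT n hh _) hh hφ
    simp only [RCLike.inner_apply, conj_trivial] at this
    simpa only [mul_comm] using this

end PseudoParabolic
theorem mainTheorem1 {d : ℕ} (hd : 1 ≤ d) (Ω : Set (Space d)) (hΩ : IsBoundedLipschitz Ω)
    (T : ℝ) (hT : 0 < T) (D : Data Ω) (hD : D.Admissible T) :
    ∃ (u du : ℝ → H1 Ω) (h : ℝ → ℝ),
      D.IsWeakSolution T u du h ∧
      (∀ (u₂ du₂ : ℝ → H1 Ω) (h₂ : ℝ → ℝ), D.IsWeakSolution T u₂ du₂ h₂ →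
        (∀ t ∈ Set.Icc 0 T, u₂ t = u t) ∧
        (∀ᵐ t ∂(volume.restrict (Set.Ioo 0 T)), du₂ t = du t) ∧
        (∀ᵐ t ∂(volume.restrict (Set.Ioo 0 T)), h₂ t = h t)) ∧
      (∀ n : ℕ, 1 ≤ n → ∃ (U : ℕ → H1 Ω) (H : ℕ → ℝ), D.IsRotheScheme T n U H ∧
        ∀ (U₂ : ℕ → H1 Ω) (H₂ : ℕ → ℝ), D.IsRotheScheme T n U₂ H₂ →
          (∀ i ≤ n, U₂ i = U i) ∧ ∀ i, 1 ≤ i → i ≤ n → H₂ i = H i) ∧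
      (∀ (U : ℕ → ℕ → H1 Ω) (H : ℕ → ℕ → ℝ),
        (∀ n, 1 ≤ n → D.IsRotheScheme T n (U n) (H n)) → RotheConverges T U H u du h) := by
  have hΩfin := hΩ.isFiniteMeasure_restrict
  have hσfin := isFiniteMeasure_surface hΩ
  have hclfin : IsFiniteMeasure (closureMeasure Ω) := by
    unfold closureMeasure
    infer_instance
  have h2top : Fact ((2 : ENNReal) ≠ ⊤) := ⟨by norm_num⟩
  obtain ⟨tr, htr⟩ := exists_traceL hΩ
  obtain ⟨η, κ, η₀, M, L, hv, hF, hS⟩ := hD.exists_model tr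
  obtain ⟨u, du, h, hs, huniq⟩ := hS.exists_unique_weakSolution hT
  refine ⟨u, du, h, (hv.isWeakSolution_iff htr hF).2 hs,
    fun u₂ du₂ h₂ hs₂ => huniq u₂ du₂ h₂ ((hv.isWeakSolution_iff htr hF).1 hs₂),
    fun n hn => ?_, fun U H hU => ?_⟩
  · obtain ⟨U, H, hU, hUuniq⟩ := hS.exists_unique_rotheScheme hT hn
    exact ⟨U, H, (hv.isRotheScheme_iff hT htr hF hn).2 hU,
      fun U₂ H₂ hU₂ => hUuniq U₂ H₂ ((hv.isRotheScheme_iff hT htr hF hn).1 hU₂)⟩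
  · obtain ⟨h1, h2, h3⟩ := hS.rothe_convergence hT hs fun n hn =>
      (hv.isRotheScheme_iff hT htr hF hn).1 (hU n hn)
    exact rotheConverges_of_strong hT hs.du_mem hs.h_mem h1 h2 h3
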